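/- Let $N\ge 1$, $a>0$, and consider the periodic Klein--Gordon chain $$H(x,y)=\tfrac12\sum_{j=1}^N\bigl[y_j^2+x_j^2+a(x_{j+1}-x_j)^2\bigr]+\tfrac14\sum_{j=1}^N x_j^4 ,\qquad x_{N+1}=x_1 .$$ Let $\mu=\frac{a}{1+2a}$, let $\tau$ be the $N\times N$ cyclic permutation matrix, $A=(1+2a)\,[\mathbb I-\mu(\tau+\tau^{\top})]$, and let $\Omega$ be the average of the square roots of the eigenvalues of $A$. In the canonical variables $q=A^{1/4}x$, $p=A^{-1/4}y$, $z=(q,p)\in\mathbb R^{2N}$, write $H=H_0+H_1$ (quadratic and quartic part), $H_\Omega=\frac\Omega2\sum_j(q_j^2+p_j^2)$ and $Z_0=H_0-H_\Omega$. Put $\sigma_0=-\ln(2\mu)$, $\sigma_1=\sigma_0/2$, $\sigma_*=\sigma_0/4$, and assume $\sigma_*\ge\ln 4$. A polynomial $f$ is a seed of $F$ if $F=\sum_{l=1}^N f\circ\tau^l$ ($\tau$ shifting the $q_j$ and the $p_j$ by one site). It is of class $\mathcal D(C,\sigma)$ if $f=\sum_{m=0}^{N-1} f^{(m)}$, where $f^{(m)}$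 depends only on the variables of the sites $0,\dots,m$ and the sum of the absolute values of its coefficients is at most $Ce^{-\sigma m}$. Let $C_{\zeta_0},C_{h_1}>0$ be such that $Z_0$ has a quadratic seed in $\mathcal D(C_{\zeta_0},\sigma_0)$ with $\zeta_0^{(0)}=0$, and $H_1$ has a quartic seed in $\mathcal D(C_{h_1},\sigma_1)$. Set $$E_{0*}=\frac{\min(\sigma_0-\sigma_1,\sigma_1-\sigma_*)}{\sigma_0-\sigma_*},\qquad \mu_*=\frac{\Omega(1-e^{-\sigma_0})(1-e^{-(\sigma_0-\sigma_*)})E_{0*}}{8C_{\zeta_0}e^{\sigma_1}},$$ and, for an integer $r\ge1$ with $r<\frac12\frac{\mu_*}{\mu}$, $$\gamma=2\Omega\Bigl(1-\frac{r\mu}{\mu_*}\Bigr),\qquad C_*=\frac{C_{h_1}}{\gamma(1-e^{-\sigma_0})(1-e^{-(\sigma_0-\sigma_*)})E_{0*}},\qquad C_r=64r^2C_* .$$ A resonant normal form of order $r$ consists of cyclically symmetric homogeneous polynomials $\chi_1,\dots,\chi_r$, with $\chi_s$ of degree $2s+2$ in the range of $\{H_\Omega,\cdot\}$, and of a formal sum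 $H^{(r)}=H_\Omega+\mathcal Z+P^{(r+1)}$, $\mathcal Z=Z_0+Z_1+\dots+Z_r$, where the $Z_s$ are cyclically symmetric and homogeneous of degree $2s+2$, $\{H_\Omega,Z_s\}=0$ for $0\le s\le r$, $P^{(r+1)}$ is a sum of cyclically symmetric homogeneous polynomials of even degrees $\ge 2r+4$, and $T_\chi H^{(r)}=H$ degree by degree. Here $T_\chi=\sum_{s\ge0}E_s$, $E_0=\mathrm{id}$, $E_s=\sum_{j=1}^s\frac js\{\chi_j,E_{s-j}\,\cdot\,\}$, and $\chi_s=0$ for $s>r$. There is a constant $C>0$, independent of $N$, $a$, $r$, $R$, $C_{\zeta_0}$, $C_{h_1}$, such that in the above situation a resonant normal form of order $r$ exists and the following holds for every one of them. Let $R>0$ satisfy $$R^2<\frac{2}{3(1+e)C_r}$$ and let $z(t)$ be a solution of the Hamilton equations of $H$ (in the variables $(q,p)$) whose initial datum satisfies $\|z(0)\|\le R/9$ in the euclidean norm. Then $$|H_\Omega(z(t))-H_\Omega(z(0))|\le\Omega R^4,\qquad |\mathcal Z(z(t))-\mathcal Z(z(0))|\le R^4\bigl(C_{\zeta_0}\mu+C_{h_1}R^2\bigr)$$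 for all times $$|t|\le\frac{C(1-e^{-\sigma_*})^2}{C_{h_1}}\,(R^2C_r)^{-r}.$$ -/

import Mathlib

/-! # The Klein-Gordon chain, its linear normalization and its resonant normal form

Sites are labelled by `ZMod N` (periodic boundary conditions).  Functions on the phase space are
polynomials in the variables `Sum.inl j` (positions) and `Sum.inr j` (momenta). -/

noncomputable section

namespace KGChain

open MvPolynomial

/-- Indices of the canonical coordinates of a periodic chain with `N` sites:
`Sum.inl j` is the `j`-th position, `Sum.inr j` the `j`-th momentum. -/
abbrev Coord (N : ℕ) : Type := ZMod N ⊕ ZMod N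

/-- Polynomial functions on the phase space. -/
abbrev Poly (N : ℕ) : Type := MvPolynomial (Coord N) ℝ

/-- The phase space `ℝ^{2N}` with its euclidean (`ℓ²`) norm. -/
abbrev Phase (N : ℕ) : Type := EuclideanSpace ℝ (Coord N)

/-! ## Cyclic symmetry, seeds, norms, exponential decay -/

/-- The site of a coordinate. -/
def site {N : ℕ} (i : Coord N) : ZMod N := Sum.elim id id i

/-- The action of the cyclic permutation on functions, `(τ f)(x, y) = f (τ x, τ y)` with
`(τ x)_j = x_{j+1}`. -/
def shift {N : ℕ} (f : Poly N) : Poly N :=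
  rename (Sum.map (fun j : ZMod N => j + 1) (fun j : ZMod N => j + 1)) f

/-- `F` is cyclically symmetric: `τ F = F`. -/
def IsCyclic {N : ℕ} (F : Poly N) : Prop := shift F = F

/-- The cyclically symmetric function `f^⊕ = ∑_{l=1}^N τ^l f` generated by the seed `f`. -/
def cyc {N : ℕ} (f : Poly N) : Poly N := ∑ l ∈ Finset.Icc 1 N, shift^[l] f

/-- The polynomial norm `‖f‖_1`: the sum of the absolute values of the coefficients. -/
def coeffNorm {N : ℕ} (f : Poly N) : ℝ := ∑ k ∈ f.support, |f.coeff k|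

/-- All the variables occurring in `f` belong to the sites `0, …, m`: `f` is left aligned and
has interaction distance at most `m`. -/
def LeftAligned {N : ℕ} (m : ℕ) (f : Poly N) : Prop :=
  ∀ i ∈ f.vars, (site i).val ≤ m

/-- `F = f^⊕` is a cyclically symmetric homogeneous polynomial of degree `d` whose seed
`f = ∑_m f^{(m)}` is of class `𝒟(C, σ)`: every `f^{(m)}` is left aligned with interaction
distance at most `m` and `‖f^{(m)}‖_1 ≤ C e^{-σ m}`. On a chain with `N` sites the interaction
distance is at most `N - 1`. -/
structure IsDecayingSeed {N : ℕ} (d : ℕ) (C σ : ℝ) (f : ℕ → Poly N) (F : Poly N) : Prop where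
  C_pos : 0 < C
  sigma_pos : 0 < σ
  homogeneous : ∀ m, (f m).IsHomogeneous d
  leftAligned : ∀ m, LeftAligned m (f m)
  decay : ∀ m, coeffNorm (f m) ≤ C * Real.exp (-σ * m)
  generates : cyc (∑ m ∈ Finset.range N, f m) = F

/-! ## Poisson brackets, Hamiltonian vector fields, Lie transforms -/

section Symplectic

variable {N : ℕ} [NeZero N]

/-- The canonical Poisson bracket. -/
def poisson (f g : Poly N) : Poly N :=
  ∑ j : ZMod N, (pderiv (Sum.inl j) f * pderiv (Sum.inr j) g
    - pderiv (Sum.inr j) f * pderiv (Sum.inl j) g)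

/-- The Hamiltonian vector field `(∂F/∂p, -∂F/∂q)`. -/
def hamField (F : Poly N) (z : Phase N) : Phase N :=
  WithLp.toLp 2 (Sum.elim
    (fun j => eval (fun i => z i) (pderiv (Sum.inr j) F))
    (fun j => - eval (fun i => z i) (pderiv (Sum.inl j) F)))

/-- `z` is a solution of the Hamilton equations of `F`. -/
def IsOrbit (F : Poly N) (z : ℝ → Phase N) : Prop :=
  ∀ t, HasDerivAt z (hamField F (z t)) t

/-- The homogeneous components `E_s` of the Lie transform `T_χ = ∑_s E_s` with generating
sequence `χ_1, χ_2, …`: `E_0 = id` and `E_s f = ∑_{j=1}^s (j/s) {χ_j, E_{s-j} f}`. -/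
def lieE (χ : ℕ → Poly N) : ℕ → Poly N → Poly N
  | 0, f => f
  | s + 1, f => ∑ j : Fin (s + 1),
      C (((j : ℝ) + 1) / ((s : ℝ) + 1)) * poisson (χ (j + 1)) (lieE χ (s - j) f)
termination_by s => s
decreasing_by omega

end Symplectic

/-! ## The Klein-Gordon Hamiltonian and the linear normalization -/

section Model

variable (N : ℕ) [NeZero N] (a : ℝ)

/-- Quadratic part of the Klein-Gordon Hamiltonian in the variables `x, y`:
`½ ∑ [y_j² + x_j² + a (x_{j+1} - x_j)²]`. -/
def quadXY : Poly N :=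
  C (1 / 2) * ∑ j : ZMod N, (X (Sum.inr j) ^ 2 + X (Sum.inl j) ^ 2
    + C a * (X (Sum.inl (j + 1)) - X (Sum.inl j)) ^ 2)

/-- Quartic part of the Klein-Gordon Hamiltonian in the variables `x, y`: `¼ ∑ x_j⁴`. -/
def quartXY : Poly N := C (1 / 4) * ∑ j : ZMod N, X (Sum.inl j) ^ 4

/-- The rescaled coupling `μ = a / (1 + 2a)`. -/
def mu : ℝ := a / (1 + 2 * a)

/-- The matrix of the cyclic permutation. -/
def tauMat : Matrix (ZMod N) (ZMod N) ℝ := Matrix.of fun i j => if i = j + 1 then 1 else 0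

/-- The circulant matrix `A = (1 + 2a) [1 - μ (τ + τᵀ)]` of the quadratic part. -/
def matA : Matrix (ZMod N) (ZMod N) ℝ :=
  (1 + 2 * a) • (1 - mu a • (tauMat N + (tauMat N).transpose))

theorem matA_isHermitian : (matA N a).IsHermitian := by
  ext i j
  simp [matA, Matrix.conjTranspose_apply, Matrix.one_apply, add_comm, eq_comm]

/-- Real powers `A^s` of the matrix `A`, by functional calculus. -/
def matApow (s : ℝ) : Matrix (ZMod N) (ZMod N) ℝ := cfc (fun t : ℝ => t ^ s) (matA N a)

/-- The frequency `Ω`: the average of the square roots of the eigenvalues of `A`. -/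
def Omega : ℝ := (∑ i, Real.sqrt ((matA_isHermitian N a).eigenvalues i)) / N

/-- A function of `(x, y)` expressed in the variables `q = A^{1/4} x`, `p = A^{-1/4} y`, that is,
the substitution `x = A^{-1/4} q`, `y = A^{1/4} p`. -/
def toQP (f : Poly N) : Poly N :=
  bind₁ (Sum.elim
    (fun j => ∑ k : ZMod N, C (matApow N a (-1 / 4) j k) * X (Sum.inl k))
    (fun j => ∑ k : ZMod N, C (matApow N a (1 / 4) j k) * X (Sum.inr k))) f

/-- Quadratic part `H_0` in the variables `q, p`. -/
def H0 : Poly N := toQP N a (quadXY N a)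

/-- Quartic part `H_1` in the variables `q, p`. -/
def H1 : Poly N := toQP N a (quartXY N)

/-- The full Klein-Gordon Hamiltonian in the variables `q, p`. -/
def Ham : Poly N := H0 N a + H1 N a

/-- The system of identical oscillators `H_Ω = (Ω/2) ∑ (q_j² + p_j²)`. -/
def HOmega : Poly N :=
  C (Omega N a / 2) * ∑ j : ZMod N, (X (Sum.inl j) ^ 2 + X (Sum.inr j) ^ 2)

/-- The quadratic normal form term `Z_0`, with `H_0 = H_Ω + Z_0`. -/
def Z0 : Poly N := H0 N a - HOmega N a

/-! ## The constants -/

/-- `σ_0 = -ln (2μ)`. -/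
def sigma0 : ℝ := - Real.log (2 * mu a)

/-- `σ_1 = σ_0 / 2`. -/
def sigma1 : ℝ := sigma0 a / 2

/-- `σ_* = σ_0 / 4`. -/
def sigmaStar : ℝ := sigma0 a / 4

/-- `E_{0*}`. -/
def E0star : ℝ :=
  min (sigma0 a - sigma1 a) (sigma1 a - sigmaStar a) / (sigma0 a - sigmaStar a)

/-- `μ_*`. -/
def muStar (Cζ : ℝ) : ℝ :=
  Omega N a * (1 - Real.exp (-sigma0 a)) * (1 - Real.exp (-(sigma0 a - sigmaStar a))) * E0star a
    / (8 * Cζ * Real.exp (sigma1 a))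

/-- `γ = 2 Ω (1 - r μ / μ_*)`. -/
def gammaC (Cζ : ℝ) (r : ℕ) : ℝ := 2 * Omega N a * (1 - r * mu a / muStar N a Cζ)

/-- `C_*`. -/
def Cstar (Cζ Ch : ℝ) (r : ℕ) : ℝ :=
  Ch / (gammaC N a Cζ r * (1 - Real.exp (-sigma0 a))
    * (1 - Real.exp (-(sigma0 a - sigmaStar a))) * E0star a)

/-- `C_r = 64 r² C_*`. -/
def Cr (Cζ Ch : ℝ) (r : ℕ) : ℝ := 64 * (r : ℝ) ^ 2 * Cstar N a Cζ Ch r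

/-! ## The resonant normal form -/

variable {N}

/-- `χ` is the generating sequence of the Lie transform to resonant normal form of order `r`, and
`K` the sequence of homogeneous components of the transformed Hamiltonian
`H^{(r)} = H_Ω + Z_0 + Z_1 + … + Z_r + P^{(r+1)}`: `K 0 = H_Ω + Z_0`, `K s = Z_s` for
`1 ≤ s ≤ r`, and the `K s` with `s > r` are the components of the remainder. The generating
functions are taken in the range of `{H_Ω, ·}`, and `T_χ H^{(r)} = H` is imposed degree by
degree. -/
structure IsNormalForm (r : ℕ) (χ K : ℕ → Poly N) : Prop where
  chi_homogeneous : ∀ s, (χ s).IsHomogeneous (2 * s + 2)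
  chi_cyclic : ∀ s, IsCyclic (χ s)
  chi_range : ∀ s, ∃ g : Poly N, g.IsHomogeneous (2 * s + 2) ∧ χ s = poisson (HOmega N a) g
  chi_zero : ∀ s, s = 0 ∨ r < s → χ s = 0
  ham_homogeneous : ∀ s, (K s).IsHomogeneous (2 * s + 2)
  ham_cyclic : ∀ s, IsCyclic (K s)
  ham_zero : K 0 = HOmega N a + Z0 N a
  resonant_zero : poisson (HOmega N a) (Z0 N a) = 0
  resonant : ∀ s, 1 ≤ s → s ≤ r → poisson (HOmega N a) (K s) = 0
  transform : ∀ s, ∑ j ∈ Finset.range (s + 1), lieE χ (s - j) (K j)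
    = if s = 0 then H0 N a else if s = 1 then H1 N a else 0

/-- The normal form `𝒵 = Z_0 + Z_1 + … + Z_r`. -/
def normalZ (r : ℕ) (K : ℕ → Poly N) : Poly N := Z0 N a + ∑ s ∈ Finset.Icc 1 r, K s

end Model

end KGChain

end

/-!
# Almost conserved quantities of the Klein-Gordon chain

All polynomials are measured by the supremum of their modulus on the unit ball of `ℂ^{2N}`
(`supNorm`). Homogeneity and Cauchy's estimate bound the bracket of two polynomials of degrees
`2m + 2` and `2n + 2` by `30 (m + 1) (n + 1)` times the product of their norms
(`supNorm_poisson_le`), so that `N` never enters; the norms of `Z_0` and `H_1` are at most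
`(Ω - 1) / 2` and `1 / 4` for spectral reasons. The seeds are needed only to compare the constants
of the statement with these norms: evaluating `Z_0` and `H_1` at the configuration `q = (1, …, 1)`,
`p = 0` gives `Ω - 1 ≤ 5 C_{ζ_0} μ` and `15 / 64 ≤ C_{h_1}`.

The flow of `H_Ω` is a rotation, which is periodic and preserves the ball. Averaging along it
solves the homological equation for `H_Ω`. The restriction on `r` makes `{·, Z_0}` a small
perturbation of `{·, H_Ω}` on the polynomials of degree at most `2r + 2`, so the equation with
`H_0` in place of `H_Ω` is controlled by the same estimate (`supNorm_le_of_homological`). The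
estimate gives injectivity, hence, in the finite dimensional space of cyclically symmetric
polynomials of a given degree, existence (`exists_isNormalForm`). For any normal form, the
generating functions and the terms of the Hamiltonian then grow at most geometrically with the
degree, with ratio `growth = 256 r² / Ω` (`IsNormalForm.supNorm_le`). The proof by induction uses
the equation `T_χ H^{(r)} = H` weighted by the degree, in which the generating functions act on
`H_0` and `H_1` only.

The Lie transform is a morphism for the Poisson bracket, so `T_χ` maps functions in involution
with the normal form to formal integrals of `H`. For `T_χ H_Ω` and `T_χ 𝒵`, truncated at a
suitable degree, all the terms of the derivative along the flow cancel but those of highest degree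
(`IsNormalForm.poisson_Ham_actionSum`, `IsNormalForm.poisson_Ham_normalZ`). These are of the size of
`(growth ρ²)^r` on the ball of radius `ρ`. The energy is a definite function, which confines the
orbit to the ball of radius `ρ = R / 8` for all times; there `growth ρ² ≤ R² C_r / 5`. Hence over
the times considered the truncated functions move by no more than their distance from `H_Ω` and
`𝒵`, which is of order `ρ⁴` and `(Ω - 1) ρ⁴ + ρ⁶`. The constant `C` of the statement can be taken
to be `1`.
-/

noncomputable section

namespace KGChain

open MvPolynomial Finset

/-! ### The Poisson algebra of polynomials -/

section Poisson

variable {N : ℕ} [NeZero N]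

/-- The derivation `{f, ·}` of the polynomial algebra. -/
def poissonDer (f : Poly N) : Derivation ℝ (Poly N) (Poly N) :=
  ∑ j : ZMod N, (pderiv (Sum.inl j) f • pderiv (Sum.inr j)
    - pderiv (Sum.inr j) f • pderiv (Sum.inl j))

theorem poissonDer_apply (f g : Poly N) : poissonDer f g = poisson f g := by
  have h : ∀ s : Finset (ZMod N),
      (∑ j ∈ s, (pderiv (Sum.inl j) f • pderiv (Sum.inr j)
        - pderiv (Sum.inr j) f • pderiv (Sum.inl j)) : Derivation ℝ (Poly N) (Poly N)) g
      = ∑ j ∈ s, (pderiv (Sum.inl j) f * pderiv (Sum.inr j) g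
        - pderiv (Sum.inr j) f * pderiv (Sum.inl j) g) := by
    intro s
    induction s using Finset.induction_on with
    | empty => simp
    | insert j s hj ih =>
      rw [Finset.sum_insert hj, Finset.sum_insert hj, ← ih]
      simp
  exact h Finset.univ

theorem poisson_antisymm (f g : Poly N) : poisson f g = -poisson g f := by
  rw [poisson, poisson, ← Finset.sum_neg_distrib]
  exact Finset.sum_congr rfl fun j _ => by ring

theorem poisson_self (f : Poly N) : poisson f f = 0 :=
  Finset.sum_eq_zero fun j _ => by ring

/-- The Poisson bracket as a bilinear map. -/
def poissonBilin (N : ℕ) [NeZero N] : Poly N →ₗ[ℝ] Poly N →ₗ[ℝ] Poly N :=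
  LinearMap.mk₂ ℝ poisson
    (fun f f' g => by
      rw [poisson_antisymm, ← poissonDer_apply, map_add, poissonDer_apply, poissonDer_apply,
        poisson_antisymm g f, poisson_antisymm g f', neg_add, neg_neg, neg_neg])
    (fun c f g => by
      rw [poisson_antisymm, ← poissonDer_apply, Derivation.map_smul, poissonDer_apply,
        poisson_antisymm g f, smul_neg, neg_neg])
    (fun f g g' => by rw [← poissonDer_apply, map_add, poissonDer_apply, poissonDer_apply])
    (fun c f g => by rw [← poissonDer_apply, Derivation.map_smul, poissonDer_apply])

theorem poisson_add_left (f f' g : Poly N) : poisson (f + f') g = poisson f g + poisson f' g :=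
  LinearMap.map_add₂ (poissonBilin N) f f' g

theorem poisson_add_right (f g g' : Poly N) : poisson f (g + g') = poisson f g + poisson f g' :=
  map_add (poissonBilin N f) g g'

theorem poisson_sub_right (f g g' : Poly N) : poisson f (g - g') = poisson f g - poisson f g' :=
  map_sub (poissonBilin N f) g g'

theorem poisson_neg_right (f g : Poly N) : poisson f (-g) = -poisson f g :=
  map_neg (poissonBilin N f) g

theorem poisson_smul_left (c : ℝ) (f g : Poly N) : poisson (c • f) g = c • poisson f g :=
  LinearMap.map_smul₂ (poissonBilin N) c f g

theorem poisson_smul_right (c : ℝ) (f g : Poly N) : poisson f (c • g) = c • poisson f g :=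
  map_smul (poissonBilin N f) c g

@[simp] theorem poisson_zero_left (g : Poly N) : poisson 0 g = 0 :=
  LinearMap.map_zero₂ (poissonBilin N) g

@[simp] theorem poisson_zero_right (f : Poly N) : poisson f 0 = 0 :=
  map_zero (poissonBilin N f)

theorem poisson_sum_left {ι : Type*} (s : Finset ι) (f : ι → Poly N) (g : Poly N) :
    poisson (∑ i ∈ s, f i) g = ∑ i ∈ s, poisson (f i) g :=
  LinearMap.map_sum₂ (poissonBilin N) s f g

theorem poisson_sum_right {ι : Type*} (s : Finset ι) (f : Poly N) (g : ι → Poly N) :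
    poisson f (∑ i ∈ s, g i) = ∑ i ∈ s, poisson f (g i) :=
  map_sum (poissonBilin N f) g s

theorem pderiv_comm {σ : Type*} (i j : σ) (f : MvPolynomial σ ℝ) :
    pderiv i (pderiv j f) = pderiv j (pderiv i f) := by
  classical
  have h : ⁅pderiv (R := ℝ) i, pderiv (R := ℝ) j⁆ = 0 := by
    refine derivation_ext fun k => ?_
    rw [Derivation.commutator_apply, pderiv_X, pderiv_X]
    simp [Pi.single_apply, apply_ite]
  have := DFunLike.congr_fun h f
  rwa [Derivation.commutator_apply, Derivation.zero_apply, sub_eq_zero] at this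

theorem pderiv_poisson (i : Coord N) (f g : Poly N) :
    pderiv i (poisson f g) = poisson (pderiv i f) g + poisson f (pderiv i g) := by
  rw [poisson, poisson, poisson, map_sum, ← Finset.sum_add_distrib]
  refine Finset.sum_congr rfl fun j _ => ?_
  rw [map_sub, pderiv_mul, pderiv_mul, pderiv_comm i, pderiv_comm i, pderiv_comm i, pderiv_comm i]
  ring

theorem poisson_X_inr (f : Poly N) (j : ZMod N) :
    poisson f (X (Sum.inr j)) = pderiv (Sum.inl j) f := by
  classical
  simp [poisson, pderiv_X, Pi.single_apply]

theorem poisson_X_inl (f : Poly N) (j : ZMod N) :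
    poisson f (X (Sum.inl j)) = -pderiv (Sum.inr j) f := by
  classical
  simp [poisson, pderiv_X, Pi.single_apply]

/-- The Jacobi identity. Both sides are derivations of `h`, so that it is enough to compare them
on the coordinates, where they are partial derivatives of `{f, g}`. -/
theorem poisson_jacobi (f g h : Poly N) :
    poisson f (poisson g h) = poisson (poisson f g) h + poisson g (poisson f h) := by
  have key : ⁅poissonDer f, poissonDer g⁆ = poissonDer (poisson f g) := by
    refine derivation_ext fun i => ?_
    simp only [Derivation.commutator_apply, poissonDer_apply]
    rcases i with j | j
    · rw [poisson_X_inl, poisson_X_inl, poisson_X_inl, poisson_neg_right, poisson_neg_right,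
        pderiv_poisson, poisson_antisymm g]
      ring
    · rw [poisson_X_inr, poisson_X_inr, poisson_X_inr, pderiv_poisson, poisson_antisymm g]
      ring
  have := DFunLike.congr_fun key h
  simp only [Derivation.commutator_apply, poissonDer_apply] at this
  rw [← this]
  ring

theorem isHomogeneous_poisson {f g : Poly N} {m n : ℕ} (hf : f.IsHomogeneous (2 * m + 2))
    (hg : g.IsHomogeneous (2 * n + 2)) : (poisson f g).IsHomogeneous (2 * (m + n) + 2) := by
  have h : 2 * m + 2 - 1 + (2 * n + 2 - 1) = 2 * (m + n) + 2 := by omega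
  rw [← h]
  exact IsHomogeneous.sum _ _ _ fun j _ => IsHomogeneous.sub (hf.pderiv.mul hg.pderiv)
    (hf.pderiv.mul hg.pderiv)

theorem shift_poisson (f g : Poly N) : shift (poisson f g) = poisson (shift f) (shift g) := by
  have hinj : Function.Injective
      (Sum.map (fun j : ZMod N => j + 1) (fun j : ZMod N => j + 1)) :=
    (add_left_injective _).sumMap (add_left_injective _)
  have hl : ∀ (j : ZMod N) (F : Poly N),
      shift (pderiv (Sum.inl j) F) = pderiv (Sum.inl (j + 1)) (shift F) := fun j F =>
    (pderiv_rename hinj (Sum.inl j) F).symm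
  have hr : ∀ (j : ZMod N) (F : Poly N),
      shift (pderiv (Sum.inr j) F) = pderiv (Sum.inr (j + 1)) (shift F) := fun j F =>
    (pderiv_rename hinj (Sum.inr j) F).symm
  have hR : poisson (shift f) (shift g) = ∑ j : ZMod N,
      (shift (pderiv (Sum.inl j) f) * shift (pderiv (Sum.inr j) g)
        - shift (pderiv (Sum.inr j) f) * shift (pderiv (Sum.inl j) g)) := by
    rw [poisson, ← Equiv.sum_comp (Equiv.addRight (1 : ZMod N))]
    simp only [Equiv.coe_addRight, hl, hr]
  rw [hR]
  simp only [poisson, shift, map_sum, map_sub, map_mul]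

theorem IsCyclic.poisson {f g : Poly N} (hf : IsCyclic f) (hg : IsCyclic g) :
    IsCyclic (KGChain.poisson f g) := by
  rw [IsCyclic, shift_poisson, hf, hg]

end Poisson

/-! ### Lie transforms -/

section LieTransform

variable {N : ℕ} [NeZero N]

theorem lieE_zero (χ : ℕ → Poly N) (f : Poly N) : lieE χ 0 f = f := by rw [lieE]

/-- The recursion for the components of the Lie transform, solved for `s E_s`. -/
theorem smul_lieE (χ : ℕ → Poly N) (s : ℕ) (f : Poly N) :
    (s : ℝ) • lieE χ s f
      = ∑ p ∈ antidiagonal s, (p.1 : ℝ) • poisson (χ p.1) (lieE χ p.2 f) := by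
  rcases s with _ | s
  · simp
  · rw [lieE, Finset.Nat.sum_antidiagonal_succ, Finset.Nat.sum_antidiagonal_eq_sum_range_succ_mk,
      Finset.smul_sum, Fin.sum_univ_eq_sum_range (fun j => ((s + 1 : ℕ) : ℝ) •
        (C (((j : ℝ) + 1) / ((s : ℝ) + 1)) * poisson (χ (j + 1)) (lieE χ (s - j) f)))]
    simp only [Nat.cast_zero, zero_smul, zero_add]
    refine Finset.sum_congr rfl fun j _ => ?_
    rw [← smul_eq_C_mul, smul_smul]
    congr 1
    push_cast
    field_simp

/-- The sequence `E_s f` is the only one that satisfies the recursion. -/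
theorem lieE_unique {χ u : ℕ → Poly N} {n : ℕ}
    (h : ∀ s ≤ n, (s : ℝ) • u s = ∑ p ∈ antidiagonal s, (p.1 : ℝ) • poisson (χ p.1) (u p.2)) :
    ∀ s ≤ n, u s = lieE χ s (u 0) := by
  intro s
  induction s using Nat.strong_induction_on with
  | _ s ih =>
    intro hs
    rcases Nat.eq_zero_or_pos s with rfl | hpos
    · rw [lieE_zero]
    · have h0 : (s : ℝ) ≠ 0 := by exact_mod_cast hpos.ne'
      apply smul_right_injective (Poly N) h0
      simp only
      rw [h s hs, smul_lieE]
      refine Finset.sum_congr rfl fun p hp => ?_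
      rw [Finset.HasAntidiagonal.mem_antidiagonal] at hp
      rcases Nat.eq_zero_or_pos p.1 with h1 | h1
      · simp [h1]
      · rw [ih p.2 (by omega) (by omega)]

theorem lieE_add (χ : ℕ → Poly N) (s : ℕ) (f g : Poly N) :
    lieE χ s (f + g) = lieE χ s f + lieE χ s g := by
  have := lieE_unique (χ := χ) (u := fun s => lieE χ s f + lieE χ s g) (n := s)
    (fun s _ => by simp only [smul_add, smul_lieE, poisson_add_right, Finset.sum_add_distrib])
    s le_rfl
  simp only [lieE_zero] at this
  exact this.symm

theorem lieE_smul (χ : ℕ → Poly N) (s : ℕ) (c : ℝ) (f : Poly N) :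
    lieE χ s (c • f) = c • lieE χ s f := by
  have := lieE_unique (χ := χ) (u := fun s => c • lieE χ s f) (n := s)
    (fun s _ => by
      simp only [smul_comm _ c, smul_lieE, poisson_smul_right, Finset.smul_sum])
    s le_rfl
  simp only [lieE_zero] at this
  exact this.symm

theorem lieE_zero_right (χ : ℕ → Poly N) (s : ℕ) : lieE χ s 0 = 0 := by
  simpa using lieE_smul χ s 0 0

/-- `E_s` involves the generating functions up to the index `s` only. -/
theorem lieE_congr {χ χ' : ℕ → Poly N} {n : ℕ} (h : ∀ j, 1 ≤ j → j ≤ n → χ j = χ' j) (f : Poly N) :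
    ∀ s ≤ n, lieE χ s f = lieE χ' s f := by
  intro s hs
  have := lieE_unique (χ := χ') (u := fun s => lieE χ s f) (n := n) (fun s hs => by
    simp only [smul_lieE]
    refine Finset.sum_congr rfl fun p hp => ?_
    rw [Finset.HasAntidiagonal.mem_antidiagonal] at hp
    rcases Nat.eq_zero_or_pos p.1 with h1 | h1
    · simp [h1]
    · rw [h p.1 h1 (by omega)]) s hs
  simpa only [lieE_zero] using this

omit [NeZero N] in
theorem isHomogeneous_smul {f : Poly N} {d : ℕ} (hf : f.IsHomogeneous d) (c : ℝ) :
    (c • f).IsHomogeneous d :=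
  (homogeneousSubmodule (Coord N) ℝ d).smul_mem c hf

/-- A property of sequences of polynomials that is additive, homogeneous and stable under the
brackets with the generating functions is inherited by the components of the Lie transform. -/
theorem lieE_mem {χ : ℕ → Poly N} {V : ℕ → Submodule ℝ (Poly N)} {m : ℕ} {f : Poly N}
    (hf : f ∈ V m)
    (hV : ∀ j k g, 1 ≤ j → g ∈ V k → poisson (χ j) g ∈ V (j + k)) (s : ℕ) :
    lieE χ s f ∈ V (s + m) := by
  induction s using Nat.strong_induction_on with
  | _ s ih =>
    rcases Nat.eq_zero_or_pos s with rfl | hpos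
    · rw [lieE_zero, zero_add]; exact hf
    · have h0 : (s : ℝ) ≠ 0 := by exact_mod_cast hpos.ne'
      rw [← Submodule.smul_mem_iff _ h0, smul_lieE]
      refine Submodule.sum_mem _ fun p hp => ?_
      rw [Finset.HasAntidiagonal.mem_antidiagonal] at hp
      rcases Nat.eq_zero_or_pos p.1 with h1 | h1
      · simp [h1]
      · refine Submodule.smul_mem _ _ ?_
        have := hV p.1 (p.2 + m) _ h1 (ih p.2 (by omega))
        rwa [← add_assoc, hp] at this

/-- The space of cyclically symmetric polynomials, homogeneous of degree `2 m + 2`. -/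
def cycHom (N : ℕ) (m : ℕ) : Submodule ℝ (Poly N) where
  carrier := {f | f.IsHomogeneous (2 * m + 2) ∧ IsCyclic f}
  add_mem' := fun {f g} hf hg => ⟨hf.1.add hg.1, by
    have h1 := hf.2; have h2 := hg.2
    simp only [IsCyclic, shift, map_add] at *
    rw [h1, h2]⟩
  zero_mem' := ⟨isHomogeneous_zero _ _ _, by simp [IsCyclic, shift]⟩
  smul_mem' := fun c f hf => ⟨(homogeneousSubmodule (Coord N) ℝ _).smul_mem c hf.1, by
    have h1 := hf.2
    simp only [IsCyclic, shift, map_smul] at *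
    rw [h1]⟩

theorem poisson_mem_cycHom {f g : Poly N} {m n : ℕ} (hf : f ∈ cycHom N m) (hg : g ∈ cycHom N n) :
    poisson f g ∈ cycHom N (m + n) :=
  ⟨isHomogeneous_poisson hf.1 hg.1, hf.2.poisson hg.2⟩

theorem lieE_isHomogeneous {χ : ℕ → Poly N} (hχ : ∀ j, (χ j).IsHomogeneous (2 * j + 2))
    {m : ℕ} {f : Poly N} (hf : f.IsHomogeneous (2 * m + 2)) (s : ℕ) :
    (lieE χ s f).IsHomogeneous (2 * (s + m) + 2) :=
  lieE_mem (V := fun m => homogeneousSubmodule (Coord N) ℝ (2 * m + 2)) hf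
    (fun j _ _ _ hg => isHomogeneous_poisson (hχ j) hg) s

theorem sum_antidiagonal_assoc {M : Type*} [AddCommMonoid M] (F : ℕ → ℕ → ℕ → M) (s : ℕ) :
    ∑ p ∈ antidiagonal s, ∑ q ∈ antidiagonal p.1, F q.1 q.2 p.2
      = ∑ p ∈ antidiagonal s, ∑ q ∈ antidiagonal p.2, F p.1 q.1 q.2 := by
  rw [Finset.sum_sigma', Finset.sum_sigma']
  refine Finset.sum_nbij' (fun x => ⟨(x.2.1, x.2.2 + x.1.2), (x.2.2, x.1.2)⟩)
    (fun x => ⟨(x.1.1 + x.2.1, x.2.2), (x.1.1, x.2.1)⟩) ?_ ?_ ?_ ?_ ?_ <;>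
  · rintro ⟨⟨a, b⟩, ⟨c, d⟩⟩ h
    simp only [Finset.mem_sigma, Finset.HasAntidiagonal.mem_antidiagonal] at h ⊢
    all_goals first
      | rfl
      | exact ⟨by omega, trivial⟩
      | (obtain ⟨h1, h2⟩ := h; subst h2; rfl)

theorem sum_antidiagonal_left_comm {M : Type*} [AddCommMonoid M] (F : ℕ → ℕ → ℕ → M) (s : ℕ) :
    ∑ p ∈ antidiagonal s, ∑ q ∈ antidiagonal p.2, F p.1 q.1 q.2
      = ∑ p ∈ antidiagonal s, ∑ q ∈ antidiagonal p.2, F q.1 p.1 q.2 := by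
  rw [Finset.sum_sigma', Finset.sum_sigma']
  refine Finset.sum_nbij' (fun x => ⟨(x.2.1, x.1.1 + x.2.2), (x.1.1, x.2.2)⟩)
    (fun x => ⟨(x.2.1, x.1.1 + x.2.2), (x.1.1, x.2.2)⟩) ?_ ?_ ?_ ?_ ?_ <;>
  · rintro ⟨⟨a, b⟩, ⟨c, d⟩⟩ h
    simp only [Finset.mem_sigma, Finset.HasAntidiagonal.mem_antidiagonal] at h ⊢
    all_goals first
      | rfl
      | exact ⟨by omega, trivial⟩
      | (obtain ⟨h1, h2⟩ := h; subst h2; rfl)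

/-- The Lie transform is a morphism for the Poisson bracket, degree by degree. -/
theorem lieE_poisson (χ : ℕ → Poly N) (f g : Poly N) (s : ℕ) :
    lieE χ s (poisson f g)
      = ∑ p ∈ antidiagonal s, poisson (lieE χ p.1 f) (lieE χ p.2 g) := by
  have := lieE_unique (χ := χ) (n := s)
    (u := fun s => ∑ p ∈ antidiagonal s, poisson (lieE χ p.1 f) (lieE χ p.2 g)) (fun s _ => by
      have h1 : ∀ p ∈ antidiagonal s, (s : ℝ) • poisson (lieE χ p.1 f) (lieE χ p.2 g)
          = (∑ q ∈ antidiagonal p.1,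
              (q.1 : ℝ) • poisson (poisson (χ q.1) (lieE χ q.2 f)) (lieE χ p.2 g))
            + ∑ q ∈ antidiagonal p.2,
              (q.1 : ℝ) • poisson (lieE χ p.1 f) (poisson (χ q.1) (lieE χ q.2 g)) := by
        intro p hp
        have hs : (s : ℝ) = p.1 + p.2 := by
          rw [Finset.HasAntidiagonal.mem_antidiagonal] at hp; exact_mod_cast hp.symm
        rw [hs, add_smul, ← poisson_smul_left, ← poisson_smul_right, smul_lieE, smul_lieE,
          poisson_sum_left, poisson_sum_right]
        simp only [poisson_smul_left, poisson_smul_right]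
      simp only [Finset.smul_sum, poisson_sum_right]
      rw [Finset.sum_congr rfl h1, Finset.sum_add_distrib]
      have h2 : ∀ j k l : ℕ, (j : ℝ) • poisson (χ j) (poisson (lieE χ k f) (lieE χ l g))
          = (j : ℝ) • poisson (poisson (χ j) (lieE χ k f)) (lieE χ l g)
            + (j : ℝ) • poisson (lieE χ k f) (poisson (χ j) (lieE χ l g)) := fun j k l => by
        rw [poisson_jacobi, smul_add]
      simp only [h2, Finset.sum_add_distrib]
      rw [sum_antidiagonal_assoc (fun j k l =>
          (j : ℝ) • poisson (poisson (χ j) (lieE χ k f)) (lieE χ l g)),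
        sum_antidiagonal_left_comm (fun k j l =>
          (j : ℝ) • poisson (lieE χ k f) (poisson (χ j) (lieE χ l g)))]) s le_rfl
  simpa [lieE_zero] using this.symm

end LieTransform

/-! ### The supremum norm on the complex unit ball -/

section SupNorm

variable {σ : Type*} [Fintype σ]

/-- The supremum of `|F|` over the unit ball of `ℂ^σ` for the euclidean norm. The
estimates of derivatives in this norm do not involve the number of variables. -/
def supNorm (F : MvPolynomial σ ℝ) : ℝ :=
  ⨆ z : Metric.closedBall (0 : EuclideanSpace ℂ σ) 1, ‖aeval (fun i => z.1 i) F‖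

omit [Fintype σ] in
theorem continuous_aeval (F : MvPolynomial σ ℝ) :
    Continuous fun z : EuclideanSpace ℂ σ => aeval (fun i => z i) F := by
  have h : (fun z : EuclideanSpace ℂ σ => aeval (fun i => z i) F)
      = fun z => eval (fun i => z i) (MvPolynomial.map (algebraMap ℝ ℂ) F) := by
    funext z; rw [eval_map, aeval_def]
  rw [h]
  exact (MvPolynomial.continuous_eval _).comp (by fun_prop)

theorem norm_aeval_le_of_norm_le_one (F : MvPolynomial σ ℝ) {z : EuclideanSpace ℂ σ}
    (hz : ‖z‖ ≤ 1) : ‖aeval (fun i => z i) F‖ ≤ supNorm F := by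
  have hb : BddAbove (Set.range fun z : Metric.closedBall (0 : EuclideanSpace ℂ σ) 1 =>
      ‖aeval (fun i => z.1 i) F‖) := by
    have h := (isCompact_closedBall (0 : EuclideanSpace ℂ σ) 1).bddAbove_image
      (continuous_aeval F).norm.continuousOn
    rwa [Set.image_eq_range] at h
  exact le_ciSup hb ⟨z, by simpa using hz⟩

theorem supNorm_le {F : MvPolynomial σ ℝ} {M : ℝ}
    (h : ∀ z : EuclideanSpace ℂ σ, ‖z‖ ≤ 1 → ‖aeval (fun i => z i) F‖ ≤ M) : supNorm F ≤ M := by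
  have : Nonempty (Metric.closedBall (0 : EuclideanSpace ℂ σ) 1) := ⟨⟨0, by simp⟩⟩
  exact ciSup_le fun z => h z.1 (mem_closedBall_zero_iff.mp z.2)

theorem supNorm_nonneg (F : MvPolynomial σ ℝ) : 0 ≤ supNorm F :=
  (norm_nonneg _).trans (norm_aeval_le_of_norm_le_one F (z := 0) (by simp))

theorem supNorm_add_le (F G : MvPolynomial σ ℝ) : supNorm (F + G) ≤ supNorm F + supNorm G :=
  supNorm_le fun z hz => by
    rw [map_add]
    exact (norm_add_le _ _).trans (add_le_add (norm_aeval_le_of_norm_le_one F hz)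
      (norm_aeval_le_of_norm_le_one G hz))

@[simp] theorem supNorm_zero : supNorm (0 : MvPolynomial σ ℝ) = 0 :=
  le_antisymm (supNorm_le fun z _ => by simp) (supNorm_nonneg _)

theorem supNorm_smul_le (c : ℝ) (F : MvPolynomial σ ℝ) : supNorm (c • F) ≤ |c| * supNorm F :=
  supNorm_le fun z hz => by
    rw [map_smul, norm_smul, Real.norm_eq_abs]
    exact mul_le_mul_of_nonneg_left (norm_aeval_le_of_norm_le_one F hz) (abs_nonneg c)

theorem supNorm_neg (F : MvPolynomial σ ℝ) : supNorm (-F) = supNorm F := by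
  simp [supNorm]

theorem supNorm_sub_le (F G : MvPolynomial σ ℝ) : supNorm (F - G) ≤ supNorm F + supNorm G := by
  rw [sub_eq_add_neg, ← supNorm_neg G]
  exact supNorm_add_le _ _

theorem supNorm_sum_le {ι : Type*} (s : Finset ι) (F : ι → MvPolynomial σ ℝ) :
    supNorm (∑ i ∈ s, F i) ≤ ∑ i ∈ s, supNorm (F i) :=
  Finset.le_sum_of_subadditive supNorm supNorm_zero.le supNorm_add_le s F

theorem aeval_smul_of_isHomogeneous {A : Type*} [CommRing A] [Algebra ℝ A] {τ : Type*}
    {F : MvPolynomial τ ℝ} {d : ℕ} (hF : F.IsHomogeneous d) (c : A) (z : τ → A) :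
    aeval (fun i => c * z i) F = c ^ d * aeval z F := by
  rw [aeval_def, aeval_def, eval₂_eq, eval₂_eq, Finset.mul_sum]
  refine Finset.sum_congr rfl fun k hk => ?_
  have hd : k.sum (fun _ e => e) = d := by
    have := hF (mem_support_iff.mp hk)
    rw [← this, Finsupp.weight_apply]
    simp
  simp only [mul_pow, Finset.prod_mul_distrib, Finset.prod_pow_eq_pow_sum]
  rw [← hd, Finsupp.sum]
  ring

theorem norm_aeval_le {F : MvPolynomial σ ℝ} {d : ℕ} (hF : F.IsHomogeneous d)
    (z : EuclideanSpace ℂ σ) : ‖aeval (fun i => z i) F‖ ≤ supNorm F * ‖z‖ ^ d := by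
  rcases eq_or_ne z 0 with rfl | hz
  · rcases Nat.eq_zero_or_pos d with rfl | hd
    · simpa using norm_aeval_le_of_norm_le_one F (z := 0) (by simp)
    · have := aeval_smul_of_isHomogeneous hF (0 : ℂ) (fun _ : σ => (0 : ℂ))
      simp only [mul_zero, zero_pow hd.ne', zero_mul] at this
      simp [this, hd.ne']
  · have hz' : (‖z‖ : ℂ) ≠ 0 := by exact_mod_cast norm_ne_zero_iff.mpr hz
    have h1 : ‖((‖z‖ : ℂ)⁻¹ • z)‖ ≤ 1 := by
      rw [norm_smul, norm_inv, Complex.norm_real, norm_norm,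
        inv_mul_cancel₀ (norm_ne_zero_iff.mpr hz)]
    have h3 : ∀ i, z i = (‖z‖ : ℂ) * ((‖z‖ : ℂ)⁻¹ • z) i := fun i => by
      rw [PiLp.smul_apply, smul_eq_mul, mul_inv_cancel_left₀ hz']
    generalize (‖z‖ : ℂ)⁻¹ • z = w at h1 h3
    have h2 := aeval_smul_of_isHomogeneous hF (‖z‖ : ℂ) (fun i => w i)
    simp only [← h3] at h2
    rw [h2, norm_mul, norm_pow, Complex.norm_real, norm_norm, mul_comm]
    exact mul_le_mul_of_nonneg_right (norm_aeval_le_of_norm_le_one F h1) (by positivity)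

/-- Real points are points of the complex phase space. -/
def complexify {σ : Type*} (z : EuclideanSpace ℝ σ) : EuclideanSpace ℂ σ :=
  WithLp.toLp 2 fun i => (z i : ℂ)

theorem norm_complexify (z : EuclideanSpace ℝ σ) : ‖complexify z‖ = ‖z‖ := by
  simp [complexify, EuclideanSpace.norm_eq]

omit [Fintype σ] in
theorem aeval_complexify (z : EuclideanSpace ℝ σ) (F : MvPolynomial σ ℝ) :
    aeval (fun i => complexify z i) F = ((eval (fun i => z i) F : ℝ) : ℂ) := by
  have := aeval_algebraMap_apply ℂ (fun i => z i) F
  simpa [complexify, Function.comp_def] using this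

theorem abs_eval_le {F : MvPolynomial σ ℝ} {d : ℕ} (hF : F.IsHomogeneous d)
    (z : EuclideanSpace ℝ σ) : |eval (fun i => z i) F| ≤ supNorm F * ‖z‖ ^ d := by
  have := norm_aeval_le hF (complexify z)
  rwa [aeval_complexify, Complex.norm_real, norm_complexify] at this

theorem eq_zero_of_supNorm_eq_zero {F : MvPolynomial σ ℝ} {d : ℕ} (hF : F.IsHomogeneous d)
    (h : supNorm F = 0) : F = 0 := by
  refine MvPolynomial.funext fun x => ?_
  have := abs_eval_le hF (WithLp.toLp 2 x)
  rw [h, zero_mul] at this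
  simpa using abs_nonpos_iff.mp this

/-- The chain rule. The parameter and the values of the variables range over fields and algebras
that may differ, such as a real time and complex coordinates. -/
theorem hasDerivAt_aeval {τ 𝕜 A : Type*} [Fintype τ] [NontriviallyNormedField 𝕜]
    [NormedCommRing A] [NormedAlgebra 𝕜 A] [Algebra ℝ A] (F : MvPolynomial τ ℝ) {z : 𝕜 → τ → A}
    {z' : τ → A} {t : 𝕜} (hz : ∀ i, HasDerivAt (fun t => z t i) (z' i) t) :
    HasDerivAt (fun t => aeval (z t) F) (∑ i, z' i * aeval (z t) (pderiv i F)) t := by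
  classical
  induction F using MvPolynomial.induction_on with
  | C c => simpa using hasDerivAt_const t (algebraMap ℝ A c)
  | add F G hF hG =>
    simp only [map_add, mul_add, Finset.sum_add_distrib]
    exact hF.add hG
  | mul_X F i hF =>
    simp only [map_mul, aeval_X]
    refine (hF.mul (hz i)).congr_deriv ?_
    simp only [pderiv_mul, map_add, map_mul, aeval_X, mul_add, Finset.sum_add_distrib,
      Finset.sum_mul, pderiv_X]
    congr 1
    · exact Finset.sum_congr rfl fun j _ => by ring
    · rw [Finset.sum_eq_single i]
      · simp [mul_comm]
      · intro j _ hj; simp [hj.symm]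
      · simp

/-- Cauchy's estimate on a disc of radius `1 / d`: the derivative of a homogeneous polynomial of
degree `d` costs a factor `e d`, whatever the number of variables. -/
theorem norm_sum_pderiv_le {F : MvPolynomial σ ℝ} {d : ℕ} (hF : F.IsHomogeneous d) (hd : 1 ≤ d)
    {z : EuclideanSpace ℂ σ} (hz : ‖z‖ ≤ 1) (w : EuclideanSpace ℂ σ) :
    ‖∑ i, w i * aeval (fun i => z i) (pderiv i F)‖ ≤ Real.exp 1 * d * supNorm F * ‖w‖ := by
  have hd0 : (0 : ℝ) < d := by exact_mod_cast hd
  have key : ∀ u : EuclideanSpace ℂ σ, ‖u‖ ≤ 1 →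
      ‖∑ i, u i * aeval (fun i => z i) (pderiv i F)‖ ≤ Real.exp 1 * d * supNorm F := by
    intro u hu
    have hderiv : ∀ c : ℂ, HasDerivAt (fun c : ℂ => aeval (fun i => (z + c • u) i) F)
        (∑ i, u i * aeval (fun i => (z + c • u) i) (pderiv i F)) c := fun c =>
      hasDerivAt_aeval F (z := fun c i => (z + c • u) i) (z' := fun i => u i) fun i => by
        simpa using ((hasDerivAt_id c).mul_const (u i)).const_add (z i)
    have hdiff : Differentiable ℂ fun c : ℂ => aeval (fun i => (z + c • u) i) F :=
      fun c => (hderiv c).differentiableAt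
    have hb : ∀ c ∈ Metric.sphere (0 : ℂ) (1 / d),
        ‖aeval (fun i => (z + c • u) i) F‖ ≤ supNorm F * Real.exp 1 := by
      intro c hc
      refine (norm_aeval_le hF _).trans (mul_le_mul_of_nonneg_left ?_ (supNorm_nonneg F))
      have hc' : ‖c‖ = 1 / d := by simpa using hc
      have h1 : ‖z + c • u‖ ≤ Real.exp (1 / d) := by
        calc ‖z + c • u‖ ≤ ‖z‖ + ‖c‖ * ‖u‖ := (norm_add_le _ _).trans (by rw [norm_smul])
          _ ≤ 1 + 1 / d * 1 := by rw [hc']; gcongr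
          _ ≤ Real.exp (1 / d) := by rw [mul_one, add_comm]; exact Real.add_one_le_exp _
      calc ‖z + c • u‖ ^ d ≤ Real.exp (1 / d) ^ d := by gcongr
        _ = Real.exp 1 := by
          rw [← Real.exp_nat_mul]
          congr 1
          field_simp
    have h := Complex.norm_deriv_le_of_forall_mem_sphere_norm_le (by positivity)
      hdiff.diffContOnCl hb
    rw [(hderiv 0).deriv] at h
    simp only [zero_smul, add_zero] at h
    refine h.trans (le_of_eq ?_)
    field_simp
  rcases eq_or_ne w 0 with rfl | hw
  · simp
  · have hw' : (‖w‖ : ℂ) ≠ 0 := by exact_mod_cast norm_ne_zero_iff.mpr hw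
    have h1 : ‖((‖w‖ : ℂ)⁻¹ • w)‖ ≤ 1 := by
      rw [norm_smul, norm_inv, Complex.norm_real, norm_norm,
        inv_mul_cancel₀ (norm_ne_zero_iff.mpr hw)]
    have h2 := key _ h1
    have h3 : ∑ i, w i * aeval (fun i => z i) (pderiv i F)
        = (‖w‖ : ℂ) * ∑ i, ((‖w‖ : ℂ)⁻¹ • w) i * aeval (fun i => z i) (pderiv i F) := by
      rw [Finset.mul_sum]
      refine Finset.sum_congr rfl fun i _ => ?_
      simp only [PiLp.smul_apply, smul_eq_mul, ← mul_assoc, mul_inv_cancel₀ hw', one_mul]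
    rw [h3, norm_mul, Complex.norm_real, norm_norm, mul_comm]
    exact mul_le_mul_of_nonneg_right h2 (norm_nonneg w)

/-- The gradient of a homogeneous polynomial of degree `d` has norm at most `e d ‖F‖` on the unit
ball. -/
theorem norm_gradient_le {F : MvPolynomial σ ℝ} {d : ℕ} (hF : F.IsHomogeneous d) (hd : 1 ≤ d)
    {z : EuclideanSpace ℂ σ} (hz : ‖z‖ ≤ 1) :
    ‖(WithLp.toLp 2 fun i => aeval (fun i => z i) (pderiv i F) : EuclideanSpace ℂ σ)‖
      ≤ Real.exp 1 * d * supNorm F := by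
  set g : EuclideanSpace ℂ σ := WithLp.toLp 2 fun i => aeval (fun i => z i) (pderiv i F) with hg
  have h := norm_sum_pderiv_le hF hd hz (WithLp.toLp 2 fun i => (starRingEnd ℂ) (g i))
  have hn : ‖(WithLp.toLp 2 fun i => (starRingEnd ℂ) (g i) : EuclideanSpace ℂ σ)‖ = ‖g‖ := by
    simp [EuclideanSpace.norm_eq]
  have hs : ∑ i, (starRingEnd ℂ) (g i) * aeval (fun i => z i) (pderiv i F)
      = ((‖g‖ ^ 2 : ℝ) : ℂ) := by
    rw [EuclideanSpace.norm_sq_eq]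
    push_cast
    refine Finset.sum_congr rfl fun i _ => ?_
    rw [mul_comm, hg]
    exact Complex.mul_conj' _
  rw [hn] at h
  simp only [hs] at h
  rw [Complex.norm_real, Real.norm_of_nonneg (by positivity), pow_two] at h
  rcases (norm_nonneg g).eq_or_lt with h0 | h0
  · rw [← h0]
    have := supNorm_nonneg F
    positivity
  · exact le_of_mul_le_mul_right h h0

end SupNorm

/-! ### The bracket in the supremum norm -/

section Bracket

variable {N : ℕ} [NeZero N]

theorem aeval_poisson (F G : Poly N) (z : EuclideanSpace ℂ (Coord N)) :
    aeval (fun i => z i) (poisson F G)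
      = ∑ i, Sum.elim (fun j => -aeval (fun i => z i) (pderiv (Sum.inr j) F))
          (fun j => aeval (fun i => z i) (pderiv (Sum.inl j) F)) i
          * aeval (fun i => z i) (pderiv i G) := by
  simp only [poisson, map_sum, map_sub, map_mul, Fintype.sum_sum_type, Sum.elim_inl, Sum.elim_inr]
  rw [← Finset.sum_add_distrib]
  exact Finset.sum_congr rfl fun j _ => by ring

/-- The bracket of two polynomials is the derivative of the second along the Hamiltonian field of
the first, up to sign, so that Cauchy's estimate applies to both factors. -/
theorem supNorm_poisson_le {F G : Poly N} {m n : ℕ} (hF : F.IsHomogeneous (2 * m + 2))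
    (hG : G.IsHomogeneous (2 * n + 2)) :
    supNorm (poisson F G) ≤ 30 * (m + 1) * (n + 1) * supNorm F * supNorm G := by
  have he : Real.exp 1 ^ 2 ≤ 30 / 4 := by
    have := Real.exp_one_lt_d9
    have := Real.exp_pos 1
    nlinarith
  have h0 := supNorm_nonneg F
  have h1 := supNorm_nonneg G
  refine supNorm_le fun z hz => ?_
  rw [aeval_poisson]
  set w : EuclideanSpace ℂ (Coord N) := WithLp.toLp 2
    (Sum.elim (fun j => -aeval (fun i => z i) (pderiv (Sum.inr j) F))
      (fun j => aeval (fun i => z i) (pderiv (Sum.inl j) F))) with hw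
  have hwn : ‖w‖ ≤ Real.exp 1 * (2 * m + 2 : ℕ) * supNorm F := by
    refine le_of_eq_of_le ?_ (norm_gradient_le hF (by omega) hz)
    simp [hw, EuclideanSpace.norm_eq, Fintype.sum_sum_type, add_comm]
  calc _ ≤ Real.exp 1 * (2 * n + 2 : ℕ) * supNorm G * ‖w‖ :=
        norm_sum_pderiv_le hG (by omega) hz w
    _ ≤ Real.exp 1 * (2 * n + 2 : ℕ) * supNorm G * (Real.exp 1 * (2 * m + 2 : ℕ) * supNorm F) := by
        gcongr
    _ = Real.exp 1 ^ 2 * (4 * (m + 1) * (n + 1) * supNorm F * supNorm G) := by push_cast; ring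
    _ ≤ 30 / 4 * (4 * (m + 1) * (n + 1) * supNorm F * supNorm G) := by gcongr
    _ = _ := by ring

end Bracket

/-! ### The flow of the identical oscillators -/

section Rotation

variable {N : ℕ} [NeZero N]

/-- The rotation by the angle `θ` in each plane `(q_j, p_j)`, on the complex phase space: up to the
time scale `Ω` and the direction of time, the flow of `H_Ω`. -/
def rot (θ : ℝ) (z : EuclideanSpace ℂ (Coord N)) : EuclideanSpace ℂ (Coord N) :=
  WithLp.toLp 2 (Sum.elim
    (fun j => (Real.cos θ : ℂ) * z (Sum.inl j) - (Real.sin θ : ℂ) * z (Sum.inr j))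
    (fun j => (Real.sin θ : ℂ) * z (Sum.inl j) + (Real.cos θ : ℂ) * z (Sum.inr j)))

omit [NeZero N] in
theorem rot_zero (z : EuclideanSpace ℂ (Coord N)) : rot 0 z = z := by
  ext i
  rcases i with j | j <;> simp [rot]

theorem norm_rot (θ : ℝ) (z : EuclideanSpace ℂ (Coord N)) : ‖rot θ z‖ = ‖z‖ := by
  rw [EuclideanSpace.norm_eq, EuclideanSpace.norm_eq]
  congr 1
  simp only [Fintype.sum_sum_type, rot, Sum.elim_inl, Sum.elim_inr]
  rw [← Finset.sum_add_distrib, ← Finset.sum_add_distrib]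
  refine Finset.sum_congr rfl fun j _ => ?_
  simp only [Complex.sq_norm, Complex.normSq_apply, Complex.sub_re, Complex.sub_im, Complex.add_re,
    Complex.add_im, Complex.mul_re, Complex.mul_im, Complex.ofReal_re, Complex.ofReal_im]
  have := Real.sin_sq_add_cos_sq θ
  linear_combination ((z (Sum.inl j)).re ^ 2 + (z (Sum.inl j)).im ^ 2 + (z (Sum.inr j)).re ^ 2
    + (z (Sum.inr j)).im ^ 2) * this

omit [NeZero N] in
/-- The rotations by `π / 2` and `-π / 2` differ by `z ↦ -z`. -/
theorem aeval_rot_pi_div_two {F : Poly N} {m : ℕ} (hF : F.IsHomogeneous (2 * m + 2))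
    (z : EuclideanSpace ℂ (Coord N)) :
    aeval (fun i => rot (Real.pi / 2) z i) F = aeval (fun i => rot (-(Real.pi / 2)) z i) F := by
  have h := aeval_smul_of_isHomogeneous hF (-1 : ℂ) (fun i => rot (-(Real.pi / 2)) z i)
  have h1 : (-1 : ℂ) ^ (2 * m + 2) = 1 := Even.neg_one_pow ⟨m + 1, by ring⟩
  rw [h1, one_mul] at h
  rw [← h]
  congr 2
  funext i
  rcases i with j | j <;> simp [rot]

theorem pderiv_HOmega (a : ℝ) (i : Coord N) : pderiv i (HOmega N a) = C (Omega N a) * X i := by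
  classical
  have h2 : (C (Omega N a / 2) : Poly N) * 2 = C (Omega N a) := by
    have : (2 : Poly N) = C 2 := (map_ofNat C 2).symm
    rw [this, ← C_mul]; congr 1; ring
  rcases i with i | i <;>
  · simp only [HOmega, pderiv_C_mul, map_sum, map_add, pderiv_pow, pderiv_X]
    simp [Pi.single_apply, ← h2, mul_assoc]

theorem hasDerivAt_aeval_rot (a : ℝ) (F : Poly N) (z : EuclideanSpace ℂ (Coord N)) (θ : ℝ) :
    HasDerivAt (fun θ : ℝ => (Omega N a : ℂ) * aeval (fun i => rot θ z i) F)
      (aeval (fun i => rot θ z i) (poisson (HOmega N a) F)) θ := by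
  have hc : HasDerivAt (fun θ : ℝ => ((Real.cos θ : ℝ) : ℂ)) ((-Real.sin θ : ℝ) : ℂ) θ :=
    (Real.hasDerivAt_cos θ).ofReal_comp
  have hs : HasDerivAt (fun θ : ℝ => ((Real.sin θ : ℝ) : ℂ)) ((Real.cos θ : ℝ) : ℂ) θ :=
    (Real.hasDerivAt_sin θ).ofReal_comp
  have h := (hasDerivAt_aeval F (z := fun θ i => rot θ z i)
    (z' := Sum.elim (fun j => -rot θ z (Sum.inr j)) (fun j => rot θ z (Sum.inl j))) (t := θ)
    fun i => by
      rcases i with j | j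
      · refine ((hc.mul_const (z (Sum.inl j))).sub (hs.mul_const (z (Sum.inr j)))).congr_deriv ?_
        simp [rot]; ring
      · refine ((hs.mul_const (z (Sum.inl j))).add (hc.mul_const (z (Sum.inr j)))).congr_deriv ?_
        simp [rot]; ring).const_mul (Omega N a : ℂ)
  refine h.congr_deriv ?_
  rw [aeval_poisson, Finset.mul_sum]
  refine Finset.sum_congr rfl fun i _ => ?_
  rcases i with j | j <;> simp [pderiv_HOmega] <;> ring

/-- Invariants of `H_Ω` are constant along its flow. -/
theorem aeval_rot_eq {a : ℝ} (hΩ : 0 < Omega N a) {F : Poly N} (hF : poisson (HOmega N a) F = 0)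
    (z : EuclideanSpace ℂ (Coord N)) (θ : ℝ) :
    aeval (fun i => rot θ z i) F = aeval (fun i => z i) F := by
  have hd : ∀ θ, HasDerivAt (fun θ : ℝ => (Omega N a : ℂ) * aeval (fun i => rot θ z i) F) 0 θ :=
    fun θ => by simpa [hF] using hasDerivAt_aeval_rot a F z θ
  have h := is_const_of_deriv_eq_zero (fun θ => (hd θ).differentiableAt)
    (fun θ => (hd θ).deriv) θ 0
  have h0 : (Omega N a : ℂ) ≠ 0 := by exact_mod_cast hΩ.ne'
  simpa [rot_zero, h0] using h

/-- The divisors of `H_Ω`: on the range of `{H_Ω, ·}`, where functions have zero average along the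
flow, a function is bounded by its derivative along the flow. The flow has period `π / Ω` on
polynomials of even degree. -/
theorem supNorm_le_of_range {a : ℝ} (hΩ : 0 < Omega N a) {g : Poly N} {m : ℕ}
    (hg : g.IsHomogeneous (2 * m + 2)) :
    supNorm (poisson (HOmega N a) g)
      ≤ Real.pi / (4 * Omega N a) * supNorm (poisson (HOmega N a) (poisson (HOmega N a) g)) := by
  set χ := poisson (HOmega N a) g with hχ
  set K := supNorm (poisson (HOmega N a) χ) / Omega N a with hK
  refine supNorm_le fun z hz => ?_
  set c : ℝ → ℂ := fun θ => aeval (fun i => rot θ z i) χ with hc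
  have hcd : ∀ θ, HasDerivAt c
      ((Omega N a : ℂ)⁻¹ * aeval (fun i => rot θ z i) (poisson (HOmega N a) χ)) θ := fun θ => by
    have h := (hasDerivAt_aeval_rot a χ z θ).const_mul (Omega N a : ℂ)⁻¹
    have h0 : (Omega N a : ℂ) ≠ 0 := by exact_mod_cast hΩ.ne'
    simpa only [inv_mul_cancel_left₀ h0] using h
  have hcb : ∀ θ, ‖(Omega N a : ℂ)⁻¹ * aeval (fun i => rot θ z i) (poisson (HOmega N a) χ)‖ ≤ K :=
    fun θ => by
      rw [norm_mul, norm_inv, Complex.norm_real, Real.norm_of_nonneg hΩ.le, hK, div_eq_inv_mul]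
      gcongr
      exact norm_aeval_le_of_norm_le_one _ ((norm_rot θ z).trans_le hz)
  have hlip : ∀ θ, ‖c θ - c 0‖ ≤ K * |θ| := fun θ => by
    simpa using Convex.norm_image_sub_le_of_norm_hasDerivWithin_le (s := Set.univ) (x := 0) (y := θ)
      (fun x _ => (hcd x).hasDerivWithinAt) (fun x _ => hcb x) convex_univ trivial trivial
  have hG := fun θ => hasDerivAt_aeval_rot a g z θ
  -- the symmetric difference of a primitive of `c`, compared with its linear part
  have hf : ∀ θ, HasDerivAt (fun θ : ℝ => (Omega N a : ℂ) * aeval (fun i => rot θ z i) g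
      - (Omega N a : ℂ) * aeval (fun i => rot (-θ) z i) g - ((2 * θ : ℝ) : ℂ) * c 0)
      ((c θ - c 0) + (c (-θ) - c 0)) θ := fun θ => by
    have h2 : HasDerivAt (fun θ : ℝ => ((2 * θ : ℝ) : ℂ)) ((2 : ℝ) : ℂ) θ :=
      (by simpa using (hasDerivAt_id θ).const_mul (2 : ℝ) :
        HasDerivAt (fun θ : ℝ => 2 * θ) 2 θ).ofReal_comp
    have h3 := (hG (-θ)).scomp θ (hasDerivAt_neg θ)
    refine (((hG θ).sub h3).sub (h2.mul_const (c 0))).congr_deriv ?_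
    simp only [hc, neg_smul, one_smul]
    push_cast
    ring
  have hpi : (0 : ℝ) ≤ Real.pi / 2 := by positivity
  have hmain := image_norm_le_of_norm_deriv_right_le_deriv_boundary (a := 0) (b := Real.pi / 2)
    (B := fun θ => K * θ ^ 2) (B' := fun θ => 2 * K * θ)
    (fun θ _ => (hf θ).continuousAt.continuousWithinAt)
    (fun θ _ => (hf θ).hasDerivWithinAt) (by simp)
    (fun θ => by
      refine ((hasDerivAt_pow 2 θ).const_mul K).congr_deriv ?_
      simp; ring)
    (fun θ hθ => by
      have h1 := hlip θ
      have h2 := hlip (-θ)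
      rw [abs_neg] at h2
      rw [abs_of_nonneg hθ.1] at h1 h2
      refine (norm_add_le _ _).trans ?_
      linarith) (Set.right_mem_Icc.mpr hpi)
  rw [aeval_rot_pi_div_two hg, sub_self, zero_sub, norm_neg, norm_mul, Complex.norm_real,
    Real.norm_of_nonneg (by positivity)] at hmain
  have h0 : c 0 = aeval (fun i => z i) χ := by rw [hc]; simp only [rot_zero]
  rw [h0] at hmain
  have hpi' := Real.pi_pos
  have : Real.pi * ‖aeval (fun i => z i) χ‖ ≤ Real.pi * (K * Real.pi / 4) := by
    linarith [hmain, show K * (Real.pi / 2) ^ 2 = Real.pi * (K * Real.pi / 4) by ring]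
  refine (le_of_mul_le_mul_left this hpi').trans (le_of_eq ?_)
  rw [hK]
  field_simp

/-- The average along the flow of `H_Ω` does not increase the norm. -/
theorem supNorm_le_of_average {a : ℝ} (hΩ : 0 < Omega N a) {g Z : Poly N} {m : ℕ}
    (hg : g.IsHomogeneous (2 * m + 2)) (hZ : poisson (HOmega N a) Z = 0) :
    supNorm Z ≤ supNorm (poisson (HOmega N a) g + Z) := by
  refine supNorm_le fun z hz => ?_
  have hpi := Real.pi_pos
  have hf : ∀ θ : ℝ, HasDerivAt (fun θ : ℝ => (Omega N a : ℂ) * aeval (fun i => rot θ z i) g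
      + (θ : ℂ) * aeval (fun i => z i) Z)
      (aeval (fun i => rot θ z i) (poisson (HOmega N a) g + Z)) θ := fun θ => by
    have h1 : HasDerivAt (fun θ : ℝ => (θ : ℂ)) ((1 : ℝ) : ℂ) θ := (hasDerivAt_id θ).ofReal_comp
    refine ((hasDerivAt_aeval_rot a g z θ).add (h1.mul_const _)).congr_deriv ?_
    rw [map_add, aeval_rot_eq hΩ hZ]
    simp
  have h := Convex.norm_image_sub_le_of_norm_hasDerivWithin_le (s := Set.univ)
    (x := -(Real.pi / 2)) (y := Real.pi / 2) (fun θ _ => (hf θ).hasDerivWithinAt)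
    (fun θ _ => norm_aeval_le_of_norm_le_one (poisson (HOmega N a) g + Z)
      ((norm_rot θ z).trans_le hz)) convex_univ trivial trivial
  have h2 : ((Real.pi / 2 : ℝ) : ℂ) * aeval (fun i => z i) Z
      - ((-(Real.pi / 2) : ℝ) : ℂ) * aeval (fun i => z i) Z
      = ((Real.pi : ℝ) : ℂ) * aeval (fun i => z i) Z := by push_cast; ring
  rw [aeval_rot_pi_div_two hg, add_sub_add_left_eq_sub, h2, norm_mul, Complex.norm_real,
    Real.norm_of_nonneg hpi.le, show Real.pi / 2 - -(Real.pi / 2) = Real.pi by ring,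
    Real.norm_of_nonneg hpi.le, mul_comm] at h
  exact le_of_mul_le_mul_right h hpi

theorem isHomogeneous_HOmega (a : ℝ) : (HOmega N a).IsHomogeneous (2 * 0 + 2) := by
  rw [HOmega, ← smul_eq_C_mul]
  exact isHomogeneous_smul (IsHomogeneous.sum _ _ _ fun j _ =>
    (isHomogeneous_X_pow _ _).add (isHomogeneous_X_pow _ _)) _

theorem isCyclic_HOmega (a : ℝ) : IsCyclic (HOmega N a) := by
  simp only [IsCyclic, HOmega, shift, map_mul, map_sum, map_add, map_pow, rename_X, rename_C,
    Sum.map_inl, Sum.map_inr]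
  congr 1
  exact Equiv.sum_comp (Equiv.addRight (1 : ZMod N))
    (fun j => (X (Sum.inl j) ^ 2 + X (Sum.inr j) ^ 2 : Poly N))

theorem supNorm_HOmega_le {a : ℝ} (hΩ : 0 < Omega N a) :
    supNorm (HOmega N a) ≤ Omega N a / 2 := by
  refine supNorm_le fun z hz => ?_
  have h1 : aeval (fun i => z i) (HOmega N a) = ((Omega N a / 2 : ℝ) : ℂ) * ∑ i, z i ^ 2 := by
    simp only [HOmega, map_mul, map_sum, map_add, map_pow, aeval_X, Fintype.sum_sum_type,
      ← Finset.sum_add_distrib, aeval_C]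
    rfl
  rw [h1, norm_mul, Complex.norm_real, Real.norm_of_nonneg (by positivity)]
  have h2 : ‖∑ i, z i ^ 2‖ ≤ ‖z‖ ^ 2 := by
    rw [EuclideanSpace.norm_sq_eq]
    exact (norm_sum_le _ _).trans (le_of_eq (by simp))
  have h3 : ‖z‖ ^ 2 ≤ 1 := pow_le_one₀ (norm_nonneg z) hz
  have h4 : 0 ≤ Omega N a / 2 := by positivity
  nlinarith

/-- The homological equation `{χ, H_Ω + W} + Z = G` for a small perturbation `W` of `H_Ω` that
Poisson commutes with it, with `χ` in the range and `Z` in the kernel of `{H_Ω, ·}`. -/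
theorem supNorm_le_of_homological {a : ℝ} (hΩ : 0 < Omega N a) {W g Z G : Poly N} {b : ℝ} {m : ℕ}
    (hW : W.IsHomogeneous (2 * 0 + 2)) (hcomm : poisson (HOmega N a) W = 0)
    (hWb : supNorm W ≤ b / 2) (hb : 48 * (m + 1) * b ≤ Omega N a)
    (hg : g.IsHomogeneous (2 * m + 2)) (hZ : poisson (HOmega N a) Z = 0)
    (hG : poisson (poisson (HOmega N a) g) (HOmega N a + W) + Z = G) :
    supNorm Z ≤ supNorm G ∧
      supNorm (poisson (HOmega N a) g) ≤ 21 / (10 * Omega N a) * supNorm G := by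
  set Ω := Omega N a with hΩd
  set χ := poisson (HOmega N a) g with hχ
  have hχh : χ.IsHomogeneous (2 * m + 2) := by
    have := isHomogeneous_poisson (isHomogeneous_HOmega a) hg
    rwa [zero_add] at this
  have hrange : G = poisson (HOmega N a) (poisson g W - χ) + Z := by
    rw [← hG, poisson_add_right, poisson_sub_right, poisson_jacobi _ g W, hcomm,
      poisson_zero_right, add_zero, poisson_antisymm χ (HOmega N a)]
    ring
  have hZG : supNorm Z ≤ supNorm G := by
    rw [hrange]
    have h1 := isHomogeneous_poisson hg hW
    rw [add_zero] at h1
    exact supNorm_le_of_average hΩ (h1.sub hχh) hZ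
  refine ⟨hZG, ?_⟩
  have hL : poisson (HOmega N a) χ = poisson χ W + Z - G := by
    rw [← hG, poisson_add_right, poisson_antisymm χ (HOmega N a)]
    ring
  have h1 := supNorm_le_of_range hΩ hg
  rw [← hχ, hL] at h1
  have h2 : supNorm (poisson χ W + Z - G) ≤ 30 * (m + 1) * supNorm χ * (b / 2) + 2 * supNorm G := by
    have h3 := supNorm_poisson_le hχh hW
    have h4 : 30 * ((m : ℝ) + 1) * ((0 : ℕ) + 1) * supNorm χ * supNorm W
        ≤ 30 * (m + 1) * supNorm χ * (b / 2) := by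
      have := supNorm_nonneg χ
      simp only [Nat.cast_zero, zero_add, mul_one]
      gcongr
    linarith [h3.trans h4, supNorm_sub_le (poisson χ W + Z) G, supNorm_add_le (poisson χ W) Z]
  have hχ0 := supNorm_nonneg χ
  have hG0 := supNorm_nonneg G
  have hpi : Real.pi / (4 * Ω) ≤ 315 / 400 / Ω := by
    rw [div_le_div_iff₀ (by positivity) hΩ]
    nlinarith [Real.pi_lt_d2]
  have h5 : supNorm (poisson χ W + Z - G) ≤ 15 / 48 * Ω * supNorm χ + 2 * supNorm G := by
    nlinarith [mul_le_mul_of_nonneg_right hb hχ0]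
  have h6 : supNorm χ ≤ 315 / 400 / Ω * (15 / 48 * Ω * supNorm χ + 2 * supNorm G) :=
    h1.trans (mul_le_mul hpi h5 (supNorm_nonneg _) (by positivity))
  have h7 : 315 / 400 / Ω * (15 / 48 * Ω * supNorm χ + 2 * supNorm G)
      = 315 / 400 * (15 / 48) * supNorm χ + 315 / 200 * (supNorm G / Ω) := by
    field_simp
    ring
  have h8 : 21 / (10 * Ω) * supNorm G = 21 / 10 * (supNorm G / Ω) := by
    field_simp
  have h9 : 0 ≤ supNorm G / Ω := by positivity
  rw [h8]
  rw [h7] at h6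
  linarith

end Rotation

/-! ### Spectral bounds for the linear normalization -/

section Spectral

variable {N : ℕ} [NeZero N] {a : ℝ}

theorem continuousOn_spectrum_matA (f : ℝ → ℝ) : ContinuousOn f (spectrum ℝ (matA N a)) :=
  Matrix.finite_real_spectrum.continuousOn f

theorem isSelfAdjoint_matA : IsSelfAdjoint (matA N a) := matA_isHermitian N a

theorem matA_mulVec (ha : 0 < a) (u : ZMod N → ℝ) (j : ZMod N) :
    (matA N a).mulVec u j = (1 + 2 * a) * u j - a * (u (j - 1) + u (j + 1)) := by
  have h : (1 + 2 * a) * mu a = a := by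
    rw [mu]; field_simp
  have h1 : ∀ k, j = k + 1 ↔ k = j - 1 := fun k => by
    rw [eq_sub_iff_add_eq, eq_comm]
  simp only [matA, Matrix.smul_mulVec, Matrix.sub_mulVec, Matrix.add_mulVec, Matrix.one_mulVec,
    Pi.smul_apply, Pi.sub_apply, Pi.add_apply, smul_eq_mul]
  have h2 : (tauMat N).mulVec u j = u (j - 1) := by
    simp [tauMat, Matrix.mulVec, dotProduct, h1]
  have h3 : (tauMat N).transpose.mulVec u j = u (j + 1) := by
    simp [tauMat, Matrix.mulVec, dotProduct, Matrix.transpose_apply]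
  rw [h2, h3]
  linear_combination -(u (j - 1) + u (j + 1)) * h

theorem dotProduct_matA_mulVec (ha : 0 < a) (u : ZMod N → ℝ) :
    ∑ j, u j * (matA N a).mulVec u j = ∑ j, (u j ^ 2 + a * (u (j + 1) - u j) ^ 2) := by
  have h1 : ∑ j, u j * u (j - 1) = ∑ j, u (j + 1) * u j := by
    rw [← Equiv.sum_comp (Equiv.addRight (1 : ZMod N))]
    simp
  have h2 : ∑ j, u (j + 1) ^ 2 = ∑ j, u j ^ 2 :=
    Equiv.sum_comp (Equiv.addRight (1 : ZMod N)) (fun j => u j ^ 2)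
  have h3 : ∑ j, u j * (matA N a).mulVec u j
      = (1 + 2 * a) * ∑ j, u j ^ 2 - a * (∑ j, u j * u (j - 1) + ∑ j, u (j + 1) * u j) := by
    rw [Finset.mul_sum, ← Finset.sum_add_distrib, Finset.mul_sum, ← Finset.sum_sub_distrib]
    exact Finset.sum_congr rfl fun j _ => by rw [matA_mulVec ha]; ring
  have h4 : ∑ j, (u j ^ 2 + a * (u (j + 1) - u j) ^ 2)
      = ∑ j, u j ^ 2 + a * (∑ j, u (j + 1) ^ 2 + ∑ j, u j ^ 2 - 2 * ∑ j, u (j + 1) * u j) := by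
    rw [Finset.mul_sum, ← Finset.sum_add_distrib, ← Finset.sum_sub_distrib, Finset.mul_sum,
      ← Finset.sum_add_distrib]
    exact Finset.sum_congr rfl fun j _ => by ring
  rw [h3, h4, h1, h2]
  ring

theorem eigenvalue_matA (ha : 0 < a) (i : ZMod N) : ∃ v : ZMod N → ℝ, ∑ j, v j ^ 2 = 1 ∧
    (matA_isHermitian N a).eigenvalues i = ∑ j, (v j ^ 2 + a * (v (j + 1) - v j) ^ 2) := by
  set hA := matA_isHermitian N a
  set v : ZMod N → ℝ := fun j => hA.eigenvectorBasis i j with hv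
  have hn : ∑ j, v j ^ 2 = 1 := by
    have h := hA.eigenvectorBasis.orthonormal.1 i
    rw [EuclideanSpace.norm_eq, Real.sqrt_eq_one] at h
    simpa using h
  refine ⟨v, hn, ?_⟩
  rw [← dotProduct_matA_mulVec ha]
  have h := hA.mulVec_eigenvectorBasis i
  have h' : ∀ j, (matA N a).mulVec v j = hA.eigenvalues i * v j := fun j => congrFun h j
  simp only [h']
  calc hA.eigenvalues i = hA.eigenvalues i * ∑ j, v j ^ 2 := by rw [hn, mul_one]
    _ = _ := by rw [Finset.mul_sum]; exact Finset.sum_congr rfl fun j _ => by ring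

theorem one_le_eigenvalue (ha : 0 < a) (i : ZMod N) :
    1 ≤ (matA_isHermitian N a).eigenvalues i := by
  obtain ⟨v, hv, h⟩ := eigenvalue_matA ha i
  rw [h, ← hv]
  exact Finset.sum_le_sum fun j _ => by nlinarith [sq_nonneg (v (j + 1) - v j)]

theorem eigenvalue_le (ha : 0 < a) (i : ZMod N) :
    (matA_isHermitian N a).eigenvalues i ≤ 1 + 4 * a := by
  obtain ⟨v, hv, h⟩ := eigenvalue_matA ha i
  have h2 : ∑ j, v (j + 1) ^ 2 = ∑ j, v j ^ 2 :=
    Equiv.sum_comp (Equiv.addRight (1 : ZMod N)) (fun j => v j ^ 2)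
  calc (matA_isHermitian N a).eigenvalues i
      ≤ ∑ j, (v j ^ 2 + a * (2 * v (j + 1) ^ 2 + 2 * v j ^ 2)) := by
        rw [h]
        refine Finset.sum_le_sum fun j _ => ?_
        nlinarith [sq_nonneg (v (j + 1) + v j)]
    _ = 1 + 4 * a := by
        rw [Finset.sum_add_distrib, ← Finset.mul_sum, Finset.sum_add_distrib, ← Finset.mul_sum,
          ← Finset.mul_sum, h2, hv]
        ring

theorem natCast_pos : (0 : ℝ) < N := by exact_mod_cast Nat.pos_of_neZero N

theorem one_le_Omega (ha : 0 < a) : 1 ≤ Omega N a := by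
  rw [Omega, le_div_iff₀ natCast_pos, one_mul]
  calc (N : ℝ) = ∑ _i : ZMod N, (1 : ℝ) := by simp
    _ ≤ _ := Finset.sum_le_sum fun i _ => by
      rw [Real.one_le_sqrt]; exact one_le_eigenvalue ha i

theorem Omega_le (ha : 0 < a) : Omega N a ≤ 1 + 2 * a := by
  rw [Omega, div_le_iff₀ natCast_pos]
  calc _ ≤ ∑ _i : ZMod N, (1 + 2 * a) := Finset.sum_le_sum fun i _ => by
        rw [Real.sqrt_le_left (by linarith)]
        nlinarith [eigenvalue_le ha i]
    _ = _ := by simp; ring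

/-- The eigenvalues of `A^{1/2}` lie in `[1, 2 Ω - 1]`: as the trace of `A` is `N (1 + 2 a)`, the
average `Ω` of the eigenvalues of `A^{1/2}` is not below the midpoint of `[1, √(1 + 4 a)]`. -/
theorem sqrt_eigenvalue_le (ha : 0 < a) (i : ZMod N) :
    Real.sqrt ((matA_isHermitian N a).eigenvalues i) ≤ 2 * Omega N a - 1 := by
  by_cases hN : N = 1
  · subst hN
    have h1 : ∀ i, (matA_isHermitian 1 a).eigenvalues i = 1 := fun i => by
      obtain ⟨v, hv, h⟩ := eigenvalue_matA ha i
      rw [h, ← hv]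
      refine Finset.sum_congr rfl fun j _ => ?_
      rw [Subsingleton.elim (j + 1) j]
      ring
    have hΩ : Omega 1 a = 1 := by simp [Omega, h1]
    rw [h1, hΩ]
    norm_num
  · have hN2 : 1 < N := by have := Nat.pos_of_neZero N; omega
    have : Fact (1 < N) := ⟨hN2⟩
    set s := Real.sqrt (1 + 4 * a) with hs
    have hs2 : s ^ 2 = 1 + 4 * a := Real.sq_sqrt (by linarith)
    have hs1 : 1 ≤ s := by rw [hs, Real.one_le_sqrt]; linarith
    have htr : ∑ i, (matA_isHermitian N a).eigenvalues i = N * (1 + 2 * a) := by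
      have h := (matA_isHermitian N a).trace_eq_sum_eigenvalues
      simp only [RCLike.ofReal_real_eq_id, id] at h
      rw [← h]
      simp [Matrix.trace, matA, tauMat]
      ring
    have hk : ∀ i, (matA_isHermitian N a).eigenvalues i - 1
        ≤ (1 + s) * (Real.sqrt ((matA_isHermitian N a).eigenvalues i) - 1) := fun i => by
      set l := (matA_isHermitian N a).eigenvalues i
      have h1 : 1 ≤ l := one_le_eigenvalue ha i
      have h2 : Real.sqrt l ^ 2 = l := Real.sq_sqrt (by linarith)
      have h3 : Real.sqrt l ≤ s := Real.sqrt_le_sqrt (eigenvalue_le ha i)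
      have h4 : 1 ≤ Real.sqrt l := by rw [Real.one_le_sqrt]; exact h1
      nlinarith [mul_nonneg (sub_nonneg.2 h3) (sub_nonneg.2 h4)]
    have hsum := Finset.sum_le_sum fun i (_ : i ∈ Finset.univ) => hk i
    rw [← Finset.mul_sum, Finset.sum_sub_distrib, Finset.sum_sub_distrib, htr] at hsum
    have hΩ : ∑ i, Real.sqrt ((matA_isHermitian N a).eigenvalues i) = N * Omega N a := by
      rw [Omega]; field_simp [natCast_pos.ne']
    rw [hΩ] at hsum
    simp only [Finset.sum_const, Finset.card_univ, ZMod.card, nsmul_eq_mul, mul_one] at hsum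
    have h5 : 2 * a ≤ (1 + s) * (Omega N a - 1) := by
      have hN0 : (0 : ℝ) < N := natCast_pos
      have : (N : ℝ) * (2 * a) ≤ N * ((1 + s) * (Omega N a - 1)) := by linarith
      exact le_of_mul_le_mul_left this hN0
    have h6 : s ≤ 2 * Omega N a - 1 := by
      have : (s + 1) * (s - 1) ≤ (s + 1) * (2 * (Omega N a - 1)) := by nlinarith
      have := le_of_mul_le_mul_left this (by linarith)
      linarith
    exact (Real.sqrt_le_sqrt (eigenvalue_le ha i)).trans h6

theorem mem_spectrum_matA (ha : 0 < a) {t : ℝ} (ht : t ∈ spectrum ℝ (matA N a)) :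
    1 ≤ t ∧ Real.sqrt t ≤ 2 * Omega N a - 1 := by
  rw [(matA_isHermitian N a).spectrum_real_eq_range_eigenvalues] at ht
  obtain ⟨i, rfl⟩ := ht
  exact ⟨one_le_eigenvalue ha i, sqrt_eigenvalue_le ha i⟩

theorem cfc_matA_transpose (f : ℝ → ℝ) :
    (cfc f (matA N a)).transpose = cfc f (matA N a) := by
  have h : IsSelfAdjoint (cfc f (matA N a)) := cfc_predicate f _
  have h' : (cfc f (matA N a)).conjTranspose = cfc f (matA N a) := h
  ext i j
  simpa using congrFun (congrFun h' i) j

theorem cfc_matA_mul (f g : ℝ → ℝ) :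
    cfc f (matA N a) * cfc g (matA N a) = cfc (fun t => f t * g t) (matA N a) :=
  (cfc_mul f g (matA N a) (continuousOn_spectrum_matA f) (continuousOn_spectrum_matA g)).symm

theorem sum_sq_mulVec (f : ℝ → ℝ) (u : ZMod N → ℝ) :
    ∑ j, (cfc f (matA N a)).mulVec u j ^ 2
      = ∑ j, u j * (cfc (fun t => f t * f t) (matA N a)).mulVec u j := by
  set M := cfc f (matA N a) with hM
  have h : dotProduct (M.mulVec u) (M.mulVec u) = dotProduct u ((M * M).mulVec u) := by
    rw [← Matrix.mulVec_mulVec, Matrix.dotProduct_mulVec u M, ← Matrix.mulVec_transpose,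
      cfc_matA_transpose]
  rw [← cfc_matA_mul]
  simpa [dotProduct, pow_two] using h

/-- A function of `A` that is bounded by `c` on the spectrum has norm at most `c`. -/
theorem sum_sq_mulVec_le {f : ℝ → ℝ} {c : ℝ} (hf : ∀ t ∈ spectrum ℝ (matA N a), |f t| ≤ c)
    (u : ZMod N → ℝ) :
    ∑ j, (cfc f (matA N a)).mulVec u j ^ 2 ≤ c ^ 2 * ∑ j, u j ^ 2 := by
  have h1 := sum_sq_mulVec (a := a) f u
  have h2 := sum_sq_mulVec (a := a) (fun t => Real.sqrt (c ^ 2 - f t * f t)) u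
  have h3 : cfc (fun t => Real.sqrt (c ^ 2 - f t * f t) * Real.sqrt (c ^ 2 - f t * f t)) (matA N a)
      = c ^ 2 • (1 : Matrix (ZMod N) (ZMod N) ℝ) - cfc (fun t => f t * f t) (matA N a) := by
    rw [← Algebra.algebraMap_eq_smul_one, ← cfc_const (c ^ 2) (matA N a) isSelfAdjoint_matA,
      ← cfc_sub _ _ _ (continuousOn_spectrum_matA _) (continuousOn_spectrum_matA _)]
    refine cfc_congr fun t ht => Real.mul_self_sqrt ?_
    have := abs_le.mp (hf t ht)
    nlinarith
  have h4 : ∑ j, u j * (cfc (fun t => Real.sqrt (c ^ 2 - f t * f t)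
      * Real.sqrt (c ^ 2 - f t * f t)) (matA N a)).mulVec u j
      = c ^ 2 * ∑ j, u j ^ 2 - ∑ j, u j * (cfc (fun t => f t * f t) (matA N a)).mulVec u j := by
    rw [h3, Finset.mul_sum, ← Finset.sum_sub_distrib]
    refine Finset.sum_congr rfl fun j _ => ?_
    simp only [Matrix.sub_mulVec, Matrix.smul_mulVec, Matrix.one_mulVec, Pi.sub_apply,
      Pi.smul_apply, smul_eq_mul]
    ring
  have h5 : 0 ≤ ∑ j, (cfc (fun t => Real.sqrt (c ^ 2 - f t * f t)) (matA N a)).mulVec u j ^ 2 :=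
    Finset.sum_nonneg fun j _ => sq_nonneg _
  rw [h2, h4, ← h1] at h5
  linarith

theorem sum_norm_sq_le {f : ℝ → ℝ} {c : ℝ} (hf : ∀ t ∈ spectrum ℝ (matA N a), |f t| ≤ c)
    (w : ZMod N → ℂ) :
    ∑ j, ‖∑ k, (cfc f (matA N a) j k : ℂ) * w k‖ ^ 2 ≤ c ^ 2 * ∑ j, ‖w j‖ ^ 2 := by
  have h1 := sum_sq_mulVec_le hf (fun k => (w k).re)
  have h2 := sum_sq_mulVec_le hf (fun k => (w k).im)
  have h3 : ∀ v : ℂ, ‖v‖ ^ 2 = v.re ^ 2 + v.im ^ 2 := fun v => by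
    rw [Complex.sq_norm, Complex.normSq_apply]; ring
  simp only [h3, Finset.sum_add_distrib, mul_add, Complex.re_sum, Complex.im_sum,
    Complex.re_ofReal_mul, Complex.im_ofReal_mul]
  exact add_le_add h1 h2

/-- The constant vector is an eigenvector of `A` for the eigenvalue `1`. -/
theorem cfc_matA_mulVec_one (ha : 0 < a) (f : ℝ → ℝ) (j : ZMod N) :
    ∑ k, cfc f (matA N a) j k = f 1 := by
  have h0 : (matA N a).mulVec (fun _ => 1) = fun _ => 1 := by
    funext j; rw [matA_mulVec ha]; ring
  have h1 : cfc f (matA N a) = cfc (fun t => (f t - f 1) / (t - 1)) (matA N a) * (matA N a - 1)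
      + f 1 • (1 : Matrix (ZMod N) (ZMod N) ℝ) := by
    have h2 : matA N a - 1 = cfc (fun t : ℝ => t - 1) (matA N a) := by
      rw [cfc_sub _ _ _ (continuousOn_spectrum_matA _) (continuousOn_spectrum_matA _),
        cfc_id' ℝ (matA N a) isSelfAdjoint_matA, cfc_const_one ℝ (matA N a) isSelfAdjoint_matA]
    rw [h2, cfc_matA_mul, ← Algebra.algebraMap_eq_smul_one,
      ← cfc_add_const _ _ _ (continuousOn_spectrum_matA _) isSelfAdjoint_matA]
    refine cfc_congr fun t _ => ?_
    rcases eq_or_ne t 1 with rfl | ht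
    · simp
    · have : t - 1 ≠ 0 := sub_ne_zero.mpr ht
      field_simp
      ring
  have h3 : (cfc f (matA N a)).mulVec (fun _ => 1) = fun _ => f 1 := by
    rw [h1, Matrix.add_mulVec, ← Matrix.mulVec_mulVec, Matrix.sub_mulVec, h0, Matrix.one_mulVec,
      sub_self, Matrix.mulVec_zero, zero_add, Matrix.smul_mulVec, Matrix.one_mulVec]
    funext j
    simp
  have := congrFun h3 j
  simpa [Matrix.mulVec, dotProduct] using this

/-- Functions of `A` commute with the cyclic permutation. -/
theorem cfc_matA_add_one (f : ℝ → ℝ) (j k : ZMod N) :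
    cfc f (matA N a) (j + 1) (k + 1) = cfc f (matA N a) j k := by
  have hτ : tauMat N * (tauMat N).transpose = (tauMat N).transpose * tauMat N := by
    ext i l
    simp only [Matrix.mul_apply, tauMat, Matrix.transpose_apply, Matrix.of_apply, mul_ite, mul_one,
      mul_zero]
    have h1 : ∀ x : ZMod N, i = x + 1 ↔ x = i - 1 := fun x => by
      rw [eq_sub_iff_add_eq, eq_comm]
    have h2 : ∀ x : ZMod N, l = x + 1 ↔ x = l - 1 := fun x => by
      rw [eq_sub_iff_add_eq, eq_comm]
    simp [h1, h2]
  have hcomm : Commute (matA N a) (tauMat N) := by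
    rw [matA]
    refine Commute.smul_left (Commute.sub_left (Commute.one_left _) (Commute.smul_left
      (Commute.add_left (Commute.refl _) hτ.symm) _)) _
  have h := hcomm.cfc_real f
  have h1 := congrFun (congrFun h.eq (j + 1)) k
  simpa [Matrix.mul_apply, tauMat] using h1

end Spectral

/-! ### The Klein-Gordon Hamiltonian in the variables `q, p` -/

section Hamiltonian

variable {N : ℕ} [NeZero N] {a : ℝ}

theorem matApow_mul (ha : 0 < a) (s t : ℝ) :
    matApow N a s * matApow N a t = matApow N a (s + t) := by
  rw [matApow, matApow, cfc_matA_mul, matApow]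
  refine cfc_congr fun x hx => ?_
  have := (mem_spectrum_matA ha hx).1
  exact (Real.rpow_add (by linarith) s t).symm

theorem matApow_one : matApow N a 1 = matA N a := by
  simp only [matApow, Real.rpow_one]
  exact cfc_id' ℝ (matA N a) isSelfAdjoint_matA

theorem matApow_transpose (s : ℝ) : (matApow N a s).transpose = matApow N a s :=
  cfc_matA_transpose _

theorem dotProduct_matApow_mulVec (B : Matrix (ZMod N) (ZMod N) ℝ) (s : ℝ) (u : ZMod N → ℝ) :
    ∑ j, (matApow N a s).mulVec u j * B.mulVec ((matApow N a s).mulVec u) j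
      = ∑ j, u j * (matApow N a s * B * matApow N a s).mulVec u j := by
  set M := matApow N a s with hM
  have h : dotProduct (M.mulVec u) (B.mulVec (M.mulVec u))
      = dotProduct u ((M * B * M).mulVec u) := by
    rw [← Matrix.mulVec_mulVec, ← Matrix.mulVec_mulVec, Matrix.dotProduct_mulVec u M,
      ← Matrix.mulVec_transpose, matApow_transpose]
  exact h

/-- The quadratic form `½ (q · B q + p · B p)`. -/
def quadForm (B : Matrix (ZMod N) (ZMod N) ℝ) : Poly N :=
  C (1 / 2) * ∑ j, ∑ k, C (B j k) * (X (Sum.inl j) * X (Sum.inl k) + X (Sum.inr j) * X (Sum.inr k))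

/-- Both the kinetic and the potential part of `H_0` have the matrix `A^{1/2}`. -/
theorem H0_eq (ha : 0 < a) : H0 N a = quadForm (matApow N a (1 / 2)) := by
  refine MvPolynomial.funext fun x => ?_
  have hU := dotProduct_matApow_mulVec (a := a) 1 (1 / 4) (fun j => x (Sum.inr j))
  have hW := dotProduct_matApow_mulVec (a := a) (matA N a) (-1 / 4) (fun j => x (Sum.inl j))
  rw [mul_one, matApow_mul ha, Matrix.one_mulVec, show (1 / 4 + 1 / 4 : ℝ) = 1 / 2 by norm_num] at hU
  have h1 : matApow N a (-1 / 4) * matA N a * matApow N a (-1 / 4) = matApow N a (1 / 2) := by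
    rw [← matApow_one, matApow_mul ha, matApow_mul ha]
    norm_num
  rw [h1, dotProduct_matA_mulVec ha] at hW
  have hL : eval x (H0 N a) = 1 / 2 * (∑ j, ((matApow N a (1 / 4)).mulVec
      (fun j => x (Sum.inr j)) j * (matApow N a (1 / 4)).mulVec (fun j => x (Sum.inr j)) j)
      + ∑ j, ((matApow N a (-1 / 4)).mulVec (fun j => x (Sum.inl j)) j ^ 2
        + a * ((matApow N a (-1 / 4)).mulVec (fun j => x (Sum.inl j)) (j + 1)
          - (matApow N a (-1 / 4)).mulVec (fun j => x (Sum.inl j)) j) ^ 2)) := by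
    rw [← Finset.sum_add_distrib]
    simp only [H0, toQP, quadXY, map_mul, map_sum, map_add, map_sub, map_pow, bind₁_X_right,
      bind₁_C_right, eval_C, eval_X, Sum.elim_inl, Sum.elim_inr, Matrix.mulVec,
      dotProduct]
    congr 1
    exact Finset.sum_congr rfl fun j _ => by ring
  rw [hL, hU, hW, ← Finset.sum_add_distrib, quadForm]
  simp only [map_mul, map_sum, map_add, eval_C, eval_X, Matrix.mulVec, dotProduct]
  congr 1
  refine Finset.sum_congr rfl fun j _ => ?_
  rw [Finset.mul_sum, Finset.mul_sum, ← Finset.sum_add_distrib]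
  exact Finset.sum_congr rfl fun k _ => by ring

theorem quadForm_sub (B B' : Matrix (ZMod N) (ZMod N) ℝ) :
    quadForm (B - B') = quadForm B - quadForm B' := by
  simp only [quadForm, ← mul_sub, ← Finset.sum_sub_distrib]
  congr 1
  refine Finset.sum_congr rfl fun j _ => Finset.sum_congr rfl fun k _ => ?_
  rw [Matrix.sub_apply, C_sub]
  ring

theorem HOmega_eq : HOmega N a = quadForm (Omega N a • (1 : Matrix (ZMod N) (ZMod N) ℝ)) := by
  simp only [HOmega, quadForm, Matrix.smul_apply, Matrix.one_apply, smul_eq_mul, mul_ite, mul_one,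
    mul_zero, apply_ite C, C_0, ite_mul, zero_mul, Finset.sum_ite_eq, Finset.mem_univ, if_true]
  rw [div_eq_inv_mul, one_div, C_mul, ← Finset.mul_sum, mul_assoc]
  congr 2
  exact Finset.sum_congr rfl fun j _ => by ring

/-- `Z_0` is the quadratic form of the matrix `A^{1/2} - Ω`. -/
theorem Z0_eq (ha : 0 < a) :
    Z0 N a = quadForm (cfc (fun t : ℝ => t ^ (1 / 2 : ℝ) - Omega N a) (matA N a)) := by
  rw [Z0, H0_eq ha, HOmega_eq, ← quadForm_sub, matApow,
    cfc_sub _ _ _ (continuousOn_spectrum_matA _) (continuousOn_spectrum_matA _),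
    cfc_const _ _ isSelfAdjoint_matA, Algebra.algebraMap_eq_smul_one]

theorem isHomogeneous_quadForm (B : Matrix (ZMod N) (ZMod N) ℝ) :
    (quadForm B).IsHomogeneous (2 * 0 + 2) := by
  rw [quadForm, ← smul_eq_C_mul]
  refine isHomogeneous_smul (IsHomogeneous.sum _ _ _ fun j _ => IsHomogeneous.sum _ _ _
    fun k _ => ?_) _
  rw [← smul_eq_C_mul]
  exact isHomogeneous_smul (((isHomogeneous_X _ _).mul (isHomogeneous_X _ _)).add
    ((isHomogeneous_X _ _).mul (isHomogeneous_X _ _))) _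

theorem sum_add_one {M : Type*} [AddCommMonoid M] (F : ZMod N → M) : ∑ j, F (j + 1) = ∑ j, F j :=
  Equiv.sum_comp (Equiv.addRight (1 : ZMod N)) F

theorem isCyclic_quadForm {B : Matrix (ZMod N) (ZMod N) ℝ}
    (hB : ∀ j k, B (j + 1) (k + 1) = B j k) : IsCyclic (quadForm B) := by
  set T : ZMod N → ZMod N → Poly N := fun j k =>
    C (B j k) * (X (Sum.inl j) * X (Sum.inl k) + X (Sum.inr j) * X (Sum.inr k)) with hT
  have h : shift (quadForm B) = C (1 / 2) * ∑ j, ∑ k, T (j + 1) (k + 1) := by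
    simp only [quadForm, shift, map_mul, map_sum, map_add, rename_X, rename_C, Sum.map_inl,
      Sum.map_inr, hT, hB]
  rw [IsCyclic, h, Finset.sum_congr rfl fun j _ => sum_add_one (T (j + 1)),
    sum_add_one fun j => ∑ k, T j k]
  rfl

/-- Quadratic forms that treat positions and momenta alike are invariant under the rotations. -/
theorem poisson_HOmega_quadForm (B : Matrix (ZMod N) (ZMod N) ℝ) :
    poisson (HOmega N a) (quadForm B) = 0 := by
  have hq : ∀ j, poissonDer (HOmega N a) (X (Sum.inl j)) = -(C (Omega N a) * X (Sum.inr j)) :=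
    fun j => by rw [poissonDer_apply, poisson_X_inl, pderiv_HOmega]
  have hp : ∀ j, poissonDer (HOmega N a) (X (Sum.inr j)) = C (Omega N a) * X (Sum.inl j) :=
    fun j => by rw [poissonDer_apply, poisson_X_inr, pderiv_HOmega]
  have h : ∀ j k, poisson (HOmega N a)
      (X (Sum.inl j) * X (Sum.inl k) + X (Sum.inr j) * X (Sum.inr k)) = 0 := fun j k => by
    rw [← poissonDer_apply, map_add, Derivation.leibniz, Derivation.leibniz, hq, hq, hp, hp]
    simp only [smul_eq_mul]
    ring
  rw [quadForm, ← smul_eq_C_mul, poisson_smul_right, poisson_sum_right,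
    Finset.sum_eq_zero fun j _ => ?_, smul_zero]
  rw [poisson_sum_right]
  exact Finset.sum_eq_zero fun k _ => by
    rw [← smul_eq_C_mul, poisson_smul_right, h, smul_zero]

theorem aeval_quadForm (B : Matrix (ZMod N) (ZMod N) ℝ) (z : Coord N → ℂ) :
    aeval z (quadForm B) = 1 / 2 * (∑ j, z (Sum.inl j) * ∑ k, (B j k : ℂ) * z (Sum.inl k)
      + ∑ j, z (Sum.inr j) * ∑ k, (B j k : ℂ) * z (Sum.inr k)) := by
  rw [← Finset.sum_add_distrib]
  simp only [quadForm, map_mul, map_sum, map_add, aeval_X, aeval_C, Complex.coe_algebraMap]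
  congr 1
  · push_cast; rfl
  · refine Finset.sum_congr rfl fun j _ => ?_
    rw [Finset.mul_sum, Finset.mul_sum, ← Finset.sum_add_distrib]
    exact Finset.sum_congr rfl fun k _ => by ring

theorem norm_sum_mul_cfc_le {f : ℝ → ℝ} {c : ℝ} (hc : 0 ≤ c)
    (hf : ∀ t ∈ spectrum ℝ (matA N a), |f t| ≤ c) (w : ZMod N → ℂ) :
    ‖∑ j, w j * ∑ k, (cfc f (matA N a) j k : ℂ) * w k‖ ≤ c * ∑ j, ‖w j‖ ^ 2 := by
  have h0 : 0 ≤ ∑ j, ‖w j‖ ^ 2 := Finset.sum_nonneg fun j _ => sq_nonneg _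
  refine (norm_sum_le _ _).trans ?_
  simp only [norm_mul]
  refine abs_le_of_sq_le_sq' ?_ (by positivity) |>.2
  calc _ ≤ (∑ j, ‖w j‖ ^ 2) * ∑ j, ‖∑ k, (cfc f (matA N a) j k : ℂ) * w k‖ ^ 2 :=
        Finset.sum_mul_sq_le_sq_mul_sq _ _ _
    _ ≤ (∑ j, ‖w j‖ ^ 2) * (c ^ 2 * ∑ j, ‖w j‖ ^ 2) :=
        mul_le_mul_of_nonneg_left (sum_norm_sq_le hf w) h0
    _ = _ := by ring

/-- As `Ω` is an average, `‖Z_0‖` is not larger than the difference between `Ω` and the smallest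
frequency, which is `1`. -/
theorem supNorm_Z0_le (ha : 0 < a) : supNorm (Z0 N a) ≤ (Omega N a - 1) / 2 := by
  have h1 := one_le_Omega (N := N) ha
  have hf : ∀ t ∈ spectrum ℝ (matA N a), |t ^ (1 / 2 : ℝ) - Omega N a| ≤ Omega N a - 1 := by
    intro t ht
    obtain ⟨h2, h3⟩ := mem_spectrum_matA ha ht
    have h4 : 1 ≤ Real.sqrt t := by rwa [Real.one_le_sqrt]
    rw [← Real.sqrt_eq_rpow, abs_le]
    constructor <;> linarith
  refine supNorm_le fun z hz => ?_
  rw [Z0_eq ha, aeval_quadForm, norm_mul]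
  have h5 := norm_sum_mul_cfc_le (by linarith) hf (fun j => z (Sum.inl j))
  have h6 := norm_sum_mul_cfc_le (by linarith) hf (fun j => z (Sum.inr j))
  have h7 : ∑ j, ‖z (Sum.inl j)‖ ^ 2 + ∑ j, ‖z (Sum.inr j)‖ ^ 2 ≤ 1 := by
    rw [← Fintype.sum_sum_type (fun i => ‖z i‖ ^ 2), ← EuclideanSpace.norm_sq_eq]
    exact pow_le_one₀ (norm_nonneg z) hz
  have h8 : ‖(1 / 2 : ℂ)‖ = 1 / 2 := by norm_num
  rw [h8]
  have h9 : 0 ≤ Omega N a - 1 := by linarith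
  nlinarith [norm_add_le (∑ j, z (Sum.inl j) * ∑ k, (cfc (fun t : ℝ => t ^ (1 / 2 : ℝ) - Omega N a)
      (matA N a) j k : ℂ) * z (Sum.inl k)) (∑ j, z (Sum.inr j) * ∑ k, (cfc (fun t : ℝ =>
      t ^ (1 / 2 : ℝ) - Omega N a) (matA N a) j k : ℂ) * z (Sum.inr k))]

theorem isHomogeneous_Z0 (ha : 0 < a) : (Z0 N a).IsHomogeneous (2 * 0 + 2) := by
  rw [Z0_eq ha]; exact isHomogeneous_quadForm _

theorem isHomogeneous_H0 (ha : 0 < a) : (H0 N a).IsHomogeneous (2 * 0 + 2) := by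
  rw [H0_eq ha]; exact isHomogeneous_quadForm _

theorem isCyclic_H0 (ha : 0 < a) : IsCyclic (H0 N a) := by
  rw [H0_eq ha]; exact isCyclic_quadForm fun j k => cfc_matA_add_one _ j k

theorem poisson_HOmega_Z0 (ha : 0 < a) : poisson (HOmega N a) (Z0 N a) = 0 := by
  rw [Z0_eq ha]; exact poisson_HOmega_quadForm _

theorem HOmega_add_Z0 : HOmega N a + Z0 N a = H0 N a := by rw [Z0]; ring

theorem H1_eq : H1 N a
    = C (1 / 4) * ∑ j, (∑ k, C (matApow N a (-1 / 4) j k) * X (Sum.inl k)) ^ 4 := by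
  simp only [H1, toQP, quartXY, map_mul, map_sum, map_pow, bind₁_X_right, bind₁_C_right,
    Sum.elim_inl]

theorem isHomogeneous_H1 : (H1 N a).IsHomogeneous (2 * 1 + 2) := by
  rw [H1_eq, ← smul_eq_C_mul]
  refine isHomogeneous_smul (IsHomogeneous.sum _ _ _ fun j _ => ?_) _
  exact (IsHomogeneous.sum _ _ 1 fun k _ => by
    rw [← smul_eq_C_mul]; exact isHomogeneous_smul (isHomogeneous_X _ _) _).pow 4

theorem isCyclic_H1 : IsCyclic (H1 N a) := by
  set T : ZMod N → ZMod N → Poly N := fun j k =>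
    C (matApow N a (-1 / 4) j k) * X (Sum.inl k) with hT
  have hW : ∀ j k : ZMod N, matApow N a (-1 / 4) (j + 1) (k + 1) = matApow N a (-1 / 4) j k :=
    cfc_matA_add_one _
  have h : shift (H1 N a) = C (1 / 4) * ∑ j, (∑ k, T (j + 1) (k + 1)) ^ 4 := by
    simp only [H1_eq, shift, map_mul, map_sum, map_pow, rename_X, rename_C, Sum.map_inl, hT, hW]
  rw [IsCyclic, h, Finset.sum_congr rfl fun j _ => by rw [sum_add_one (T (j + 1))],
    sum_add_one fun j => (∑ k, T j k) ^ 4, H1_eq]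

/-- The transformation `q ↦ A^{-1/4} q` is a contraction, so that the quartic part is bounded by
`¼ ‖z‖⁴` uniformly in `N`. -/
theorem supNorm_H1_le (ha : 0 < a) : supNorm (H1 N a) ≤ 1 / 4 := by
  refine supNorm_le fun z hz => ?_
  have hf : ∀ t ∈ spectrum ℝ (matA N a), |t ^ (-1 / 4 : ℝ)| ≤ 1 := fun t ht => by
    have h1 := (mem_spectrum_matA ha ht).1
    rw [abs_of_nonneg (Real.rpow_nonneg (by linarith) _)]
    exact Real.rpow_le_one_of_one_le_of_nonpos h1 (by norm_num)
  have h1 := sum_norm_sq_le hf (fun j => z (Sum.inl j))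
  have h2 : ∑ j, ‖z (Sum.inl j)‖ ^ 2 ≤ 1 := by
    refine le_trans ?_ (pow_le_one₀ (n := 2) (norm_nonneg z) hz)
    rw [EuclideanSpace.norm_sq_eq, Fintype.sum_sum_type]
    exact le_add_of_nonneg_right (Finset.sum_nonneg fun j _ => sq_nonneg _)
  set x : ZMod N → ℂ := fun j => ∑ k, (matApow N a (-1 / 4) j k : ℂ) * z (Sum.inl k) with hx
  have h3 : ∑ j, ‖x j‖ ^ 2 ≤ 1 := by simpa [hx, matApow] using h1.trans (by simpa using h2)
  have h4 : aeval (fun i => z i) (H1 N a) = 1 / 4 * ∑ j, x j ^ 4 := by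
    rw [H1_eq]
    simp only [map_mul, map_sum, map_pow, aeval_C, aeval_X, Complex.coe_algebraMap, hx]
    push_cast
    rfl
  rw [h4, norm_mul, show ‖(1 / 4 : ℂ)‖ = 1 / 4 by norm_num]
  have h5 : ‖∑ j, x j ^ 4‖ ≤ ∑ j, ‖x j‖ ^ 2 := by
    refine (norm_sum_le _ _).trans (Finset.sum_le_sum fun j _ => ?_)
    have h6 : ‖x j‖ ^ 2 ≤ 1 :=
      (Finset.single_le_sum (fun j _ => sq_nonneg ‖x j‖) (Finset.mem_univ j)).trans h3
    rw [norm_pow]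
    nlinarith [sq_nonneg (‖x j‖)]
  linarith

theorem eval_H1_nonneg (x : Coord N → ℝ) : 0 ≤ eval x (H1 N a) := by
  rw [H1_eq]
  simp only [map_mul, map_sum, map_pow, eval_C, eval_X]
  exact mul_nonneg (by norm_num) (Finset.sum_nonneg fun j _ => by positivity)

/-- The configuration with all the positions equal to `1` and all the momenta equal to `0`. -/
def unitPoint (N : ℕ) : Coord N → ℝ := Sum.elim (fun _ => 1) (fun _ => 0)

theorem eval_unitPoint_H1 (ha : 0 < a) : eval (unitPoint N) (H1 N a) = N / 4 := by
  rw [H1_eq]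
  simp only [map_mul, map_sum, map_pow, eval_C, eval_X, unitPoint, Sum.elim_inl, mul_one, matApow,
    cfc_matA_mulVec_one ha, Real.one_rpow]
  simp
  ring

theorem eval_unitPoint_Z0 (ha : 0 < a) : eval (unitPoint N) (Z0 N a) = N * (1 - Omega N a) / 2 := by
  rw [Z0_eq ha, quadForm]
  simp only [map_mul, map_sum, map_add, eval_C, eval_X, unitPoint, Sum.elim_inl, Sum.elim_inr,
    mul_one, mul_zero, add_zero, cfc_matA_mulVec_one ha, Real.one_rpow]
  simp
  ring

omit [NeZero N] in
theorem eval_unitPoint_shift (f : Poly N) :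
    eval (unitPoint N) (shift f) = eval (unitPoint N) f := by
  rw [shift, eval_rename]
  congr 2
  funext i
  rcases i with j | j <;> rfl

omit [NeZero N] in
theorem abs_eval_unitPoint_le (f : Poly N) : |eval (unitPoint N) f| ≤ coeffNorm f := by
  rw [eval_eq, coeffNorm]
  refine (Finset.abs_sum_le_sum_abs _ _).trans (Finset.sum_le_sum fun k _ => ?_)
  rw [abs_mul, Finset.abs_prod]
  refine mul_le_of_le_one_right (abs_nonneg _) (Finset.prod_le_one (fun _ _ => abs_nonneg _) ?_)
  intro i _
  rw [abs_pow]
  refine pow_le_one₀ (abs_nonneg _) ?_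
  rcases i with j | j <;> simp [unitPoint]

omit [NeZero N] in
/-- The constants of the decay classes control the values at the configuration `unitPoint`. -/
theorem IsDecayingSeed.abs_eval_unitPoint_le {d : ℕ} {c σ : ℝ} {f : ℕ → Poly N} {F : Poly N}
    (h : IsDecayingSeed d c σ f F) :
    |eval (unitPoint N) F| ≤ N * ∑ m ∈ Finset.range N, coeffNorm (f m) := by
  have h1 : ∀ (l : ℕ) (g : Poly N),
      eval (unitPoint N) (shift^[l] g) = eval (unitPoint N) g := fun l => by
    induction l with
    | zero => intro g; rfl
    | succ l ih => intro g; rw [Function.iterate_succ_apply, ih, eval_unitPoint_shift]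
  rw [← h.generates, cyc, map_sum]
  simp only [h1, map_sum, Finset.sum_const, Nat.card_Icc, add_tsub_cancel_right, nsmul_eq_mul]
  rw [abs_mul, Nat.abs_cast]
  gcongr
  exact (Finset.abs_sum_le_sum_abs _ _).trans
    (Finset.sum_le_sum fun m _ => KGChain.abs_eval_unitPoint_le _)

/-- The constant `C_{h_1}` is not much smaller than `1 / 4`. -/
theorem one_sub_exp_le_of_isDecayingSeed (ha : 0 < a) {c σ : ℝ} {h : ℕ → Poly N}
    (hh : IsDecayingSeed 4 c σ h (H1 N a)) : 1 - Real.exp (-σ) ≤ 4 * c := by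
  have hN : (0 : ℝ) < N := natCast_pos
  have h1 := hh.abs_eval_unitPoint_le
  rw [eval_unitPoint_H1 ha, abs_of_nonneg (by positivity)] at h1
  set x := Real.exp (-σ) with hx
  have hx0 : 0 < x := Real.exp_pos _
  have hx1 : x < 1 := by rw [hx, Real.exp_lt_one_iff]; linarith [hh.sigma_pos]
  have h2 : ∑ m ∈ Finset.range N, coeffNorm (h m) ≤ c * (1 / (1 - x)) := by
    calc _ ≤ ∑ m ∈ Finset.range N, c * x ^ m := Finset.sum_le_sum fun m _ => by
          refine (hh.decay m).trans (le_of_eq ?_)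
          rw [hx, ← Real.exp_nat_mul]
          ring_nf
      _ = c * ∑ m ∈ Finset.range N, x ^ m := by rw [Finset.mul_sum]
      _ ≤ c * (1 / (1 - x)) := by
          refine mul_le_mul_of_nonneg_left ?_ hh.C_pos.le
          rw [geom_sum_eq hx1.ne, ← neg_div_neg_eq, neg_sub, neg_sub]
          have : 0 < x ^ N := by positivity
          have h1x : 0 < 1 - x := by linarith
          gcongr
          linarith
  have h3 : (N : ℝ) / 4 ≤ N * (c * (1 / (1 - x))) := h1.trans (by gcongr)
  have h4 : 1 / 4 ≤ c * (1 / (1 - x)) := by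
    refine le_of_mul_le_mul_left ?_ hN
    linarith
  have h5 : 0 < 1 - x := by linarith
  rw [mul_one_div, div_le_div_iff₀ (by norm_num) h5] at h4
  linarith

/-- The constant `C_{ζ_0}` controls the spread of the frequencies. -/
theorem Omega_sub_one_le_of_isDecayingSeed (ha : 0 < a) {c σ : ℝ} {ζ : ℕ → Poly N}
    (hζ : IsDecayingSeed 2 c σ ζ (Z0 N a)) (h0 : ζ 0 = 0) :
    (Omega N a - 1) * (1 - Real.exp (-σ)) ≤ 2 * c * Real.exp (-σ) := by
  have hN : (0 : ℝ) < N := natCast_pos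
  have hΩ := one_le_Omega (N := N) ha
  have h1 := hζ.abs_eval_unitPoint_le
  have h1' : |N * (1 - Omega N a) / 2| = N * ((Omega N a - 1) / 2) := by
    rw [abs_of_nonpos (by nlinarith)]; ring
  rw [eval_unitPoint_Z0 ha, h1'] at h1
  set x := Real.exp (-σ) with hx
  have hx0 : 0 < x := Real.exp_pos _
  have hx1 : x < 1 := by rw [hx, Real.exp_lt_one_iff]; linarith [hζ.sigma_pos]
  have h1x : 0 < 1 - x := by linarith
  have h2 : ∑ m ∈ Finset.range N, coeffNorm (ζ m) ≤ c * (x / (1 - x)) := by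
    have h00 : coeffNorm (ζ 0) = 0 := by simp [h0, coeffNorm]
    obtain ⟨n, hn⟩ := Nat.exists_eq_succ_of_ne_zero (NeZero.ne N)
    have hsum : ∑ m ∈ Finset.range N, coeffNorm (ζ m)
        = ∑ m ∈ Finset.range n, coeffNorm (ζ (m + 1)) := by
      have h3 := Finset.sum_range_succ' (fun m => coeffNorm (ζ m)) n
      rw [h00, add_zero] at h3
      rw [← h3]
      exact congrArg (fun k => ∑ m ∈ Finset.range k, coeffNorm (ζ m)) hn
    rw [hsum]
    calc _ ≤ ∑ m ∈ Finset.range n, c * x * x ^ m := Finset.sum_le_sum fun m _ => by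
          refine (hζ.decay (m + 1)).trans (le_of_eq ?_)
          rw [hx, mul_assoc, ← pow_succ', ← Real.exp_nat_mul]
          ring_nf
      _ = c * x * ∑ m ∈ Finset.range n, x ^ m := by rw [Finset.mul_sum]
      _ ≤ c * x * (1 / (1 - x)) := by
          refine mul_le_mul_of_nonneg_left ?_ (mul_nonneg hζ.C_pos.le hx0.le)
          rw [geom_sum_eq hx1.ne, ← neg_div_neg_eq, neg_sub, neg_sub]
          have : 0 < x ^ n := by positivity
          gcongr
          linarith
      _ = c * (x / (1 - x)) := by ring
  have h4 : (Omega N a - 1) / 2 ≤ c * (x / (1 - x)) := by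
    refine le_of_mul_le_mul_left ?_ hN
    exact h1.trans (by gcongr)
  rw [← mul_div_assoc, div_le_div_iff₀ (by norm_num) h1x] at h4
  linarith

end Hamiltonian

/-! ### Existence of the normal form -/

section Existence

variable {N : ℕ} [NeZero N] {a : ℝ}

theorem supNorm_le_of_homological_Z0 (ha : 0 < a) {r m : ℕ} (hm : m ≤ r)
    (hb : 48 * ((r : ℝ) + 1) * (Omega N a - 1) ≤ Omega N a) {g Z : Poly N}
    (hg : g.IsHomogeneous (2 * m + 2)) (hZ : poisson (HOmega N a) Z = 0) :
    supNorm Z ≤ supNorm (poisson (poisson (HOmega N a) g) (H0 N a) + Z) ∧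
      supNorm (poisson (HOmega N a) g) ≤ 21 / (10 * Omega N a)
        * supNorm (poisson (poisson (HOmega N a) g) (H0 N a) + Z) := by
  have hΩ := one_le_Omega (N := N) ha
  refine supNorm_le_of_homological (by linarith) (isHomogeneous_Z0 ha) (poisson_HOmega_Z0 ha)
    (supNorm_Z0_le ha) ?_ hg hZ (by rw [HOmega_add_Z0])
  refine le_trans ?_ hb
  have : (m : ℝ) ≤ r := by exact_mod_cast hm
  gcongr

instance finiteDimensional_cycHom (m : ℕ) : FiniteDimensional ℝ (cycHom N m) := by
  have h : FiniteDimensional ℝ (homogeneousSubmodule (Coord N) ℝ (2 * m + 2)) :=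
    Module.Finite.iff_fg.mpr (homogeneousSubmodule_fg (Coord N) ℝ (2 * m + 2))
  exact Submodule.finiteDimensional_of_le
    (show cycHom N m ≤ homogeneousSubmodule (Coord N) ℝ (2 * m + 2) from fun f hf => hf.1)

/-- If `M` maps the range of `L` injectively into the quotient by the kernel of `L`, then it does so
surjectively, by counting dimensions. -/
theorem exists_eq_of_comp_injective {V : Type*} [AddCommGroup V] [Module ℝ V]
    [FiniteDimensional ℝ V] (L M : V →ₗ[ℝ] V) (h : ∀ x, L (M (L x)) = 0 → L x = 0) (F : V) :
    ∃ x, L (M (L x)) = L F := by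
  have hker : LinearMap.ker (L ∘ₗ M ∘ₗ L) = LinearMap.ker L := by
    ext x
    simp only [LinearMap.mem_ker, LinearMap.comp_apply]
    exact ⟨h x, fun hx => by rw [hx, map_zero, map_zero]⟩
  have hle : LinearMap.range (L ∘ₗ M ∘ₗ L) ≤ LinearMap.range L := LinearMap.range_comp_le_range _ _
  have h1 := LinearMap.finrank_range_add_finrank_ker (L ∘ₗ M ∘ₗ L)
  have h2 := LinearMap.finrank_range_add_finrank_ker L
  rw [hker] at h1
  have heq := Submodule.eq_of_le_of_finrank_eq hle (by omega)
  have : L F ∈ LinearMap.range (L ∘ₗ M ∘ₗ L) := heq ▸ LinearMap.mem_range_self L F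
  exact this

/-- Solvability of the homological equation. The operator `{·, H_0}` is invertible on the range of
`{H_Ω, ·}`, by the estimate of the solutions and finiteness of the dimension. -/
theorem exists_homological (ha : 0 < a) {r m : ℕ} (hm : m ≤ r)
    (hb : 48 * ((r : ℝ) + 1) * (Omega N a - 1) ≤ Omega N a) {F : Poly N} (hF : F ∈ cycHom N m) :
    ∃ g ∈ cycHom N m,
      poisson (HOmega N a) (F - poisson (poisson (HOmega N a) g) (H0 N a)) = 0 := by
  have hΩc : HOmega N a ∈ cycHom N 0 := ⟨isHomogeneous_HOmega a, isCyclic_HOmega a⟩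
  have hH0c : H0 N a ∈ cycHom N 0 := ⟨isHomogeneous_H0 ha, isCyclic_H0 ha⟩
  have hL : ∀ f ∈ cycHom N m, poissonBilin N (HOmega N a) f ∈ cycHom N m := fun f hf => by
    have := poisson_mem_cycHom hΩc hf
    rwa [zero_add] at this
  have hM : ∀ f ∈ cycHom N m, (poissonBilin N).flip (H0 N a) f ∈ cycHom N m := fun f hf => by
    have := poisson_mem_cycHom hf hH0c
    rwa [add_zero] at this
  obtain ⟨x, hx⟩ := exists_eq_of_comp_injective ((poissonBilin N (HOmega N a)).restrict hL)
    (((poissonBilin N).flip (H0 N a)).restrict hM) (fun x hx => by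
      have hx' : poisson (HOmega N a) (poisson (poisson (HOmega N a) x) (H0 N a)) = 0 :=
        congrArg Subtype.val hx
      have hh := (supNorm_le_of_homological_Z0 ha hm hb (g := x)
        (Z := -poisson (poisson (HOmega N a) x) (H0 N a)) x.2.1
        (by rw [poisson_neg_right, hx', neg_zero])).2
      rw [add_neg_cancel, supNorm_zero, mul_zero] at hh
      exact Subtype.ext (eq_zero_of_supNorm_eq_zero (hL x x.2).1
        (le_antisymm hh (supNorm_nonneg _)))) ⟨F, hF⟩
  have hx' : poisson (HOmega N a) (poisson (poisson (HOmega N a) x) (H0 N a))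
      = poisson (HOmega N a) F := congrArg Subtype.val hx
  exact ⟨x, x.2, by rw [poisson_sub_right, hx', sub_self]⟩

/-- The homogeneous components of the Hamiltonian `H = H_0 + H_1`, by degree. -/
def hamComponent (N : ℕ) [NeZero N] (a : ℝ) (s : ℕ) : Poly N :=
  if s = 0 then H0 N a else if s = 1 then H1 N a else 0

theorem hamComponent_mem (ha : 0 < a) (s : ℕ) : hamComponent N a s ∈ cycHom N s := by
  unfold hamComponent
  split_ifs with h0 h1
  · subst h0; exact ⟨isHomogeneous_H0 ha, isCyclic_H0 ha⟩
  · subst h1; exact ⟨isHomogeneous_H1, isCyclic_H1⟩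
  · exact zero_mem _

/-- The components of the Hamiltonian transformed by the inverse of `T_χ`, which the equation
`T_χ K = H` determines degree by degree. -/
def pullbackHam (a : ℝ) (χ : ℕ → Poly N) : ℕ → Poly N
  | s => hamComponent N a s - ∑ j : Fin s, lieE χ (s - j) (pullbackHam a χ j)
termination_by s => s
decreasing_by exact j.2

theorem pullbackHam_eq (χ : ℕ → Poly N) (s : ℕ) :
    pullbackHam a χ s
      = hamComponent N a s - ∑ j ∈ Finset.range s, lieE χ (s - j) (pullbackHam a χ j) := by
  rw [pullbackHam, Fin.sum_univ_eq_sum_range (fun j => lieE χ (s - j) (pullbackHam a χ j))]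

theorem pullbackHam_zero (χ : ℕ → Poly N) : pullbackHam a χ 0 = H0 N a := by
  rw [pullbackHam_eq]
  simp [hamComponent]

theorem pullbackHam_transform (χ : ℕ → Poly N) (s : ℕ) :
    ∑ j ∈ Finset.range (s + 1), lieE χ (s - j) (pullbackHam a χ j) = hamComponent N a s := by
  rw [Finset.sum_range_succ, Nat.sub_self, lieE_zero, pullbackHam_eq χ s, add_sub_cancel]

theorem pullbackHam_mem (ha : 0 < a) {χ : ℕ → Poly N} (hχ : ∀ s, χ s ∈ cycHom N s) (s : ℕ) :
    pullbackHam a χ s ∈ cycHom N s := by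
  induction s using Nat.strong_induction_on with
  | _ s ih =>
    rw [pullbackHam_eq]
    refine Submodule.sub_mem _ (hamComponent_mem ha s) (Submodule.sum_mem _ fun j hj => ?_)
    rw [Finset.mem_range] at hj
    have := lieE_mem (V := cycHom N) (ih j hj)
      (fun j _ _ _ hg => poisson_mem_cycHom (hχ j) hg) (s - j)
    rwa [Nat.sub_add_cancel hj.le] at this

theorem pullbackHam_congr {χ χ' : ℕ → Poly N} {n : ℕ} (h : ∀ j, 1 ≤ j → j ≤ n → χ j = χ' j) :
    ∀ s ≤ n, pullbackHam a χ s = pullbackHam a χ' s := by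
  intro s
  induction s using Nat.strong_induction_on with
  | _ s ih =>
    intro hs
    rw [pullbackHam_eq, pullbackHam_eq]
    congr 1
    refine Finset.sum_congr rfl fun j hj => ?_
    rw [Finset.mem_range] at hj
    rw [ih j hj (by omega), lieE_congr h _ _ (by omega)]

/-- The generating function of index `n + 1` enters `E_{n+1}` through a single bracket. -/
theorem lieE_succ_congr {χ χ' : ℕ → Poly N} {n : ℕ} (h : ∀ j, 1 ≤ j → j ≤ n → χ j = χ' j)
    (h0 : χ (n + 1) = 0) (f : Poly N) :
    lieE χ' (n + 1) f = lieE χ (n + 1) f + poisson (χ' (n + 1)) f := by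
  have hn : ((n + 1 : ℕ) : ℝ) ≠ 0 := by positivity
  apply smul_right_injective (Poly N) hn
  simp only
  rw [smul_add, smul_lieE, smul_lieE, Finset.Nat.sum_antidiagonal_succ',
    Finset.Nat.sum_antidiagonal_succ', h0, poisson_zero_left, smul_zero, zero_add, lieE_zero,
    add_comm]
  congr 1
  refine Finset.sum_congr rfl fun p hp => ?_
  rw [Finset.HasAntidiagonal.mem_antidiagonal] at hp
  rcases Nat.eq_zero_or_pos p.1 with h1 | h1
  · simp [h1]
  · rw [h p.1 h1 (by omega), lieE_congr h f (p.2 + 1) (by omega)]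

theorem pullbackHam_succ_congr {χ χ' : ℕ → Poly N} {n : ℕ}
    (h : ∀ j, 1 ≤ j → j ≤ n → χ j = χ' j) (h0 : χ (n + 1) = 0) :
    pullbackHam a χ' (n + 1)
      = pullbackHam a χ (n + 1) - poisson (χ' (n + 1)) (H0 N a) := by
  rw [pullbackHam_eq, pullbackHam_eq, Finset.sum_range_succ', Finset.sum_range_succ']
  simp only [Nat.sub_zero, pullbackHam_zero, lieE_succ_congr h h0]
  have : ∑ j ∈ Finset.range n, lieE χ' (n + 1 - (j + 1)) (pullbackHam a χ' (j + 1))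
      = ∑ j ∈ Finset.range n, lieE χ (n + 1 - (j + 1)) (pullbackHam a χ (j + 1)) := by
    refine Finset.sum_congr rfl fun j hj => ?_
    rw [Finset.mem_range] at hj
    rw [pullbackHam_congr h _ (by omega), lieE_congr h _ _ (by omega)]
  rw [this]
  abel

/-- The functions `g_s` with `χ_s = {H_Ω, g_s}`, chosen one degree at a time: the choice of `g_{n+1}`
changes the transformed Hamiltonian in the degree of index `n + 1` by `-{χ_{n+1}, H_0}` and leaves the
lower degrees as they are. -/
theorem exists_generating (ha : 0 < a) {r : ℕ}
    (hb : 48 * ((r : ℝ) + 1) * (Omega N a - 1) ≤ Omega N a) (n : ℕ) (hn : n ≤ r) :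
    ∃ g : ℕ → Poly N, (∀ s, g s ∈ cycHom N s) ∧ (∀ s, s = 0 ∨ n < s → g s = 0) ∧
      ∀ s, 1 ≤ s → s ≤ n → poisson (HOmega N a)
        (pullbackHam a (fun s => poisson (HOmega N a) (g s)) s) = 0 := by
  have hΩc : HOmega N a ∈ cycHom N 0 := ⟨isHomogeneous_HOmega a, isCyclic_HOmega a⟩
  induction n with
  | zero => exact ⟨fun _ => 0, fun s => zero_mem _, fun s _ => rfl, fun s h1 h2 => by omega⟩
  | succ n ih =>
    obtain ⟨g, hg, hg0, hres⟩ := ih (by omega)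
    set χ := fun s => poisson (HOmega N a) (g s) with hχ
    have hχc : ∀ s, χ s ∈ cycHom N s := fun s => by
      have := poisson_mem_cycHom hΩc (hg s)
      rwa [zero_add] at this
    obtain ⟨c, hc, hc'⟩ := exists_homological ha hn hb (pullbackHam_mem ha hχc (n + 1))
    have hagree : ∀ j, 1 ≤ j → j ≤ n →
        χ j = poisson (HOmega N a) (Function.update g (n + 1) c j) := fun j _ hj => by
      rw [Function.update_of_ne (by omega)]
    have h0 : χ (n + 1) = 0 := by rw [hχ]; simp [hg0 (n + 1) (Or.inr (by omega))]
    refine ⟨Function.update g (n + 1) c, fun s => ?_, fun s hs => ?_, fun s h1 h2 => ?_⟩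
    · rcases eq_or_ne s (n + 1) with rfl | hne
      · rwa [Function.update_self]
      · rw [Function.update_of_ne hne]; exact hg s
    · rw [Function.update_of_ne (by omega)]
      exact hg0 s (by omega)
    · rcases Nat.lt_or_ge n s with hlt | hle
      · obtain rfl : s = n + 1 := by omega
        rw [pullbackHam_succ_congr hagree h0, Function.update_self]
        exact hc'
      · rw [← pullbackHam_congr hagree s hle]
        exact hres s h1 hle

theorem exists_isNormalForm (ha : 0 < a) {r : ℕ}
    (hb : 48 * ((r : ℝ) + 1) * (Omega N a - 1) ≤ Omega N a) :
    ∃ χ K : ℕ → Poly N, IsNormalForm a r χ K := by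
  obtain ⟨g, hg, hg0, hres⟩ := exists_generating (N := N) ha hb r le_rfl
  set χ := fun s => poisson (HOmega N a) (g s) with hχ
  have hχc : ∀ s, χ s ∈ cycHom N s := fun s => by
    have := poisson_mem_cycHom (m := 0) ⟨isHomogeneous_HOmega a, isCyclic_HOmega a⟩ (hg s)
    rwa [zero_add] at this
  exact ⟨χ, pullbackHam a χ,
    { chi_homogeneous := fun s => (hχc s).1
      chi_cyclic := fun s => (hχc s).2
      chi_range := fun s => ⟨g s, (hg s).1, rfl⟩
      chi_zero := fun s hs => by rw [hχ]; simp [hg0 s hs]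
      ham_homogeneous := fun s => (pullbackHam_mem ha hχc s).1
      ham_cyclic := fun s => (pullbackHam_mem ha hχc s).2
      ham_zero := by rw [pullbackHam_zero, HOmega_add_Z0]
      resonant_zero := poisson_HOmega_Z0 ha
      resonant := hres
      transform := pullbackHam_transform χ }⟩

end Existence

/-! ### Estimates of the normal form -/

section Estimates

variable {N : ℕ} [NeZero N] {a : ℝ}

/-- Estimate of the components of the Lie transform. As `D` is proportional to the degree and
`β` to its square, the hypothesis `hβ` makes the sum of the contributions of
`E_1, …, E_{s-1}` comparable with the term `{χ_s, f}`. -/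
theorem supNorm_lieE_le {χ : ℕ → Poly N} {α β : ℝ} (hα : 0 ≤ α) (hβ0 : 0 ≤ β)
    (hχ : ∀ j, (χ j).IsHomogeneous (2 * j + 2)) {n m t : ℕ}
    (hχb : ∀ j ≤ n, ((j : ℝ) + 2) * supNorm (χ (j + 1)) ≤ α * β ^ j)
    (hβ : 2 * n * (30 * α * t) ≤ β) (ht : n + 1 + m ≤ t) {f : Poly N}
    (hf : f.IsHomogeneous (2 * m + 2)) :
    supNorm (lieE χ (n + 1) f) ≤ 2 * (30 * α * t) * β ^ n * supNorm f := by
  set D := 30 * α * t with hD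
  have hD0 : 0 ≤ D := by positivity
  have hf0 := supNorm_nonneg f
  induction n using Nat.strong_induction_on with
  | _ n ih =>
    have hterm : ∀ j k, j + 1 + k ≤ n + 1 →
        supNorm (poisson (χ (j + 1)) (lieE χ k f)) ≤ D * β ^ j * supNorm (lieE χ k f) := by
      intro j k hjk
      have h1 := supNorm_poisson_le (hχ (j + 1)) (lieE_isHomogeneous hχ hf k)
      have h2 : ((k + m : ℕ) : ℝ) + 1 ≤ t := by
        have : k + m + 1 ≤ t := by omega
        exact_mod_cast this
      have h3 := hχb j (by omega)
      have h4 := supNorm_nonneg (lieE χ k f)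
      have h5 := supNorm_nonneg (χ (j + 1))
      calc _ ≤ 30 * (((j + 1 : ℕ) : ℝ) + 1) * (((k + m : ℕ) : ℝ) + 1) * supNorm (χ (j + 1))
            * supNorm (lieE χ k f) := h1
        _ = 30 * (((k + m : ℕ) : ℝ) + 1) * (((j : ℝ) + 2) * supNorm (χ (j + 1)))
            * supNorm (lieE χ k f) := by push_cast; ring
        _ ≤ 30 * t * (α * β ^ j) * supNorm (lieE χ k f) := by gcongr
        _ = _ := by rw [hD]; ring
    have hn0 : (0 : ℝ) < n + 1 := by positivity
    have hmain : ((n : ℝ) + 1) * supNorm (lieE χ (n + 1) f)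
        ≤ (n + 1) * (2 * D * β ^ n * supNorm f) := by
      have h1 : ((n : ℝ) + 1) * supNorm (lieE χ (n + 1) f)
          = supNorm (((n + 1 : ℕ) : ℝ) • lieE χ (n + 1) f) := by
        refine le_antisymm ?_ ((supNorm_smul_le _ _).trans (le_of_eq ?_))
        · have h := supNorm_smul_le ((n + 1 : ℕ) : ℝ)⁻¹ (((n + 1 : ℕ) : ℝ) • lieE χ (n + 1) f)
          rw [inv_smul_smul₀ (by positivity), abs_of_pos (by positivity), inv_mul_eq_div,
            le_div_iff₀ (by positivity)] at h
          push_cast at h ⊢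
          linarith
        · rw [abs_of_pos (by positivity)]; push_cast; ring
      rw [h1, smul_lieE, Finset.Nat.sum_antidiagonal_succ', lieE_zero]
      refine (supNorm_add_le _ _).trans ?_
      have h2 : supNorm (((n + 1 : ℕ) : ℝ) • poisson (χ (n + 1)) f)
          ≤ (n + 1) * (D * β ^ n * supNorm f) := by
        refine (supNorm_smul_le _ _).trans ?_
        rw [abs_of_pos (by positivity)]
        push_cast
        have := hterm n 0 (by omega)
        rw [lieE_zero] at this
        gcongr
      have h3 : supNorm (∑ p ∈ antidiagonal n,
          (p.1 : ℝ) • poisson (χ p.1) (lieE χ (p.2 + 1) f))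
          ≤ (n + 1) * (D * β ^ n * supNorm f) := by
        rcases n with _ | n
        · simp only [Finset.Nat.antidiagonal_zero, Finset.sum_singleton, Nat.cast_zero, zero_smul,
            supNorm_zero]
          positivity
        · rw [Finset.Nat.sum_antidiagonal_succ, Nat.cast_zero, zero_smul, zero_add]
          calc _ ≤ ∑ p ∈ antidiagonal n, ((n + 1 : ℕ) + 1 : ℝ) * (2 * D * D * β ^ n * supNorm f) :=
                (supNorm_sum_le _ _).trans (Finset.sum_le_sum fun p hp => ?_)
            _ = (n + 1 : ℕ) * (((n + 1 : ℕ) + 1 : ℝ) * (2 * D * D * β ^ n * supNorm f)) := by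
                rw [Finset.sum_const, Finset.Nat.card_antidiagonal, nsmul_eq_mul]
            _ = ((n + 1 : ℕ) + 1 : ℝ) * (D * β ^ n * supNorm f) * (2 * (n + 1 : ℕ) * D) := by ring
            _ ≤ ((n + 1 : ℕ) + 1 : ℝ) * (D * β ^ n * supNorm f) * β := by gcongr
            _ = _ := by ring
          rw [Finset.HasAntidiagonal.mem_antidiagonal] at hp
          have hle : p.2 < n + 1 := by omega
          have h4 := ih p.2 hle (fun j hj => hχb j (by omega)) (by omega) (by
            refine le_trans ?_ hβ
            have : (p.2 : ℝ) ≤ (n + 1 : ℕ) := by exact_mod_cast hle.le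
            gcongr)
          have h5 := hterm p.1 (p.2 + 1) (by omega)
          refine (supNorm_smul_le _ _).trans ?_
          rw [abs_of_nonneg (by positivity)]
          have h6 : ((p.1 + 1 : ℕ) : ℝ) ≤ (n + 1 : ℕ) + 1 := by
            have : p.1 + 1 ≤ n + 1 + 1 := by omega
            exact_mod_cast this
          calc _ ≤ ((n + 1 : ℕ) + 1 : ℝ) * (D * β ^ p.1 * (2 * D * β ^ p.2 * supNorm f)) := by
                refine mul_le_mul h6 (h5.trans ?_) (supNorm_nonneg _) (by positivity)
                gcongr
            _ = _ := by rw [← hp, pow_add]; ring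
      linarith
    exact le_of_mul_le_mul_left hmain hn0

theorem IsNormalForm.transform' {r : ℕ} {χ K : ℕ → Poly N} (h : IsNormalForm a r χ K) (s : ℕ) :
    hamComponent N a s = ∑ p ∈ antidiagonal s, lieE χ p.1 (K p.2) := by
  rw [Finset.Nat.sum_antidiagonal_eq_sum_range_succ_mk, hamComponent, ← h.transform s,
    ← Finset.sum_range_reflect]
  refine Finset.sum_congr rfl fun j hj => ?_
  rw [Finset.mem_range] at hj
  have h1 : s + 1 - 1 - j = s - j := by omega
  have h2 : s - (s - j) = j := by omega
  rw [h1, h2]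

/-- The equation `T_χ K = H`, differentiated with respect to a parameter that scales the degrees.
The generating functions act on the known sequence `H` only. -/
theorem IsNormalForm.weighted {r : ℕ} {χ K : ℕ → Poly N} (h : IsNormalForm a r χ K) (s : ℕ) :
    (s : ℝ) • hamComponent N a s
      = ∑ p ∈ antidiagonal s, (p.1 : ℝ) • poisson (χ p.1) (hamComponent N a p.2)
        + ∑ p ∈ antidiagonal s, (p.2 : ℝ) • lieE χ p.1 (K p.2) := by
  simp only [h.transform', poisson_sum_right, Finset.smul_sum]
  rw [← sum_antidiagonal_assoc (fun j k l => (j : ℝ) • poisson (χ j) (lieE χ k (K l))),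
    ← Finset.sum_add_distrib]
  refine Finset.sum_congr rfl fun p hp => ?_
  rw [Finset.HasAntidiagonal.mem_antidiagonal] at hp
  rw [← smul_lieE, ← add_smul, ← hp]
  push_cast
  rfl

/-- The first homological equation. -/
theorem IsNormalForm.homological_one {r : ℕ} {χ K : ℕ → Poly N} (h : IsNormalForm a r χ K) :
    poisson (χ 1) (H0 N a) + K 1 = H1 N a := by
  have := h.weighted 1
  simpa [hamComponent, Finset.Nat.sum_antidiagonal_succ, lieE_zero] using this.symm

/-- The homological equations of higher order. The right-hand side involves only functions of lower
index. -/
theorem IsNormalForm.homological_add_two {r : ℕ} {χ K : ℕ → Poly N} (h : IsNormalForm a r χ K)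
    (n : ℕ) :
    ((n + 2 : ℕ) : ℝ) • (poisson (χ (n + 2)) (H0 N a) + K (n + 2))
      = -(((n + 1 : ℕ) : ℝ) • poisson (χ (n + 1)) (H1 N a)
        + ∑ p ∈ antidiagonal n, ((p.2 + 1 : ℕ) : ℝ) • lieE χ (p.1 + 1) (K (p.2 + 1))) := by
  have h1 := h.weighted (n + 2)
  rw [show hamComponent N a (n + 2) = 0 by simp [hamComponent], smul_zero,
    Finset.Nat.sum_antidiagonal_succ', Finset.Nat.sum_antidiagonal_succ',
    Finset.Nat.sum_antidiagonal_succ (f := fun p => (p.2 : ℝ) • lieE χ p.1 (K p.2)),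
    Finset.Nat.sum_antidiagonal_succ' (f := fun p => (p.2 : ℝ) • lieE χ (p.1 + 1) (K p.2))] at h1
  have h2 : ∀ k, hamComponent N a (k + 1 + 1) = 0 := fun k => by simp [hamComponent]
  have h3 : hamComponent N a 0 = H0 N a := by simp [hamComponent]
  have h4 : hamComponent N a (0 + 1) = H1 N a := by simp [hamComponent]
  simp only [h2, h3, h4, poisson_zero_right, smul_zero, Finset.sum_const_zero, add_zero,
    lieE_zero, Nat.cast_zero, zero_smul, zero_add] at h1
  rw [smul_add, eq_neg_iff_add_eq_zero, h1]
  abel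

end Estimates

/-! ### Geometric growth of the normal form -/

section Growth

variable {N : ℕ} [NeZero N] {a : ℝ}

/-- The growth rate of the estimates of the normal form with respect to the order: the estimates
of the functions of degree `2 s + 2` are proportional to its power `s - 1`. -/
def growth (N : ℕ) [NeZero N] (a : ℝ) (r : ℕ) : ℝ := 256 * (r : ℝ) ^ 2 / Omega N a

theorem growth_nonneg (ha : 0 < a) (r : ℕ) : 0 ≤ growth N a r := by
  have := one_le_Omega (N := N) ha
  unfold growth
  positivity

/-- The part of the homological equation at a given order that does not depend on the splitting
into `χ_s` and `Z_s`. At the order `r + 1`, where `χ_{r+1} = 0`, it gives the estimate of the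
remainder. -/
theorem IsNormalForm.supNorm_step (ha : 0 < a) {r : ℕ}
    (hb : 48 * ((r : ℝ) + 1) * (Omega N a - 1) ≤ Omega N a) {χ K : ℕ → Poly N}
    (h : IsNormalForm a r χ K) {n : ℕ} (hn : n ≤ r) {c : ℝ}
    (hc : ((n : ℝ) + 2) * supNorm (poisson (χ (n + 1)) (H0 N a) + K (n + 1)) ≤ 1 / 2 * c) :
    ((n : ℝ) + 2) * supNorm (χ (n + 1)) ≤ 16 / (15 * Omega N a) * c ∧
      ((n : ℝ) + 2) * supNorm (K (n + 1)) ≤ 1 / 2 * c := by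
  have hΩ := one_le_Omega (N := N) ha
  set G := poisson (χ (n + 1)) (H0 N a) + K (n + 1) with hG
  have hG0 := supNorm_nonneg G
  have hc0 : 0 ≤ c := by
    have : 0 ≤ ((n : ℝ) + 2) * supNorm G := by positivity
    linarith
  rcases Nat.lt_or_ge n r with hlt | hge
  · obtain ⟨g, hg, hgχ⟩ := h.chi_range (n + 1)
    have h1 := supNorm_le_of_homological_Z0 ha (show n + 1 ≤ r from hlt) hb hg
      (h.resonant (n + 1) (by omega) hlt)
    rw [← hgχ, ← hG] at h1
    refine ⟨?_, (mul_le_mul_of_nonneg_left h1.1 (by positivity)).trans hc⟩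
    calc ((n : ℝ) + 2) * supNorm (χ (n + 1))
        ≤ ((n : ℝ) + 2) * (21 / (10 * Omega N a) * supNorm G) :=
          mul_le_mul_of_nonneg_left h1.2 (by positivity)
      _ = 21 / (10 * Omega N a) * (((n : ℝ) + 2) * supNorm G) := by ring
      _ ≤ 21 / (10 * Omega N a) * (1 / 2 * c) := by gcongr
      _ = 21 / 20 * (c / Omega N a) := by field_simp; ring
      _ ≤ 16 / 15 * (c / Omega N a) :=
          mul_le_mul_of_nonneg_right (by norm_num) (by positivity)
      _ = _ := by field_simp
  · have h0 : χ (n + 1) = 0 := h.chi_zero (n + 1) (Or.inr (by omega))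
    rw [hG, h0, poisson_zero_left, zero_add] at hc
    rw [h0, supNorm_zero, mul_zero]
    exact ⟨by positivity, hc⟩

/-- The generating functions, the normal form and the first term of the remainder, which is the
case `n = r` of the second estimate, grow at most geometrically. -/
theorem IsNormalForm.supNorm_le (ha : 0 < a) {r : ℕ}
    (hb : 48 * ((r : ℝ) + 1) * (Omega N a - 1) ≤ Omega N a) {χ K : ℕ → Poly N}
    (h : IsNormalForm a r χ K) : ∀ n ≤ r,
      ((n : ℝ) + 2) * supNorm (χ (n + 1)) ≤ 16 / (15 * Omega N a) * growth N a r ^ n ∧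
      ((n : ℝ) + 2) * supNorm (K (n + 1)) ≤ 1 / 2 * growth N a r ^ n := by
  have hΩ := one_le_Omega (N := N) ha
  have hΩ0 : 0 < Omega N a := by linarith
  set Ω := Omega N a with hΩd
  set β := growth N a r with hβ
  have hβ0 : 0 ≤ β := growth_nonneg ha r
  intro n
  induction n using Nat.strong_induction_on with
  | _ n ih =>
    intro hn
    refine h.supNorm_step ha hb hn ?_
    rcases n with _ | n
    · rw [zero_add, h.homological_one]
      have := supNorm_H1_le (N := N) ha
      simp only [Nat.cast_zero, pow_zero]
      linarith
    · set G := poisson (χ (n + 1 + 1)) (H0 N a) + K (n + 1 + 1) with hG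
      set δ := 32 / Ω with hδ
      have hδ0 : 0 < δ := by positivity
      have hβδ : β = 8 * δ * r ^ 2 := by rw [hβ, growth, hδ]; ring
      have hnr : ((n : ℝ) + 1) ≤ r := by exact_mod_cast hn
      have hterm : ∀ p ∈ antidiagonal n,
          supNorm (((p.2 + 1 : ℕ) : ℝ) • lieE χ (p.1 + 1) (K (p.2 + 1))) ≤ δ * (n + 2) * β ^ n := by
        intro p hp
        rw [Finset.HasAntidiagonal.mem_antidiagonal] at hp
        have h1 := supNorm_lieE_le (χ := χ) (α := 16 / (15 * Ω)) (β := β) (by positivity) hβ0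
          h.chi_homogeneous (n := p.1) (m := p.2 + 1) (t := n + 2)
          (fun j hj => (ih j (by omega) (by omega)).1)
          (by
            have hp1 : (p.1 : ℝ) ≤ n := by exact_mod_cast (by omega : p.1 ≤ n)
            calc 2 * (p.1 : ℝ) * (30 * (16 / (15 * Ω)) * (n + 2 : ℕ))
                ≤ 2 * n * (30 * (16 / (15 * Ω)) * (n + 2 : ℕ)) := by gcongr
              _ = 2 * δ * (n * (n + 2)) := by rw [hδ]; push_cast; field_simp; ring
              _ ≤ 2 * δ * (4 * r ^ 2) := mul_le_mul_of_nonneg_left (by nlinarith) (by positivity)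
              _ = β := by rw [hβδ]; ring)
          (by omega) (h.ham_homogeneous (p.2 + 1))
        have h2 := (ih p.2 (by omega) (by omega)).2
        have hK0 := supNorm_nonneg (K (p.2 + 1))
        refine (supNorm_smul_le _ _).trans ?_
        rw [abs_of_pos (by positivity)]
        calc ((p.2 + 1 : ℕ) : ℝ) * supNorm (lieE χ (p.1 + 1) (K (p.2 + 1)))
            ≤ ((p.2 + 1 : ℕ) : ℝ) * (2 * (30 * (16 / (15 * Ω)) * (n + 2 : ℕ)) * β ^ p.1
              * supNorm (K (p.2 + 1))) := by gcongr
          _ = 2 * δ * (n + 2) * β ^ p.1 * (((p.2 : ℝ) + 1) * supNorm (K (p.2 + 1))) := by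
              rw [hδ]; push_cast; field_simp; ring
          _ ≤ 2 * δ * (n + 2) * β ^ p.1 * (1 / 2 * β ^ p.2) := by
              exact mul_le_mul_of_nonneg_left (by linarith) (by positivity)
          _ = _ := by rw [← hp, pow_add]; ring
      have hfirst : supNorm (((n + 1 : ℕ) : ℝ) • poisson (χ (n + 1)) (H1 N a))
          ≤ (n + 1) * (δ / 2 * β ^ n) := by
        have h1 := supNorm_poisson_le (h.chi_homogeneous (n + 1)) (isHomogeneous_H1 (N := N) (a := a))
        have h2 := (ih n (by omega) (by omega)).1
        have h3 := supNorm_H1_le (N := N) ha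
        have h4 := supNorm_nonneg (χ (n + 1))
        refine (supNorm_smul_le _ _).trans ?_
        rw [abs_of_pos (by positivity)]
        push_cast
        refine mul_le_mul_of_nonneg_left (h1.trans ?_) (by positivity)
        calc _ ≤ 30 * (((n + 1 : ℕ) : ℝ) + 1) * ((1 : ℕ) + 1) * supNorm (χ (n + 1)) * (1 / 4) := by
              gcongr
          _ = 15 * (((n : ℝ) + 2) * supNorm (χ (n + 1))) := by push_cast; ring
          _ ≤ 15 * (16 / (15 * Ω) * β ^ n) := by gcongr
          _ = _ := by rw [hδ]; field_simp; ring
      have hmain : ((n : ℝ) + 2) * supNorm G ≤ (n + 1) * (δ * β ^ n) * (n + 5 / 2) := by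
        have h1 : G = ((n + 2 : ℕ) : ℝ)⁻¹ • (((n + 2 : ℕ) : ℝ) • G) := by
          rw [inv_smul_smul₀ (by positivity)]
        have h2 : supNorm G ≤ ((n + 2 : ℕ) : ℝ)⁻¹ * supNorm (((n + 2 : ℕ) : ℝ) • G) := by
          have := supNorm_smul_le ((n + 2 : ℕ) : ℝ)⁻¹ (((n + 2 : ℕ) : ℝ) • G)
          rwa [← h1, abs_of_pos (by positivity)] at this
        rw [inv_mul_eq_div, le_div_iff₀ (by positivity), hG, h.homological_add_two n,
          supNorm_neg] at h2
        have h3 := (supNorm_sum_le (antidiagonal n) fun p =>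
          ((p.2 + 1 : ℕ) : ℝ) • lieE χ (p.1 + 1) (K (p.2 + 1))).trans (Finset.sum_le_sum hterm)
        rw [Finset.sum_const, Finset.Nat.card_antidiagonal, nsmul_eq_mul] at h3
        have h4 := h2.trans ((supNorm_add_le _ _).trans (add_le_add hfirst h3))
        push_cast at h4
        linarith
      have hn2 : (0 : ℝ) < n + 2 := by positivity
      refine le_of_mul_le_mul_left ?_ hn2
      calc ((n : ℝ) + 2) * ((((n + 1 : ℕ) : ℝ) + 2) * supNorm G)
          = ((n : ℝ) + 3) * (((n : ℝ) + 2) * supNorm G) := by push_cast; ring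
        _ ≤ ((n : ℝ) + 3) * ((n + 1) * (δ * β ^ n) * (n + 5 / 2)) := by gcongr
        _ = (δ * β ^ n) * (((n : ℝ) + 3) * (n + 1) * (n + 5 / 2)) := by ring
        _ ≤ (δ * β ^ n) * (4 * ((n : ℝ) + 2) * r ^ 2) := by
            refine mul_le_mul_of_nonneg_left ?_ (by positivity)
            calc ((n : ℝ) + 3) * (n + 1) * (n + 5 / 2) ≤ 4 * (n + 2) * (n + 1) ^ 2 := by
                  have : (0 : ℝ) ≤ n := by positivity
                  nlinarith [mul_nonneg this this, mul_nonneg (mul_nonneg this this) this]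
              _ ≤ _ := by gcongr
        _ = ((n : ℝ) + 2) * (1 / 2 * (β ^ n * (8 * δ * r ^ 2))) := by ring
        _ = ((n : ℝ) + 2) * (1 / 2 * β ^ (n + 1)) := by rw [← hβδ, pow_succ]

theorem IsNormalForm.supNorm_lieE_le (ha : 0 < a) {r : ℕ} (hr : 1 ≤ r)
    (hb : 48 * ((r : ℝ) + 1) * (Omega N a - 1) ≤ Omega N a) {χ K : ℕ → Poly N}
    (h : IsNormalForm a r χ K) {n m : ℕ} (hnm : n + m ≤ r) {f : Poly N}
    (hf : f.IsHomogeneous (2 * m + 2)) :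
    supNorm (lieE χ (n + 1) f)
      ≤ 64 * (n + 1 + m) / Omega N a * growth N a r ^ n * supNorm f := by
  have hΩ := one_le_Omega (N := N) ha
  have h1 := KGChain.supNorm_lieE_le (χ := χ) (α := 16 / (15 * Omega N a)) (β := growth N a r)
    (by positivity) (growth_nonneg ha r) h.chi_homogeneous (n := n) (m := m) (t := n + 1 + m)
    (fun j hj => (h.supNorm_le ha hb j (by omega)).1)
    (by
      have h2 : ((n + 1 + m : ℕ) : ℝ) ≤ 2 * r := by exact_mod_cast (by omega : n + 1 + m ≤ 2 * r)
      have h3 : (n : ℝ) ≤ r := by exact_mod_cast (by omega : n ≤ r)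
      calc _ ≤ 2 * (r : ℝ) * (30 * (16 / (15 * Omega N a)) * (2 * r)) := by gcongr
        _ = 128 * (r : ℝ) ^ 2 / Omega N a := by field_simp; ring
        _ ≤ growth N a r := by
          unfold growth
          gcongr
          norm_num)
    le_rfl hf
  refine h1.trans (le_of_eq ?_)
  push_cast
  field_simp
  ring

end Growth

/-! ### Approximate integrals of motion -/

section Invariants

variable {N : ℕ} [NeZero N] {a : ℝ}

/-- The image of `H_Ω` under the Lie transform, truncated at the degree `2 k + 2`: a function of
the original variables that is almost conserved. -/
def actionSum (a : ℝ) (χ : ℕ → Poly N) (k : ℕ) : Poly N :=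
  ∑ s ∈ Finset.range (k + 1), lieE χ s (HOmega N a)

/-- The terms of degree `2 n + 4` by which the image of `𝒵` under the Lie transform differs from
`𝒵`. -/
def normalCorrection (a : ℝ) (χ K : ℕ → Poly N) (n : ℕ) : Poly N :=
  lieE χ (n + 1) (Z0 N a) + ∑ j ∈ Finset.range n, lieE χ (n - j) (K (j + 1))

variable {r : ℕ} {χ K : ℕ → Poly N}

theorem IsNormalForm.poisson_lieE_HOmega (h : IsNormalForm a r χ K) (s : ℕ) :
    ∑ p ∈ antidiagonal s, poisson (hamComponent N a p.1) (lieE χ p.2 (HOmega N a))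
      = ∑ p ∈ antidiagonal s, lieE χ p.1 (poisson (K p.2) (HOmega N a)) := by
  simp only [h.transform', poisson_sum_left, lieE_poisson]
  rw [sum_antidiagonal_assoc (fun j k l => poisson (lieE χ j (K k)) (lieE χ l (HOmega N a))),
    sum_antidiagonal_assoc (fun j l k => poisson (lieE χ j (K k)) (lieE χ l (HOmega N a)))]
  refine Finset.sum_congr rfl fun p _ => ?_
  rw [← Finset.Nat.sum_antidiagonal_swap]
  rfl

theorem IsNormalForm.poisson_K_HOmega (h : IsNormalForm a r χ K) {s : ℕ} (hs : s ≤ r) :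
    poisson (K s) (HOmega N a) = 0 := by
  rw [poisson_antisymm, neg_eq_zero]
  rcases Nat.eq_zero_or_pos s with rfl | hpos
  · rw [h.ham_zero, poisson_add_right, poisson_self, h.resonant_zero, add_zero]
  · exact h.resonant s hpos hs

theorem sum_poisson_hamComponent (F : ℕ → Poly N) (n : ℕ) :
    ∑ p ∈ antidiagonal (n + 1), poisson (hamComponent N a p.1) (F p.2)
      = poisson (H0 N a) (F (n + 1)) + poisson (H1 N a) (F n) := by
  have h0 : hamComponent N a 0 = H0 N a := by simp [hamComponent]
  have h1 : hamComponent N a (0 + 1) = H1 N a := by simp [hamComponent]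
  have h2 : ∀ k, hamComponent N a (k + 1 + 1) = 0 := fun k => by simp [hamComponent]
  rw [Finset.Nat.sum_antidiagonal_succ, h0]
  rcases n with _ | n
  · simp [hamComponent]
  · rw [Finset.Nat.sum_antidiagonal_succ, h1]
    simp only [h2, poisson_zero_left, Finset.sum_const_zero, add_zero]

/-- The formal integral `T_χ H_Ω` of `H`, degree by degree. -/
theorem IsNormalForm.poisson_H0_lieE (h : IsNormalForm a r χ K) {n : ℕ} (hn : n + 1 ≤ r) :
    poisson (H0 N a) (lieE χ (n + 1) (HOmega N a))
      + poisson (H1 N a) (lieE χ n (HOmega N a)) = 0 := by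
  rw [← sum_poisson_hamComponent (fun s => lieE χ s (HOmega N a)), h.poisson_lieE_HOmega]
  refine Finset.sum_eq_zero fun p hp => ?_
  rw [Finset.HasAntidiagonal.mem_antidiagonal] at hp
  rw [h.poisson_K_HOmega (by omega), lieE_zero_right]

/-- The first degree at which the remainder prevents `T_χ H_Ω` from being an integral. -/
theorem IsNormalForm.poisson_H0_lieE_last (h : IsNormalForm a r χ K) :
    poisson (H0 N a) (lieE χ (r + 1) (HOmega N a))
      + poisson (H1 N a) (lieE χ r (HOmega N a)) = poisson (K (r + 1)) (HOmega N a) := by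
  rw [← sum_poisson_hamComponent (fun s => lieE χ s (HOmega N a)), h.poisson_lieE_HOmega,
    Finset.Nat.sum_antidiagonal_succ, lieE_zero, Finset.sum_eq_zero, add_zero]
  intro p hp
  rw [Finset.HasAntidiagonal.mem_antidiagonal] at hp
  rw [h.poisson_K_HOmega (by omega), lieE_zero_right]

/-- All the terms of the derivative of the truncated action cancel, but the one of highest
degree. -/
theorem IsNormalForm.poisson_Ham_actionSum (ha : 0 < a) (h : IsNormalForm a r χ K) :
    ∀ k ≤ r, poisson (Ham N a) (actionSum a χ k)
      = poisson (H1 N a) (lieE χ k (HOmega N a)) := by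
  intro k
  induction k with
  | zero =>
    intro _
    have h1 : poisson (H0 N a) (HOmega N a) = 0 := by
      rw [← HOmega_add_Z0, poisson_add_left, poisson_self, zero_add, poisson_antisymm,
        poisson_HOmega_Z0 ha, neg_zero]
    simp [actionSum, lieE_zero, Ham, poisson_add_left, h1]
  | succ k ih =>
    intro hk
    rw [actionSum, Finset.sum_range_succ, poisson_add_right]
    rw [show ∑ s ∈ Finset.range (k + 1), lieE χ s (HOmega N a) = actionSum a χ k from rfl,
      ih (by omega)]
    have h1 := h.poisson_H0_lieE hk
    rw [Ham, poisson_add_left]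
    rw [← sub_eq_zero, ← h1]
    abel

theorem IsNormalForm.hamComponent_succ (h : IsNormalForm a r χ K) (n : ℕ) :
    hamComponent N a (n + 1)
      = lieE χ (n + 1) (HOmega N a) + normalCorrection a χ K n + K (n + 1) := by
  have h1 : hamComponent N a (n + 1)
      = ∑ j ∈ Finset.range (n + 1 + 1), lieE χ (n + 1 - j) (K j) := (h.transform (n + 1)).symm
  rw [h1, Finset.sum_range_succ, Finset.sum_range_succ', Nat.sub_self, lieE_zero, Nat.sub_zero,
    h.ham_zero, lieE_add, normalCorrection]
  simp only [Nat.add_sub_add_right]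
  abel

theorem normalZ_eq (r : ℕ) (K : ℕ → Poly N) :
    normalZ a r K = Z0 N a + ∑ n ∈ Finset.range r, K (n + 1) := by
  rw [normalZ, Finset.range_eq_Ico, Finset.sum_Ico_add' K 0 r 1, zero_add]
  rfl

/-- The Lie transform of `𝒵`, truncated at the degree `2 r + 4`, in terms of that of `H_Ω`. -/
theorem IsNormalForm.normalZ_add_corrections (hr : 1 ≤ r) (h : IsNormalForm a r χ K) :
    normalZ a r K + ∑ n ∈ Finset.range (r + 1), normalCorrection a χ K n
      = Ham N a - actionSum a χ (r + 1) - K (r + 1) := by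
  have h1 : ∑ s ∈ Finset.range (r + 2), hamComponent N a s = Ham N a := by
    obtain ⟨k, rfl⟩ : ∃ k, r = k + 1 := ⟨r - 1, by omega⟩
    rw [Finset.sum_range_succ', Finset.sum_range_succ']
    simp [hamComponent, Ham]
    ring
  rw [Finset.sum_range_succ' (fun s => hamComponent N a s),
    Finset.sum_congr rfl fun n _ => h.hamComponent_succ n, Finset.sum_add_distrib,
    Finset.sum_add_distrib, Finset.sum_range_succ (fun n => K (n + 1)),
    show hamComponent N a 0 = HOmega N a + Z0 N a by simp [hamComponent, HOmega_add_Z0]] at h1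
  rw [← h1, actionSum, Finset.sum_range_succ' (fun s => lieE χ s (HOmega N a)), lieE_zero,
    normalZ_eq]
  abel

/-- The derivative of the truncated image of `𝒵`: the energy is conserved, the contribution of
`H_Ω` is that of `actionSum`, and the highest terms combine so that `Z_0`, rather than `H_0`,
is what the remainder is bracketed with. -/
theorem IsNormalForm.poisson_Ham_normalZ (ha : 0 < a) (hr : 1 ≤ r) (h : IsNormalForm a r χ K) :
    poisson (Ham N a) (normalZ a r K + ∑ n ∈ Finset.range (r + 1), normalCorrection a χ K n)
      = poisson (K (r + 1)) (Z0 N a) + poisson (H1 N a) (normalCorrection a χ K r) := by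
  have h1 := h.poisson_Ham_actionSum ha r le_rfl
  have h2 := h.poisson_H0_lieE_last
  have h3 : lieE χ (r + 1) (HOmega N a) + normalCorrection a χ K r + K (r + 1) = 0 := by
    rw [← h.hamComponent_succ]
    simp [hamComponent, show r ≠ 0 by omega]
  have h4 : normalCorrection a χ K r = -(lieE χ (r + 1) (HOmega N a)) - K (r + 1) := by
    rw [← sub_eq_zero, ← h3]; abel
  rw [h.normalZ_add_corrections hr, actionSum, Finset.sum_range_succ,
    show ∑ s ∈ Finset.range (r + 1), lieE χ s (HOmega N a) = actionSum a χ r from rfl,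
    poisson_sub_right, poisson_sub_right, poisson_add_right, poisson_self, h1, h4, Z0,
    poisson_sub_right, poisson_sub_right, poisson_neg_right, ← h2, Ham, poisson_add_left,
    poisson_add_left, poisson_antisymm (K (r + 1)) (H0 N a)]
  abel

end Invariants

/-! ### Estimates of the approximate integrals -/

section InvariantEstimates

variable {N : ℕ} [NeZero N] {a : ℝ} {r : ℕ} {χ K : ℕ → Poly N}

theorem abs_eval_le_of_norm_le {σ : Type*} [Fintype σ] {F : MvPolynomial σ ℝ} {d : ℕ} {M ρ : ℝ}
    (hF : F.IsHomogeneous d) (hM : supNorm F ≤ M) {z : EuclideanSpace ℝ σ} (hz : ‖z‖ ≤ ρ) :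
    |eval (fun i => z i) F| ≤ M * ρ ^ d :=
  (abs_eval_le hF z).trans (mul_le_mul hM (pow_le_pow_left₀ (norm_nonneg z) hz d) (by positivity)
    ((supNorm_nonneg F).trans hM))

theorem sum_add_one_mul_pow_le {u : ℝ} (h0 : 0 ≤ u) (h1 : u ≤ 1 / 25) (n : ℕ) :
    ∑ k ∈ Finset.range n, ((k : ℝ) + 1) * u ^ k ≤ 9 / 8 := by
  have hk : ∀ k : ℕ, ((k : ℝ) + 1) * u ^ k ≤ (2 / 25) ^ k := fun k => by
    have h2 : (k : ℝ) + 1 ≤ 2 ^ k := by exact_mod_cast Nat.lt_two_pow_self (n := k)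
    calc ((k : ℝ) + 1) * u ^ k ≤ 2 ^ k * (1 / 25) ^ k := by gcongr
      _ = (2 / 25) ^ k := by rw [← mul_pow]; norm_num
  refine (Finset.sum_le_sum fun k _ => hk k).trans ?_
  rw [geom_sum_eq (by norm_num)]
  have : (0 : ℝ) < (2 / 25) ^ n := by positivity
  rw [div_le_iff_of_neg (by norm_num)]
  linarith

theorem sum_mul_add_one_mul_pow_le {u : ℝ} (h0 : 0 ≤ u) (h1 : u ≤ 1 / 25) (n : ℕ) :
    ∑ k ∈ Finset.range n, ((k : ℝ) * (k + 1)) * u ^ (k - 1) ≤ 3 := by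
  rcases n with _ | n
  · simp
  rw [Finset.sum_range_succ']
  have hk : ∀ k : ℕ, (((k + 1 : ℕ) : ℝ) * ((k + 1 : ℕ) + 1)) * u ^ (k + 1 - 1)
      ≤ 2 * (4 / 25) ^ k := fun k => by
    have h2 : (k : ℝ) + 1 ≤ 2 ^ k := by exact_mod_cast Nat.lt_two_pow_self (n := k)
    calc (((k + 1 : ℕ) : ℝ) * ((k + 1 : ℕ) + 1)) * u ^ (k + 1 - 1)
        ≤ (2 ^ k * (2 * 2 ^ k)) * (1 / 25) ^ k := by
          rw [Nat.add_sub_cancel]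
          push_cast
          gcongr
          linarith
      _ = 2 * ((2 * 2) ^ k * (1 / 25) ^ k) := by rw [mul_pow]; ring
      _ = 2 * (4 / 25) ^ k := by rw [← mul_pow]; norm_num
  have h3 := Finset.sum_le_sum fun k (_ : k ∈ Finset.range n) => hk k
  rw [← Finset.mul_sum, geom_sum_eq (by norm_num)] at h3
  have h4 : (0 : ℝ) < (4 / 25) ^ n := by positivity
  have h5 : ((4 / 25 : ℝ) ^ n - 1) / (4 / 25 - 1) ≤ 3 / 2 := by
    rw [div_le_iff_of_neg (by norm_num)]
    linarith
  simp only [Nat.cast_zero, zero_mul, add_zero]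
  linarith

theorem IsNormalForm.isHomogeneous_normalCorrection (ha : 0 < a) (h : IsNormalForm a r χ K)
    (n : ℕ) :
    (normalCorrection a χ K n).IsHomogeneous (2 * (n + 1) + 2) := by
  refine (lieE_isHomogeneous h.chi_homogeneous (isHomogeneous_Z0 ha) (n + 1)).add
    (IsHomogeneous.sum _ _ _ fun j hj => ?_)
  rw [Finset.mem_range] at hj
  have := lieE_isHomogeneous h.chi_homogeneous (h.ham_homogeneous (j + 1)) (n - j)
  rwa [show n - j + (j + 1) = n + 1 by omega] at this

section

variable (ha : 0 < a) (hr : 1 ≤ r) (hb : 48 * ((r : ℝ) + 1) * (Omega N a - 1) ≤ Omega N a)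
  (h : IsNormalForm a r χ K)

include ha hr hb h

theorem IsNormalForm.supNorm_lieE_HOmega_le {n : ℕ} (hn : n ≤ r) :
    supNorm (lieE χ (n + 1) (HOmega N a)) ≤ 32 * (n + 1) * growth N a r ^ n := by
  have hΩ := one_le_Omega (N := N) ha
  have hβ := growth_nonneg (N := N) ha r
  have h1 := h.supNorm_lieE_le ha hr hb (n := n) (m := 0) hn (isHomogeneous_HOmega a)
  have h2 := supNorm_HOmega_le (N := N) (a := a) (by linarith)
  calc _ ≤ 64 * (n + 1 + (0 : ℕ)) / Omega N a * growth N a r ^ n * (Omega N a / 2) :=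
        h1.trans (by gcongr)
    _ = _ := by field_simp; push_cast; ring

theorem IsNormalForm.supNorm_normalCorrection_le {n : ℕ} (hn : n ≤ r) :
    supNorm (normalCorrection a χ K n)
      ≤ (32 * (n + 1) * (Omega N a - 1) * growth N a r ^ n
        + 16 * (n * (n + 1)) * growth N a r ^ (n - 1)) / Omega N a := by
  have hΩ := one_le_Omega (N := N) ha
  have hΩ0 : 0 < Omega N a := by linarith
  have hβ := growth_nonneg (N := N) ha r
  set β := growth N a r
  have h1 : supNorm (lieE χ (n + 1) (Z0 N a))
      ≤ 32 * (n + 1) * (Omega N a - 1) * β ^ n / Omega N a := by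
    have h1 := h.supNorm_lieE_le ha hr hb (n := n) (m := 0) hn (isHomogeneous_Z0 ha)
    have h2 := supNorm_Z0_le (N := N) ha
    calc _ ≤ 64 * (n + 1 + (0 : ℕ)) / Omega N a * β ^ n * ((Omega N a - 1) / 2) :=
          h1.trans (by gcongr)
      _ = _ := by push_cast; ring
  have h2 : ∀ j ∈ Finset.range n, supNorm (lieE χ (n - j) (K (j + 1)))
      ≤ 16 * (n + 1) * β ^ (n - 1) / Omega N a := by
    intro j hj
    rw [Finset.mem_range] at hj
    obtain ⟨k, rfl⟩ : ∃ k, n = j + k + 1 := ⟨n - j - 1, by omega⟩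
    have h3 := h.supNorm_lieE_le ha hr hb (n := k) (m := j + 1) (by omega)
      (h.ham_homogeneous (j + 1))
    have h4 := (h.supNorm_le ha hb j (by omega)).2
    have h5 : supNorm (K (j + 1)) ≤ 1 / 4 * β ^ j := by
      have h6 := supNorm_nonneg (K (j + 1))
      have h7 : (0 : ℝ) ≤ j := by positivity
      nlinarith
    rw [show j + k + 1 - j = k + 1 by omega, Nat.add_sub_cancel]
    calc _ ≤ 64 * (k + 1 + (j + 1 : ℕ)) / Omega N a * β ^ k * (1 / 4 * β ^ j) :=
          h3.trans (by gcongr)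
      _ = _ := by rw [pow_add]; push_cast; ring
  have h3 := (supNorm_sum_le (Finset.range n) fun j => lieE χ (n - j) (K (j + 1))).trans
    (Finset.sum_le_sum h2)
  rw [Finset.sum_const, Finset.card_range, nsmul_eq_mul] at h3
  refine (supNorm_add_le _ _).trans ((add_le_add h1 h3).trans (le_of_eq ?_))
  ring

variable {ρ : ℝ} {z : Phase N} (hz : ‖z‖ ≤ ρ)

include hz

theorem IsNormalForm.abs_actionSum_sub_le (hu : growth N a r * ρ ^ 2 ≤ 1 / 25) :
    |eval (fun i => z i) (actionSum a χ r) - eval (fun i => z i) (HOmega N a)| ≤ 36 * ρ ^ 4 := by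
  have hβ := growth_nonneg (N := N) ha r
  rw [actionSum, Finset.sum_range_succ', lieE_zero, map_add, add_sub_cancel_right, map_sum]
  calc _ ≤ ∑ n ∈ Finset.range r, 32 * ρ ^ 4 * (((n : ℝ) + 1) * (growth N a r * ρ ^ 2) ^ n) := by
        refine (Finset.abs_sum_le_sum_abs _ _).trans (Finset.sum_le_sum fun n hn => ?_)
        rw [Finset.mem_range] at hn
        refine (abs_eval_le_of_norm_le (lieE_isHomogeneous h.chi_homogeneous
          (isHomogeneous_HOmega a) (n + 1)) (h.supNorm_lieE_HOmega_le ha hr hb hn.le) hz).trans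
          (le_of_eq ?_)
        rw [mul_pow]
        ring
    _ ≤ 32 * ρ ^ 4 * (9 / 8) := by
        rw [← Finset.mul_sum]
        exact mul_le_mul_of_nonneg_left (sum_add_one_mul_pow_le (by positivity) hu r)
          (by positivity)
    _ = _ := by ring

theorem IsNormalForm.abs_normalCorrections_le (hu : growth N a r * ρ ^ 2 ≤ 1 / 25) :
    |eval (fun i => z i) (∑ n ∈ Finset.range (r + 1), normalCorrection a χ K n)|
      ≤ 36 * (Omega N a - 1) * ρ ^ 4 + 48 * ρ ^ 6 := by
  have hΩ := one_le_Omega (N := N) ha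
  have hΩ0 : 0 ≤ Omega N a - 1 := by linarith
  have hβ := growth_nonneg (N := N) ha r
  set β := growth N a r
  rw [map_sum]
  calc _ ≤ ∑ n ∈ Finset.range (r + 1), (32 * (Omega N a - 1) * ρ ^ 4 *
          (((n : ℝ) + 1) * (β * ρ ^ 2) ^ n)
          + 16 * ρ ^ 6 * (((n : ℝ) * (n + 1)) * (β * ρ ^ 2) ^ (n - 1))) := by
        refine (Finset.abs_sum_le_sum_abs _ _).trans (Finset.sum_le_sum fun n hn => ?_)
        rw [Finset.mem_range] at hn
        have h1 := h.supNorm_normalCorrection_le ha hr hb (n := n) (by omega)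
        refine (abs_eval_le_of_norm_le (h.isHomogeneous_normalCorrection ha n)
          (h1.trans (div_le_self (by positivity) hΩ)) hz).trans (le_of_eq ?_)
        rcases n with _ | n
        · simp
        · rw [Nat.add_sub_cancel, mul_pow, mul_pow]
          push_cast
          ring
    _ ≤ 32 * (Omega N a - 1) * ρ ^ 4 * (9 / 8) + 16 * ρ ^ 6 * 3 := by
        rw [Finset.sum_add_distrib, ← Finset.mul_sum, ← Finset.mul_sum]
        exact add_le_add
          (mul_le_mul_of_nonneg_left (sum_add_one_mul_pow_le (by positivity) hu _)
            (by positivity))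
          (mul_le_mul_of_nonneg_left (sum_mul_add_one_mul_pow_le (by positivity) hu _)
            (by positivity))
    _ = _ := by ring

/-- The truncated action drifts slowly. -/
theorem IsNormalForm.abs_poisson_actionSum_le :
    |eval (fun i => z i) (poisson (Ham N a) (actionSum a χ r))|
      ≤ 15 / 4 * Omega N a * ((growth N a r * ρ ^ 2) ^ r * ρ ^ 4) := by
  have hΩ := one_le_Omega (N := N) ha
  have hβ := growth_nonneg (N := N) ha r
  rw [h.poisson_Ham_actionSum ha r le_rfl]
  obtain ⟨n, rfl⟩ : ∃ n, r = n + 1 := ⟨r - 1, by omega⟩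
  have hΦ := lieE_isHomogeneous h.chi_homogeneous (isHomogeneous_HOmega (N := N) a) (n + 1)
  have h1 := supNorm_poisson_le (isHomogeneous_H1 (N := N) (a := a)) hΦ
  have h2 := h.supNorm_lieE_HOmega_le ha hr hb (n := n) (by omega)
  have h3 := supNorm_H1_le (N := N) ha
  have h4 := supNorm_nonneg (lieE χ (n + 1) (HOmega N a))
  have h5 : supNorm (poisson (H1 N a) (lieE χ (n + 1) (HOmega N a)))
      ≤ 15 / 4 * Omega N a * growth N a (n + 1) ^ (n + 1) := by
    calc _ ≤ 30 * ((1 : ℕ) + 1) * (((n + 1 + 0 : ℕ) : ℝ) + 1) * (1 / 4)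
          * (32 * (n + 1) * growth N a (n + 1) ^ n) := h1.trans (by gcongr)
      _ = 480 * (((n : ℝ) + 1) * (n + 2)) * growth N a (n + 1) ^ n := by push_cast; ring
      _ ≤ 480 * (2 * ((n : ℝ) + 1) ^ 2) * growth N a (n + 1) ^ n := by
          have h6 : ((n : ℝ) + 1) * (n + 2) ≤ 2 * ((n : ℝ) + 1) ^ 2 := by
            nlinarith [(by positivity : (0 : ℝ) ≤ n)]
          exact mul_le_mul_of_nonneg_right (mul_le_mul_of_nonneg_left h6 (by norm_num))
            (pow_nonneg hβ n)
      _ = 15 / 4 * Omega N a * (growth N a (n + 1) ^ n * (256 * ((n + 1 : ℕ) : ℝ) ^ 2 / Omega N a))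
          := by field_simp; push_cast; ring
      _ = _ := by rw [pow_succ]; rfl
  refine (abs_eval_le_of_norm_le (isHomogeneous_poisson isHomogeneous_H1 hΦ) h5 hz).trans
    (le_of_eq ?_)
  rw [mul_pow, ← pow_mul]
  ring

/-- The Lie transform of `𝒵` drifts slowly. The remainder acts on `Z_0`, which is of the size of
the coupling, or gives two degrees more. -/
theorem IsNormalForm.abs_poisson_normalZ_le (hu : growth N a r * ρ ^ 2 ≤ 1 / 25) :
    |eval (fun i => z i) (poisson (Ham N a)
        (normalZ a r K + ∑ n ∈ Finset.range (r + 1), normalCorrection a χ K n))|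
      ≤ 8 * (Omega N a - 1) * ((growth N a r * ρ ^ 2) ^ r * ρ ^ 4)
        + 6 * (r * (growth N a r * ρ ^ 2) ^ r * ρ ^ 6) := by
  have hΩ := one_le_Omega (N := N) ha
  have hΩ0 : 0 ≤ Omega N a - 1 := by linarith
  have hβ := growth_nonneg (N := N) ha r
  have hρ : 0 ≤ ρ := (norm_nonneg z).trans hz
  have hr1 : (1 : ℝ) ≤ r := by exact_mod_cast hr
  rw [h.poisson_Ham_normalZ ha hr, map_add]
  set β := growth N a r with hβd
  set b := Omega N a - 1 with hbd
  have hβΩ : (r : ℝ) ^ 2 / Omega N a = β / 256 := by rw [hβd, growth]; ring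
  have h1 : supNorm (poisson (K (r + 1)) (Z0 N a)) ≤ 15 / 2 * b * β ^ r := by
    have h1 := supNorm_poisson_le (h.ham_homogeneous (r + 1)) (isHomogeneous_Z0 (N := N) ha)
    have h2 := (h.supNorm_le ha hb r le_rfl).2
    have h3 := supNorm_Z0_le (N := N) ha
    have h4 := supNorm_nonneg (K (r + 1))
    calc _ ≤ 30 * (((r + 1 : ℕ) : ℝ) + 1) * ((0 : ℕ) + 1) * supNorm (K (r + 1)) * (b / 2) :=
          h1.trans (by gcongr)
      _ = 15 * b * (((r : ℝ) + 2) * supNorm (K (r + 1))) := by push_cast; ring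
      _ ≤ 15 * b * (1 / 2 * β ^ r) := by gcongr
      _ = _ := by ring
  have h2 : supNorm (poisson (H1 N a) (normalCorrection a χ K r))
      ≤ 45 / 4 * b * β ^ (r + 1) + 45 / 8 * r * β ^ r := by
    have h1 := supNorm_poisson_le (isHomogeneous_H1 (N := N) (a := a))
      (h.isHomogeneous_normalCorrection ha r)
    have h2 := h.supNorm_normalCorrection_le ha hr hb (n := r) le_rfl
    have h3 := supNorm_H1_le (N := N) ha
    have h4 := supNorm_nonneg (normalCorrection a χ K r)
    have h5 : ((r : ℝ) + 2) * (r + 1) ≤ 6 * r ^ 2 := by nlinarith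
    calc _ ≤ 30 * ((1 : ℕ) + 1) * (((r + 1 : ℕ) : ℝ) + 1) * (1 / 4)
          * ((32 * (r + 1) * b * β ^ r + 16 * (r * (r + 1)) * β ^ (r - 1)) / Omega N a) :=
          h1.trans (by gcongr)
      _ = 15 * (((r : ℝ) + 2) * (r + 1)) * ((32 * b * β ^ r + 16 * r * β ^ (r - 1)) / Omega N a) := by
          push_cast; ring
      _ ≤ 15 * (6 * (r : ℝ) ^ 2) * ((32 * b * β ^ r + 16 * r * β ^ (r - 1)) / Omega N a) := by
          gcongr
      _ = 90 * ((r : ℝ) ^ 2 / Omega N a) * (32 * b * β ^ r + 16 * r * β ^ (r - 1)) := by ring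
      _ = 45 / 4 * b * (β ^ r * β) + 45 / 8 * r * (β ^ (r - 1) * β) := by rw [hβΩ]; ring
      _ = _ := by rw [← pow_succ, ← pow_succ, Nat.sub_add_cancel hr]
  have h3 := abs_eval_le_of_norm_le (isHomogeneous_poisson (h.ham_homogeneous (r + 1))
    (isHomogeneous_Z0 ha)) h1 hz
  have h4 := abs_eval_le_of_norm_le (isHomogeneous_poisson isHomogeneous_H1
    (h.isHomogeneous_normalCorrection ha r)) h2 hz
  refine (abs_add_le _ _).trans ((add_le_add h3 h4).trans ?_)
  have e1 : 15 / 2 * b * β ^ r * ρ ^ (2 * (r + 1 + 0) + 2)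
      = 15 / 2 * b * ((β * ρ ^ 2) ^ r * ρ ^ 4) := by
    rw [mul_pow, ← pow_mul]; ring
  have e2 : (45 / 4 * b * β ^ (r + 1) + 45 / 8 * r * β ^ r) * ρ ^ (2 * (1 + (r + 1)) + 2)
      = 45 / 4 * b * ((β * ρ ^ 2) ^ r * ρ ^ 4) * (β * ρ ^ 2)
        + 45 / 8 * (r * (β * ρ ^ 2) ^ r * ρ ^ 6) := by
    rw [mul_pow, ← pow_mul]; ring
  rw [e1, e2]
  have h5 : 0 ≤ b * ((β * ρ ^ 2) ^ r * ρ ^ 4) := by positivity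
  have h6 : 0 ≤ r * (β * ρ ^ 2) ^ r * ρ ^ 6 := by positivity
  nlinarith [mul_le_mul_of_nonneg_left hu h5]

end

end InvariantEstimates

/-! ### Solutions of the Hamilton equations -/

section Orbits

variable {N : ℕ} [NeZero N]

theorem IsOrbit.hasDerivAt_eval {G : Poly N} {z : ℝ → Phase N} (hz : IsOrbit G z) (F : Poly N)
    (t : ℝ) : HasDerivAt (fun t => eval (fun i => z t i) F)
      (eval (fun i => z t i) (poisson F G)) t := by
  have hi : ∀ i, HasDerivAt (fun t => z t i) (hamField G (z t) i) t := fun i =>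
    (EuclideanSpace.proj (𝕜 := ℝ) i).hasFDerivAt.comp_hasDerivAt t (hz t)
  have h : HasDerivAt (fun t => eval (fun i => z t i) F)
      (∑ i, hamField G (z t) i * eval (fun i => z t i) (pderiv i F)) t :=
    hasDerivAt_aeval (A := ℝ) F hi
  refine h.congr_deriv ?_
  rw [Fintype.sum_sum_type, poisson, map_sum, ← Finset.sum_add_distrib]
  refine Finset.sum_congr rfl fun j _ => ?_
  simp only [hamField, map_sub, map_mul, Sum.elim_inl, Sum.elim_inr]
  ring

theorem IsOrbit.abs_eval_sub_le {G : Poly N} {z : ℝ → Phase N} (hz : IsOrbit G z) {F : Poly N}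
    {M : ℝ} (hM : ∀ s, |eval (fun i => z s i) (poisson G F)| ≤ M) (t : ℝ) :
    |eval (fun i => z t i) F - eval (fun i => z 0 i) F| ≤ M * |t| := by
  have h := convex_univ.norm_image_sub_le_of_norm_hasDerivWithin_le (C := M)
    (fun s _ => (hz.hasDerivAt_eval F s).hasDerivWithinAt)
    (fun s _ => by rw [poisson_antisymm, map_neg, norm_neg]; exact hM s)
    (Set.mem_univ (0 : ℝ)) (Set.mem_univ t)
  rwa [sub_zero] at h

theorem IsOrbit.eval_eq {G : Poly N} {z : ℝ → Phase N} (hz : IsOrbit G z) (t : ℝ) :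
    eval (fun i => z t i) G = eval (fun i => z 0 i) G := by
  have h := hz.abs_eval_sub_le (F := G) (M := 0) (fun s => by rw [poisson_self]; simp) t
  rw [zero_mul] at h
  exact sub_eq_zero.mp (abs_nonpos_iff.mp h)

variable {a : ℝ}

theorem eval_HOmega (z : Phase N) :
    eval (fun i => z i) (HOmega N a) = Omega N a / 2 * ‖z‖ ^ 2 := by
  rw [EuclideanSpace.norm_sq_eq, Fintype.sum_sum_type, ← Finset.sum_add_distrib]
  simp [HOmega]

/-- Conservation of energy confines the solutions: the quadratic part of the Hamiltonian is close
to half the square of the norm, and the quartic part is nonnegative and small. -/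
theorem IsOrbit.norm_le (ha : 0 < a) (hΩ : Omega N a ≤ 255 / 254) {z : ℝ → Phase N}
    (hz : IsOrbit (Ham N a) z) {R : ℝ} (hR : R ^ 2 ≤ 1 / 100) (h0 : ‖z 0‖ ≤ R / 9) (t : ℝ) :
    ‖z t‖ ≤ R / 8 := by
  have hR0 : 0 ≤ R := by linarith [norm_nonneg (z 0)]
  have hΩ1 := one_le_Omega (N := N) ha
  have hH : ∀ w : Phase N, eval (fun i => w i) (Ham N a)
      = Omega N a / 2 * ‖w‖ ^ 2 + eval (fun i => w i) (Z0 N a) + eval (fun i => w i) (H1 N a) :=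
    fun w => by rw [Ham, ← HOmega_add_Z0, map_add, map_add, eval_HOmega]
  have hZ : ∀ w : Phase N, |eval (fun i => w i) (Z0 N a)| ≤ (Omega N a - 1) / 2 * ‖w‖ ^ 2 :=
    fun w => abs_eval_le_of_norm_le (isHomogeneous_Z0 ha) (supNorm_Z0_le ha) le_rfl
  have h1 : |eval (fun i => z 0 i) (H1 N a)| ≤ 1 / 4 * (R / 9) ^ 4 :=
    abs_eval_le_of_norm_le isHomogeneous_H1 (supNorm_H1_le ha) h0
  have h2 := eval_H1_nonneg (N := N) (a := a) (fun i => z t i)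
  have h3 := hz.eval_eq t
  rw [hH, hH] at h3
  have h4 := (abs_le.mp (hZ (z t))).1
  have h5 := (abs_le.mp (hZ (z 0))).2
  have h6 := (abs_le.mp h1).2
  have h7 : ‖z 0‖ ^ 2 ≤ (R / 9) ^ 2 := pow_le_pow_left₀ (norm_nonneg _) h0 2
  have h8 : (2 * Omega N a - 1) * ‖z 0‖ ^ 2 ≤ (2 * (255 / 254) - 1) * (R / 9) ^ 2 := by gcongr
  have h9 : (R / 9) ^ 4 ≤ 1 / 8100 * (R / 9) ^ 2 := by
    have h10 : (R / 9) ^ 2 ≤ 1 / 8100 := by rw [div_pow]; linarith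
    nlinarith [sq_nonneg (R / 9)]
  refine le_of_sq_le_sq ?_ (by positivity)
  nlinarith [sq_nonneg R]

end Orbits

/-! ### The constants -/

section Constants

variable {a : ℝ}

theorem exp_neg_sigma0 (ha : 0 < a) : Real.exp (-sigma0 a) = 2 * mu a := by
  have : 0 < mu a := by unfold mu; positivity
  rw [sigma0, neg_neg, Real.exp_log (by positivity)]

theorem mu_pos (ha : 0 < a) : 0 < mu a := by unfold mu; positivity

theorem exp_neg_natCast_mul_sigmaStar_le (hσ : Real.log 4 ≤ sigmaStar a) (n : ℕ) :
    Real.exp (-(n * sigmaStar a)) ≤ (1 / 4) ^ n := by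
  rw [← mul_neg, Real.exp_nat_mul, one_div, ← Real.exp_log (show (0 : ℝ) < 4 by norm_num),
    ← Real.exp_neg]
  gcongr

theorem sigma0_eq (a : ℝ) : sigma0 a = (4 : ℕ) * sigmaStar a := by
  rw [sigmaStar]; push_cast; ring

theorem sigma1_eq (a : ℝ) : sigma1 a = (2 : ℕ) * sigmaStar a := by
  rw [sigma1, sigmaStar]; push_cast; ring

theorem sigmaStar_pos (hσ : Real.log 4 ≤ sigmaStar a) : 0 < sigmaStar a :=
  (Real.log_pos (by norm_num)).trans_le hσ

theorem two_mul_mu_le (ha : 0 < a) (hσ : Real.log 4 ≤ sigmaStar a) : 2 * mu a ≤ 1 / 256 := by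
  rw [← exp_neg_sigma0 ha, sigma0_eq]
  exact (exp_neg_natCast_mul_sigmaStar_le hσ 4).trans (by norm_num)

theorem exp_neg_sigma1_le (hσ : Real.log 4 ≤ sigmaStar a) : Real.exp (-sigma1 a) ≤ 1 / 16 := by
  rw [sigma1_eq]
  exact (exp_neg_natCast_mul_sigmaStar_le hσ 2).trans (by norm_num)

theorem le_exp_sigma1 (hσ : Real.log 4 ≤ sigmaStar a) : 16 ≤ Real.exp (sigma1 a) := by
  have h := exp_neg_sigma1_le hσ
  rw [Real.exp_neg, inv_le_comm₀ (Real.exp_pos _) (by norm_num)] at h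
  linarith

theorem coupling_le (ha : 0 < a) (hσ : Real.log 4 ≤ sigmaStar a) : a ≤ 1 / 510 := by
  have h := two_mul_mu_le ha hσ
  rw [mu, mul_div_assoc', div_le_iff₀ (by positivity)] at h
  linarith

theorem E0star_eq (hσ : Real.log 4 ≤ sigmaStar a) : E0star a = 1 / 3 := by
  have h := sigmaStar_pos hσ
  rw [E0star, sigma0_eq, sigma1_eq, min_eq_right (by push_cast; linarith)]
  push_cast
  field_simp
  norm_num

variable {N : ℕ} [NeZero N] {Cζ Ch : ℝ} {r : ℕ}

/-- The common factor of `μ_*` and of `1 / C_*`. -/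
theorem decay_factor_mem_Ioc (hσ : Real.log 4 ≤ sigmaStar a) :
    0 < (1 - Real.exp (-sigma0 a)) * (1 - Real.exp (-(sigma0 a - sigmaStar a))) ∧
      (1 - Real.exp (-sigma0 a)) * (1 - Real.exp (-(sigma0 a - sigmaStar a))) ≤ 1 := by
  have h := sigmaStar_pos hσ
  have h0 : Real.exp (-sigma0 a) < 1 := by
    rw [Real.exp_lt_one_iff, sigma0_eq]; push_cast; linarith
  have h1 : Real.exp (-(sigma0 a - sigmaStar a)) < 1 := by
    rw [Real.exp_lt_one_iff, sigma0_eq]; push_cast; linarith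
  have h2 := Real.exp_pos (-sigma0 a)
  have h3 := Real.exp_pos (-(sigma0 a - sigmaStar a))
  exact ⟨mul_pos (by linarith) (by linarith), by nlinarith⟩

theorem muStar_pos (ha : 0 < a) (hσ : Real.log 4 ≤ sigmaStar a) (hζ : 0 < Cζ) :
    0 < muStar N a Cζ := by
  have h1 := (decay_factor_mem_Ioc hσ).1
  have h2 := one_le_Omega (N := N) ha
  rw [muStar, E0star_eq hσ, mul_assoc (Omega N a)]
  positivity

theorem muStar_mul_le (ha : 0 < a) (hσ : Real.log 4 ≤ sigmaStar a) (hζ : 0 < Cζ) :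
    muStar N a Cζ * Cζ ≤ Omega N a / 384 := by
  obtain ⟨h0, h1⟩ := decay_factor_mem_Ioc hσ
  have h2 := one_le_Omega (N := N) ha
  have h3 := le_exp_sigma1 hσ
  rw [muStar, E0star_eq hσ, mul_assoc (Omega N a), div_mul_eq_mul_div,
    div_le_iff₀ (by positivity)]
  calc _ ≤ Omega N a * 1 * (1 / 3) * Cζ := by gcongr
    _ = Omega N a / 384 * (8 * Cζ * 16) := by ring
    _ ≤ _ := by gcongr

theorem order_mul_mu_lt (ha : 0 < a)
    (hr : (r : ℝ) < 1 / 2 * (muStar N a Cζ / mu a)) : r * mu a < muStar N a Cζ / 2 := by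
  have h := mu_pos ha
  rw [mul_div_assoc', lt_div_iff₀ h] at hr
  linarith

/-- The order of the normal form is at most a small multiple of the inverse of the coupling. -/
theorem order_mul_le (ha : 0 < a) (hσ : Real.log 4 ≤ sigmaStar a) (hζ : 0 < Cζ)
    (hr : (r : ℝ) < 1 / 2 * (muStar N a Cζ / mu a)) : r * (Cζ * mu a) ≤ Omega N a / 768 := by
  have h1 := order_mul_mu_lt ha hr
  have h2 := muStar_mul_le (N := N) ha hσ hζ
  nlinarith

theorem Omega_sub_one_le (ha : 0 < a) (hσ : Real.log 4 ≤ sigmaStar a) {ζ : ℕ → Poly N}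
    (hζ : IsDecayingSeed 2 Cζ (sigma0 a) ζ (Z0 N a)) (h0 : ζ 0 = 0) :
    Omega N a - 1 ≤ 5 * (Cζ * mu a) := by
  have h1 := Omega_sub_one_le_of_isDecayingSeed ha hζ h0
  have h2 := two_mul_mu_le ha hσ
  have h3 := one_le_Omega (N := N) ha
  have h4 := mul_pos hζ.C_pos (mu_pos ha)
  rw [exp_neg_sigma0 ha] at h1
  nlinarith

/-- Up to the order of the normal form, `Z_0` is a small perturbation of `H_Ω`: the smallness
assumed in the estimate of the homological equation. -/
theorem nonresonance (ha : 0 < a) (hσ : Real.log 4 ≤ sigmaStar a) {ζ : ℕ → Poly N}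
    (hζ : IsDecayingSeed 2 Cζ (sigma0 a) ζ (Z0 N a)) (h0 : ζ 0 = 0) (hr1 : 1 ≤ r)
    (hr : (r : ℝ) < 1 / 2 * (muStar N a Cζ / mu a)) :
    48 * ((r : ℝ) + 1) * (Omega N a - 1) ≤ Omega N a := by
  have h1 := order_mul_le ha hσ hζ.C_pos hr
  have h2 := Omega_sub_one_le ha hσ hζ h0
  have h3 : (1 : ℝ) ≤ r := by exact_mod_cast hr1
  have h4 := one_le_Omega (N := N) ha
  nlinarith

theorem le_of_isDecayingSeed_H1 (ha : 0 < a) (hσ : Real.log 4 ≤ sigmaStar a) {h : ℕ → Poly N}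
    (hh : IsDecayingSeed 4 Ch (sigma1 a) h (H1 N a)) : 15 / 64 ≤ Ch := by
  have h1 := one_sub_exp_le_of_isDecayingSeed ha hh
  have h2 := exp_neg_sigma1_le hσ
  linarith

theorem le_Cr (ha : 0 < a) (hσ : Real.log 4 ≤ sigmaStar a) (hζ : 0 < Cζ) (hh : 0 < Ch)
    (hr : (r : ℝ) < 1 / 2 * (muStar N a Cζ / mu a)) :
    96 * (r : ℝ) ^ 2 * Ch / Omega N a ≤ Cr N a Cζ Ch r := by
  have hμ := muStar_pos (N := N) ha hσ hζ
  have h1 := order_mul_mu_lt ha hr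
  have h2 := one_le_Omega (N := N) ha
  have h3 : r * mu a / muStar N a Cζ < 1 / 2 := by rw [div_lt_iff₀ hμ]; linarith
  have h4 : 0 ≤ r * mu a / muStar N a Cζ := by have := mu_pos ha; positivity
  obtain ⟨h5, h6⟩ := decay_factor_mem_Ioc hσ
  have h7 : 0 < gammaC N a Cζ r := by
    unfold gammaC; exact mul_pos (by linarith) (by linarith)
  have h8 : gammaC N a Cζ r ≤ 2 * Omega N a := by unfold gammaC; nlinarith
  have h9 : Ch / (2 * Omega N a * 1 * (1 / 3)) ≤ Cstar N a Cζ Ch r := by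
    rw [Cstar, E0star_eq hσ, mul_assoc (gammaC N a Cζ r)]
    gcongr
  calc _ = 64 * (r : ℝ) ^ 2 * (Ch / (2 * Omega N a * 1 * (1 / 3))) := by ring
    _ ≤ _ := by unfold Cr; gcongr

end Constants

/-! ### Stability over long times -/

section Stability

variable {N : ℕ} [NeZero N] {a : ℝ} {r : ℕ} {χ K : ℕ → Poly N}

/-- The growth of the approximate integrals over a time `T` is controlled when
`T r (growth ρ²)^r ≤ 1`. -/
theorem IsNormalForm.abs_eval_HOmega_sub_le (ha : 0 < a) (hr : 1 ≤ r)
    (hb : 48 * ((r : ℝ) + 1) * (Omega N a - 1) ≤ Omega N a) (h : IsNormalForm a r χ K)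
    {z : ℝ → Phase N} (hz : IsOrbit (Ham N a) z) {ρ : ℝ} (hρ : ∀ s, ‖z s‖ ≤ ρ)
    (hu : growth N a r * ρ ^ 2 ≤ 1 / 25) {t : ℝ}
    (ht : |t| * (r * (growth N a r * ρ ^ 2) ^ r) ≤ 1) :
    |eval (fun i => z t i) (HOmega N a) - eval (fun i => z 0 i) (HOmega N a)|
      ≤ 76 * Omega N a * ρ ^ 4 := by
  have hΩ := one_le_Omega (N := N) ha
  have hβ := growth_nonneg (N := N) ha r
  have hr1 : (1 : ℝ) ≤ r := by exact_mod_cast hr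
  have h1 := abs_le.mp (h.abs_actionSum_sub_le ha hr hb (hρ t) hu)
  have h2 := abs_le.mp (h.abs_actionSum_sub_le ha hr hb (hρ 0) hu)
  have h3 := hz.abs_eval_sub_le (fun s => h.abs_poisson_actionSum_le ha hr hb (hρ s)) t
  have hρ4 : 0 ≤ ρ ^ 4 := by positivity
  set u := growth N a r * ρ ^ 2
  have hu0 : 0 ≤ |t| * u ^ r := by positivity
  have h4 : |t| * u ^ r ≤ 1 := by nlinarith
  have h5 : 15 / 4 * Omega N a * (u ^ r * ρ ^ 4) * |t| ≤ 15 / 4 * Omega N a * ρ ^ 4 := by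
    calc _ = 15 / 4 * Omega N a * ρ ^ 4 * (|t| * u ^ r) := by ring
      _ ≤ 15 / 4 * Omega N a * ρ ^ 4 * 1 := by gcongr
      _ = _ := by ring
  have h6 := abs_le.mp (h3.trans h5)
  have h7 : ρ ^ 4 ≤ Omega N a * ρ ^ 4 := le_mul_of_one_le_left hρ4 hΩ
  rw [abs_le]
  constructor <;> linarith [h1.1, h1.2, h2.1, h2.2, h6.1, h6.2]

theorem IsNormalForm.abs_eval_normalZ_sub_le (ha : 0 < a) (hr : 1 ≤ r)
    (hb : 48 * ((r : ℝ) + 1) * (Omega N a - 1) ≤ Omega N a) (h : IsNormalForm a r χ K)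
    {z : ℝ → Phase N} (hz : IsOrbit (Ham N a) z) {ρ : ℝ} (hρ : ∀ s, ‖z s‖ ≤ ρ)
    (hu : growth N a r * ρ ^ 2 ≤ 1 / 25) {t : ℝ}
    (ht : |t| * (r * (growth N a r * ρ ^ 2) ^ r) ≤ 1) :
    |eval (fun i => z t i) (normalZ a r K) - eval (fun i => z 0 i) (normalZ a r K)|
      ≤ 80 * (Omega N a - 1) * ρ ^ 4 + 102 * ρ ^ 6 := by
  have hΩ := one_le_Omega (N := N) ha
  have hβ := growth_nonneg (N := N) ha r
  have hr1 : (1 : ℝ) ≤ r := by exact_mod_cast hr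
  have h1 := abs_le.mp (h.abs_normalCorrections_le ha hr hb (hρ t) hu)
  have h2 := abs_le.mp (h.abs_normalCorrections_le ha hr hb (hρ 0) hu)
  have h3 := hz.abs_eval_sub_le (fun s => h.abs_poisson_normalZ_le ha hr hb (hρ s) hu) t
  set u := growth N a r * ρ ^ 2
  set b := Omega N a - 1
  have hb0 : 0 ≤ b := sub_nonneg.mpr hΩ
  have hu0 : 0 ≤ |t| * u ^ r := by positivity
  have h4 : |t| * u ^ r ≤ 1 := by nlinarith
  have h5 : (8 * b * (u ^ r * ρ ^ 4) + 6 * (r * u ^ r * ρ ^ 6)) * |t|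
      ≤ 8 * b * ρ ^ 4 + 6 * ρ ^ 6 := by
    calc _ = 8 * b * ρ ^ 4 * (|t| * u ^ r) + 6 * ρ ^ 6 * (|t| * (r * u ^ r)) := by ring
      _ ≤ 8 * b * ρ ^ 4 * 1 + 6 * ρ ^ 6 * 1 := by gcongr
      _ = _ := by ring
  have h6 := h3.trans h5
  rw [map_add, map_add] at h6
  replace h6 := abs_le.mp h6
  rw [abs_le]
  constructor <;> linarith [h1.1, h1.2, h2.1, h2.2, h6.1, h6.2]

/-- The admissible times are shorter than the time scale of the drift. -/
theorem mul_order_mul_pow_le_one {T c y u : ℝ} (hc : 15 / 64 ≤ c) (hy : 0 < y) (hu0 : 0 ≤ u)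
    (hu : 5 * u ≤ y) (hr : 1 ≤ r) (hT : T ≤ 1 / c * (y ^ r)⁻¹) : T * (r * u ^ r) ≤ 1 := by
  obtain ⟨n, rfl⟩ : ∃ n, r = n + 1 := ⟨r - 1, by omega⟩
  have h1 : ((n + 1 : ℕ) : ℝ) ≤ 5 ^ n := by
    exact_mod_cast (Nat.lt_pow_self (n := n) (by norm_num : 1 < 5))
  have h2 : (5 : ℝ) ^ (n + 1) * u ^ (n + 1) ≤ y ^ (n + 1) := by
    rw [← mul_pow]; gcongr
  have h3 : 5 * (((n + 1 : ℕ) : ℝ) * u ^ (n + 1)) ≤ y ^ (n + 1) := by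
    calc _ ≤ 5 * (5 ^ n * u ^ (n + 1)) := by gcongr
      _ = 5 ^ (n + 1) * u ^ (n + 1) := by ring
      _ ≤ _ := h2
  have h4 : 0 < y ^ (n + 1) := by positivity
  calc _ ≤ 1 / c * (y ^ (n + 1))⁻¹ * (((n + 1 : ℕ) : ℝ) * u ^ (n + 1)) := by gcongr
    _ ≤ 1 / c * (y ^ (n + 1))⁻¹ * (y ^ (n + 1) / 5) := by
        gcongr
        linarith
    _ = 1 / (5 * c) := by field_simp
    _ ≤ 1 := by rw [div_le_one (by positivity)]; linarith

end Stability

end KGChain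

end

theorem corollary1 :
    ∃ C : ℝ, 0 < C ∧
      ∀ (N : ℕ) [NeZero N] (a : ℝ), 0 < a →
      -- small coupling: `σ_* = σ_0 / 4` is an admissible choice
      Real.log 4 ≤ KGChain.sigmaStar a →
      -- `C_{ζ_0}`, `C_{h_1}`: constants of the decay classes of seeds of `Z_0` and `H_1`
      ∀ (Cζ Ch : ℝ) (ζ h : ℕ → KGChain.Poly N),
      KGChain.IsDecayingSeed 2 Cζ (KGChain.sigma0 a) ζ (KGChain.Z0 N a) → ζ 0 = 0 →
      KGChain.IsDecayingSeed 4 Ch (KGChain.sigma1 a) h (KGChain.H1 N a) →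
      -- the order of the normal form
      ∀ r : ℕ, 1 ≤ r → (r : ℝ) < 1 / 2 * (KGChain.muStar N a Cζ / KGChain.mu a) →
      (∃ χ K : ℕ → KGChain.Poly N, KGChain.IsNormalForm a r χ K) ∧
      ∀ χ K : ℕ → KGChain.Poly N, KGChain.IsNormalForm a r χ K →
      -- the radius
      ∀ R : ℝ, 0 < R → R ^ 2 < 2 / (3 * (1 + Real.exp 1) * KGChain.Cr N a Cζ Ch r) →
      -- the orbit
      ∀ z : ℝ → KGChain.Phase N, KGChain.IsOrbit (KGChain.Ham N a) z → ‖z 0‖ ≤ R / 9 →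
      ∀ t : ℝ, |t| ≤ C * (1 - Real.exp (-KGChain.sigmaStar a)) ^ 2 / Ch
          * ((R ^ 2 * KGChain.Cr N a Cζ Ch r) ^ r)⁻¹ →
      |MvPolynomial.eval (fun i => z t i) (KGChain.HOmega N a)
          - MvPolynomial.eval (fun i => z 0 i) (KGChain.HOmega N a)|
        ≤ KGChain.Omega N a * R ^ 4 ∧
      |MvPolynomial.eval (fun i => z t i) (KGChain.normalZ a r K)
          - MvPolynomial.eval (fun i => z 0 i) (KGChain.normalZ a r K)|
        ≤ R ^ 4 * (Cζ * KGChain.mu a + Ch * R ^ 2) := by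
  refine ⟨1, one_pos, fun N _ a ha hσ Cζ Ch ζ h hζ hζ0 hh r hr1 hr => ?_⟩
  have hb := KGChain.nonresonance ha hσ hζ hζ0 hr1 hr
  refine ⟨KGChain.exists_isNormalForm ha hb, fun χ K hK R hR hR2 z hz hz0 t ht => ?_⟩
  have hΩ1 := KGChain.one_le_Omega (N := N) ha
  have hΩ : KGChain.Omega N a ≤ 255 / 254 := by
    have h1 := KGChain.Omega_le (N := N) ha
    have h2 := KGChain.coupling_le ha hσ
    linarith
  have hCh := KGChain.le_of_isDecayingSeed_H1 ha hσ hh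
  have hCr := KGChain.le_Cr (N := N) ha hσ hζ.C_pos hh.C_pos hr
  have hr2 : (1 : ℝ) ≤ r := by exact_mod_cast hr1
  have hr3 : (1 : ℝ) ≤ (r : ℝ) ^ 2 := one_le_pow₀ hr2
  have hCr0 : 0 < KGChain.Cr N a Cζ Ch r := lt_of_lt_of_le (by positivity) hCr
  set y := R ^ 2 * KGChain.Cr N a Cζ Ch r with hy
  have hy0 : 0 < y := by positivity
  have hy1 : y ≤ 1 / 5 := by
    have h1 := Real.exp_one_gt_d9
    rw [lt_div_iff₀ (by positivity)] at hR2
    have h2 : 3 * (1 + Real.exp 1) * y < 2 := by rw [hy]; linarith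
    nlinarith
  have hyle : 96 * (r : ℝ) ^ 2 * Ch / KGChain.Omega N a * R ^ 2 ≤ y := by
    rw [hy, mul_comm (R ^ 2)]
    gcongr
  have hR3 : R ^ 2 ≤ 1 / 100 := by
    have h1 : 96 * 1 * (15 / 64) / (255 / 254) * R ^ 2 ≤ y := by
      refine le_trans ?_ hyle
      gcongr
    linarith
  have hu : 5 * (KGChain.growth N a r * (R / 8) ^ 2) ≤ y := by
    refine le_trans ?_ hyle
    calc _ = 20 * (r : ℝ) ^ 2 * 1 / KGChain.Omega N a * R ^ 2 := by
          rw [KGChain.growth]; ring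
      _ ≤ 20 * (r : ℝ) ^ 2 * (24 / 5 * Ch) / KGChain.Omega N a * R ^ 2 := by
          gcongr
          linarith
      _ = _ := by ring
  have hu0 : 0 ≤ KGChain.growth N a r * (R / 8) ^ 2 :=
    mul_nonneg (KGChain.growth_nonneg ha r) (by positivity)
  have hT : |t| ≤ 1 / Ch * (y ^ r)⁻¹ := by
    refine ht.trans ?_
    have h1 := Real.exp_pos (-KGChain.sigmaStar a)
    have h2 : Real.exp (-KGChain.sigmaStar a) < 1 :=
      Real.exp_lt_one_iff.mpr (neg_lt_zero.mpr (KGChain.sigmaStar_pos hσ))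
    have h3 : (1 - Real.exp (-KGChain.sigmaStar a)) ^ 2 ≤ 1 :=
      pow_le_one₀ (by linarith) (by linarith)
    have h4 := hh.C_pos
    gcongr
    linarith
  have hT' := KGChain.mul_order_mul_pow_le_one hCh hy0 hu0 hu hr1 hT
  have hρ := fun s => hz.norm_le ha hΩ hR3 hz0 s
  refine ⟨(hK.abs_eval_HOmega_sub_le ha hr1 hb hz hρ (by linarith) hT').trans ?_,
    (hK.abs_eval_normalZ_sub_le ha hr1 hb hz hρ (by linarith) hT').trans ?_⟩
  · have h1 : 0 ≤ KGChain.Omega N a * R ^ 4 := by positivity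
    calc _ = 76 / 4096 * (KGChain.Omega N a * R ^ 4) := by ring
      _ ≤ _ := by linarith
  · have h1 := KGChain.Omega_sub_one_le ha hσ hζ hζ0
    have h2 : 80 / 4096 * (KGChain.Omega N a - 1) ≤ Cζ * KGChain.mu a := by
      linarith [mul_pos hζ.C_pos (KGChain.mu_pos ha)]
    have h3 : 102 / 262144 ≤ Ch := by linarith
    calc _ = R ^ 4 * (80 / 4096 * (KGChain.Omega N a - 1) + 102 / 262144 * R ^ 2) := by ring
      _ ≤ _ := by gcongr
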